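/- Let $S^2$ be the unit sphere in $\mathbb R^3$. For points $a_1,\dots,a_n,b_1,\dots,b_n\in S^2$, the crossing graph of the geodesic drawing of $K_{n,n}$ with these parts has the $n^2$ geodesic segments $a_ib_j$ as vertices, two of them being adjacent if they cross. For probability measures $\mu_1,\mu_2$ on $S^2$, a graphon $W:[0,1]^2\to[0,1]$ (symmetric, measurable) is denoted $W(\mu_1,\mu_2)$ if it is the limit, with probability $1$, as $n\to\infty$, of the crossing graphs of the drawings with $n$ independent $\mu_1$-random points $a_i$ and $n$ independent $\mu_2$-random points $b_j$; that is, the homomorphism densities of every finite graph $H$ converge to $t(H,W)$. Let $v_1,v_2,w_1,w_2\in S^2$ be such that no three of them lie on a common great circle. For $0<r<\pi/2$ let $\mu_1$ be the uniform distribution on the four circles of spherical radius $r$ centred at $\pm v_1,\pm v_2$, and $\mu_2$ the uniform distribution on the four circles of radius $r$ centred at $\pm w_1,\pm w_2$. Then the following hold, where the constants implied in $O(r)$ may depend on $v_1,v_2,w_1,w_2$. (1) The graphon $W(\mu_1,\mu_2)$ exists, and $$\frac{83}{3\cdot 2^{12}}+O(r)\le t(K_3,W(\mu_1,\mu_2))\le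 \frac{1}{3\cdot 2^5}+O(r).$$ (2) These bounds are best possible: if a constant $c$ is such that $c+O(r)\le t(K_3,W(\mu_1,\mu_2))$ for all $v_1,v_2,w_1,w_2$ as above, then $c\le \frac{83}{3\cdot 2^{12}}$; and if $t(K_3,W(\mu_1,\mu_2))\le c+O(r)$ for all of them, then $c\ge\frac1{3\cdot 2^5}$. (3) The limiting triangle density depends on angles as follows. If the labels and signs are chosen such that the geodesic segments $v_1w_2$ and $v_2w_1$ cross, and $\alpha,\beta,\gamma,\delta$ are the angles between the geodesics to $v_2,v_1$ at $w_2$, to $w_2,w_1$ at $v_2$, to $w_1,w_2$ at $v_1$, and to $v_1,v_2$ at $w_1$, respectively, then $$t(K_3,W(\mu_1,\mu_2))=\frac{3}{2^{12}\pi^2}\Bigl((2\pi-\alpha-\delta)(2\pi-\gamma-\beta)+2(\alpha^2+\beta^2+\gamma^2+\delta^2)-2\pi(\alpha+\beta+\gamma+\delta)\Bigr)+\frac{23}{3\cdot 2^{10}}+O(r).$$ (4) Every $x\in\bigl(\frac{83}{12288},\frac{128}{12288}\bigr)$ is attained: for some $v_1,v_2,w_1,w_2$ as above, $t(K_3,W(\mu_1,\mu_2))\to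 x$ as $r\to0$; moreover, for every sufficiently small $r>0$ (depending on $x$) there are $v_1,v_2,w_1,w_2$ as above with $t(K_3,W(\mu_1,\mu_2))=x$ exactly. -/

import Mathlib

open Real Set Filter Topology MeasureTheory ProbabilityTheory
open scoped ENNReal unitInterval

noncomputable section

/-! ### Graph limits -/

/-- A graphon: a symmetric measurable function `[0,1]² → [0,1]`. -/
structure Graphon where
  toFun : I → I → ℝ
  measurable_toFun : Measurable (Function.uncurry toFun)
  symm : ∀ x y, toFun x y = toFun y x
  nonneg : ∀ x y, 0 ≤ toFun x y
  le_one : ∀ x y, toFun x y ≤ 1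

/-- The value of a graphon on a pair of points given by an edge of `H` and a labelling of the
vertices of `H` by points of `[0,1]`. -/
def Graphon.edgeWeight (W : Graphon) {V : Type*} (x : V → I) (e : Sym2 V) : ℝ :=
  Sym2.lift ⟨fun i j => W.toFun (x i) (x j), fun _ _ => W.symm _ _⟩ e

open Classical in
/-- The homomorphism density `t(H, W) = ∫ ∏_{ij ∈ E(H)} W(x_i, x_j) dx` of a graph `H` in a
graphon `W`. -/
def Graphon.homDensity {V : Type*} [Fintype V] (H : SimpleGraph V) (W : Graphon) : ℝ :=
  ∫ x : V → I, ∏ e ∈ H.edgeFinset, W.edgeWeight x e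

/-- The homomorphism density `t(H, G) = hom(H, G) / |G|^|H|` of a finite graph `H` in a finite
graph `G`. -/
def SimpleGraph.homDensity {V V' : Type*} (H : SimpleGraph V) (G : SimpleGraph V') : ℝ :=
  (Nat.card (H →g G) : ℝ) / (Nat.card V' : ℝ) ^ Nat.card V

/-- A sequence of finite graphs converges to the graphon `W`: all homomorphism densities
converge to those of `W`. -/
def GraphsTendsTo {V : ℕ → Type*} (X : ∀ n, SimpleGraph (V n)) (W : Graphon) : Prop :=
  ∀ (k : ℕ) (H : SimpleGraph (Fin k)),
    Tendsto (fun n => SimpleGraph.homDensity H (X n)) atTop (𝓝 (Graphon.homDensity H W))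

/-! ### Geodesic drawings of complete bipartite graphs on the sphere -/

/-- Euclidean space `ℝ³`. -/
abbrev E3 : Type := EuclideanSpace ℝ (Fin 3)

/-- The unit sphere in `ℝ³`. -/
abbrev S2 : Type := Metric.sphere (0 : E3) 1

/-- The relative interior of the geodesic segment joining two non-antipodal points `u`, `v` of
the sphere. -/
def openGeodesic (u v : S2) : Set S2 :=
  {p | ∃ s t : ℝ, 0 < s ∧ 0 < t ∧ (p : E3) = s • (u : E3) + t • (v : E3)}

/-- The geodesic segments `ab` and `cd` cross. -/
def SegmentsCross (a b c d : S2) : Prop :=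
  (openGeodesic a b ∩ openGeodesic c d).Nonempty

/-- The crossing graph of the geodesic drawing of `K_{n,n}` with parts `a₁, …, aₙ` and
`b₁, …, bₙ`. Its vertices are the `n²` edges `aᵢbⱼ`, and two of them are adjacent when they
cross. -/
def crossingGraph {n : ℕ} (a b : Fin n → S2) : SimpleGraph (Fin n × Fin n) where
  Adj e f := e ≠ f ∧ SegmentsCross (a e.1) (b e.2) (a f.1) (b f.2)
  symm := ⟨fun _ _ h => ⟨h.1.symm, by
    have h2 := h.2
    unfold SegmentsCross at h2 ⊢
    rwa [Set.inter_comm] at h2⟩⟩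
  loopless := ⟨fun _ h => h.1 rfl⟩

/-- `W` is the limit of the crossing graphs of `(μ₁, μ₂)`-random drawings: whenever for every `n`
the parts `a n`, `b n` consist of `n` independent `μ₁`-random points and `n` independent
`μ₂`-random points (independent of each other; the dependence between different `n` is
arbitrary), the crossing graphs converge to `W` with probability one. -/
def IsCrossingGraphon (μ₁ μ₂ : Measure S2) (W : Graphon) : Prop :=
  ∀ (Ω : Type) [MeasurableSpace Ω] (P : Measure Ω) [IsProbabilityMeasure P]
    (a b : ∀ n : ℕ, Ω → Fin n → S2),
    (∀ n, HasLaw (fun ω => (a n ω, b n ω))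
      ((Measure.pi fun _ : Fin n => μ₁).prod (Measure.pi fun _ : Fin n => μ₂)) P) →
    ∀ᵐ ω ∂P, GraphsTendsTo (fun n => crossingGraph (a n ω) (b n ω)) W

/-! ### Uniform distributions on pairs of antipodal circles -/

/-- An orthonormal basis of the plane orthogonal to `c`. -/
def circleFrame (c : S2) : OrthonormalBasis (Fin 2) ℝ (Submodule.span ℝ {(c : E3)})ᗮ :=
  haveI : Fact (Module.finrank ℝ E3 = 2 + 1) := ⟨by simp⟩
  OrthonormalBasis.fromOrthogonalSpanSingleton 2 (ne_zero_of_mem_unit_sphere c)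

/-- The point with angular coordinate `θ` on the circle of (spherical) radius `r` on the sphere
with centre `c`. -/
def circlePoint (c : S2) (r θ : ℝ) : S2 :=
  ⟨cos r • (c : E3) + sin r • (cos θ • (circleFrame c 0 : E3) + sin θ • (circleFrame c 1 : E3)), by
    have hc : ‖(c : E3)‖ = 1 := by simp
    have h0 : ‖(circleFrame c 0 : E3)‖ = 1 := (circleFrame c).orthonormal.1 0
    have h1 : ‖(circleFrame c 1 : E3)‖ = 1 := (circleFrame c).orthonormal.1 1
    have h01 : inner ℝ (circleFrame c 0 : E3) (circleFrame c 1 : E3) = 0 :=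
      (circleFrame c).orthonormal.2 (show (0 : Fin 2) ≠ 1 by decide)
    have hc0 : inner ℝ (c : E3) (circleFrame c 0 : E3) = 0 :=
      Submodule.mem_orthogonal_singleton_iff_inner_right.1 (circleFrame c 0).2
    have hc1 : inner ℝ (c : E3) (circleFrame c 1 : E3) = 0 :=
      Submodule.mem_orthogonal_singleton_iff_inner_right.1 (circleFrame c 1).2
    have hsq : ‖cos r • (c : E3) + sin r •
        (cos θ • (circleFrame c 0 : E3) + sin θ • (circleFrame c 1 : E3))‖ ^ 2 = 1 := by
      rw [norm_add_sq_real, norm_smul, norm_smul, mul_pow, mul_pow, norm_add_sq_real, norm_smul,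
        norm_smul, mul_pow, mul_pow]
      simp only [inner_smul_left, inner_smul_right, inner_add_right, h01, hc0, hc1, hc, h0, h1,
        Real.norm_eq_abs, sq_abs]
      simp [Real.cos_sq_add_sin_sq]
    rw [mem_sphere_zero_iff_norm]
    exact (pow_eq_one_iff_of_nonneg (norm_nonneg _) two_ne_zero).1 hsq⟩

/-- The uniform distribution on the circle of radius `r` on the sphere with centre `c`. -/
def circleMeasure (c : S2) (r : ℝ) : Measure S2 :=
  (volume[|Set.Ico (0 : ℝ) (2 * π)]).map (circlePoint c r)

/-- The uniform distribution on the union of the two pairs of antipodal circles of radius `r` with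
centres `±c₁` and `±c₂`. -/
def circlePairsMeasure (c₁ c₂ : S2) (r : ℝ) : Measure S2 :=
  (4 : ℝ≥0∞)⁻¹ • (circleMeasure c₁ r + circleMeasure (-c₁) r
    + circleMeasure c₂ r + circleMeasure (-c₂) r)

/-- The centres `±v₁, ±v₂` and `±w₁, ±w₂` are the vertices of a (non-degenerate) geodesic drawing
of `K_{4,4}`: no great circle contains three of `v₁, v₂, w₁, w₂`. -/
def CentresInGeneralPosition (v₁ v₂ w₁ w₂ : S2) : Prop :=
  LinearIndependent ℝ ![(v₁ : E3), (v₂ : E3), (w₁ : E3)] ∧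
  LinearIndependent ℝ ![(v₁ : E3), (v₂ : E3), (w₂ : E3)] ∧
  LinearIndependent ℝ ![(v₁ : E3), (w₁ : E3), (w₂ : E3)] ∧
  LinearIndependent ℝ ![(v₂ : E3), (w₁ : E3), (w₂ : E3)]

/-- `W` is the graphon `W(μ₁, μ₂)` where `μ₁` and `μ₂` are uniform on the circles of radius `r`
around `±v₁, ±v₂` and around `±w₁, ±w₂`, respectively. -/
def IsCircleGraphon (v₁ v₂ w₁ w₂ : S2) (r : ℝ) (W : Graphon) : Prop :=
  IsCrossingGraphon (circlePairsMeasure v₁ v₂ r) (circlePairsMeasure w₁ w₂ r) W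

/-- The triangle density `t(K₃, W)`. -/
def triangleDensity (W : Graphon) : ℝ :=
  Graphon.homDensity (⊤ : SimpleGraph (Fin 3)) W

/-- The angle at `p` between the geodesics from `p` to `x` and from `p` to `y`. -/
def sphericalAngle (x p y : S2) : ℝ :=
  InnerProductGeometry.angle ((x : E3) - inner ℝ (p : E3) (x : E3) • (p : E3))
    ((y : E3) - inner ℝ (p : E3) (y : E3) • (p : E3))

/-- The limiting triangle density as a function of the angles. -/
def angleDensity (α β γ δ : ℝ) : ℝ :=
  3 / (2 ^ 12 * π ^ 2) * ((2 * π - α - δ) * (2 * π - γ - β)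
    + 2 * (α ^ 2 + β ^ 2 + γ ^ 2 + δ ^ 2) - 2 * π * (α + β + γ + δ)) + 23 / (3 * 2 ^ 10)

end

/-! ### Uniform measures on finite types -/

/-- The uniform probability measure on a finite type. -/
noncomputable def finUniform (ι : Type*) [Fintype ι] [MeasurableSpace ι] : Measure ι :=
  (Fintype.card ι : ℝ≥0∞)⁻¹ • Measure.count

section FinUniform

variable {ι κ : Type*} [Fintype ι] [MeasurableSpace ι] [MeasurableSingletonClass ι]
  [Fintype κ] [MeasurableSpace κ] [MeasurableSingletonClass κ]

instance [Nonempty ι] : IsProbabilityMeasure (finUniform ι) := by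
  constructor
  have h : (Fintype.card ι : ℝ≥0∞) ≠ 0 := by simp [Fintype.card_ne_zero]
  simp only [finUniform, Measure.smul_apply, Measure.count_univ, smul_eq_mul]
  rw [ENat.card_eq_coe_fintype_card]
  exact ENNReal.inv_mul_cancel h (by simp)

instance : IsFiniteMeasure (finUniform ι) := by
  rcases isEmpty_or_nonempty ι with h | h
  · exact ⟨by simp [Set.univ_eq_empty_iff.2 h]⟩
  · infer_instance

theorem finUniform_singleton (i : ι) : finUniform ι {i} = (Fintype.card ι : ℝ≥0∞)⁻¹ := by
  simp [finUniform]

theorem integral_finUniform (f : ι → ℝ) :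
    ∫ i, f i ∂finUniform ι = (Fintype.card ι : ℝ)⁻¹ * ∑ i, f i := by
  rw [finUniform, integral_smul_measure, integral_count]
  simp

theorem finUniform_prod : (finUniform ι).prod (finUniform κ) = finUniform (ι × κ) := by
  refine Measure.ext_of_singleton fun x => ?_
  rw [finUniform_singleton, ← Set.singleton_prod_singleton (a := x.1) (b := x.2), Measure.prod_prod,
    finUniform_singleton, finUniform_singleton, Fintype.card_prod, Nat.cast_mul,
    ENNReal.mul_inv (by simp) (by simp)]

omit [MeasurableSpace κ] [MeasurableSingletonClass κ] in
theorem finUniform_pi [DecidableEq κ] :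
    Measure.pi (fun _ : κ => finUniform ι) = finUniform (κ → ι) := by
  refine Measure.ext_of_singleton fun x => ?_
  rw [finUniform_singleton, Measure.pi_singleton]
  simp [finUniform_singleton, ENNReal.inv_pow]

theorem finUniform_real_apply (s : Set ι) :
    (finUniform ι).real s = (Nat.card s : ℝ) / Nat.card ι := by
  classical
  have h : (finUniform ι).real s = ∫ i, s.indicator 1 i ∂finUniform ι :=
    (integral_indicator_one (Set.toFinite s).measurableSet).symm
  rw [h, integral_finUniform, Nat.card_eq_fintype_card (α := ι), inv_mul_eq_div]
  congr 1
  rw [Nat.card_eq_card_toFinset, Finset.card_eq_sum_ones, Nat.cast_sum]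
  simp [Set.indicator_apply]

end FinUniform

/-! ### Almost sure weak convergence of empirical measures -/

section Empirical

variable {X : Type*} [MeasurableSpace X]

theorem measure_abs_average_sub_integral_le (μ : Measure X) [IsProbabilityMeasure μ]
    {f : X → ℝ} (hf : Measurable f) {B : ℝ} (hB : ∀ x, |f x| ≤ B) (hB0 : 0 < B) {ε : ℝ}
    (hε : 0 < ε) {n : ℕ} (hn : 0 < n) :
    (Measure.pi fun _ : Fin n => μ).real {x | ε ≤ |(n : ℝ)⁻¹ * ∑ i, f (x i) - ∫ y, f y ∂μ|}
      ≤ 2 * rexp (-(ε ^ 2 / (2 * B ^ 2)) * n) := by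
  set P := Measure.pi fun _ : Fin n => μ
  have key : ∀ g : X → ℝ, Measurable g → (∀ x, |g x| ≤ B) →
      P.real {x | ε * n ≤ ∑ i, (g (x i) - ∫ y, g y ∂μ)} ≤ rexp (-(ε ^ 2 / (2 * B ^ 2)) * n) := by
    intro g hg hgB
    have hind : iIndepFun (fun (i : Fin n) (x : Fin n → X) => g (x i) - ∫ y, g y ∂μ) P :=
      iIndepFun_pi (X := fun _ y => g y - ∫ y, g y ∂μ) fun _ => (hg.sub_const _).aemeasurable
    have hsub : ∀ i ∈ (Finset.univ : Finset (Fin n)),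
        HasSubgaussianMGF (fun x : Fin n → X => g (x i) - ∫ y, g y ∂μ)
          ((‖B - (-B)‖₊ / 2) ^ 2) P := by
      intro i _
      have h := hasSubgaussianMGF_of_mem_Icc (μ := P) (X := fun x : Fin n → X => g (x i))
        (a := -B) (b := B) (hg.comp (measurable_pi_apply i)).aemeasurable
        (ae_of_all _ fun x => abs_le.1 (hgB _))
      have h2 : ∫ x, g (x i) ∂P = ∫ y, g y ∂μ :=
        integral_comp_eval (μ := fun _ : Fin n => μ) (i := i) hg.aestronglyMeasurable
      rwa [h2] at h
    have h := HasSubgaussianMGF.measure_sum_ge_le_of_iIndepFun hind hsub (ε := ε * n) (by positivity)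
    refine h.trans (le_of_eq ?_)
    congr 1
    have hc : (((‖B - (-B)‖₊ / 2) ^ 2 : NNReal) : ℝ) = B ^ 2 := by
      simp only [sub_neg_eq_add, NNReal.coe_pow, NNReal.coe_div, coe_nnnorm, Real.norm_eq_abs,
        NNReal.coe_ofNat]
      rw [abs_of_pos (by linarith)]; ring
    rw [Finset.sum_const, Finset.card_univ, Fintype.card_fin, nsmul_eq_mul, NNReal.coe_mul, hc,
      NNReal.coe_natCast]
    have : (n : ℝ) ≠ 0 := by positivity
    field_simp
  have h1 := key f hf hB
  have h2 := key (fun x => -f x) hf.neg (fun x => by rw [abs_neg]; exact hB x)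
  have hsub : {x : Fin n → X | ε ≤ |(n : ℝ)⁻¹ * ∑ i, f (x i) - ∫ y, f y ∂μ|} ⊆
      {x | ε * n ≤ ∑ i, (f (x i) - ∫ y, f y ∂μ)} ∪
      {x | ε * n ≤ ∑ i, (-f (x i) - ∫ y, -f y ∂μ)} := by
    intro x hx
    have hn' : (0 : ℝ) < n := by positivity
    have e1 : ∑ i, (f (x i) - ∫ y, f y ∂μ) = ((n : ℝ)⁻¹ * ∑ i, f (x i) - ∫ y, f y ∂μ) * n := by
      rw [Finset.sum_sub_distrib]; simp; field_simp
    have e2 : ∑ i, (-f (x i) - ∫ y, -f y ∂μ) =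
        -((n : ℝ)⁻¹ * ∑ i, f (x i) - ∫ y, f y ∂μ) * n := by
      rw [neg_mul, ← e1, integral_neg, ← Finset.sum_neg_distrib]
      exact Finset.sum_congr rfl fun i _ => by ring
    simp only [Set.mem_union, Set.mem_ofPred_eq, e1, e2] at hx ⊢
    rcases le_abs.1 hx with h | h
    · exact Or.inl (mul_le_mul_of_nonneg_right h hn'.le)
    · exact Or.inr (mul_le_mul_of_nonneg_right h hn'.le)
  calc P.real _ ≤ P.real _ := measureReal_mono hsub
    _ ≤ _ + _ := measureReal_union_le _ _
    _ ≤ _ := by linarith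

theorem ae_tendsto_average (μ : Measure X) [IsProbabilityMeasure μ] {Ω : Type*}
    [MeasurableSpace Ω] {P : Measure Ω} [IsProbabilityMeasure P] {a : ∀ n : ℕ, Ω → Fin n → X}
    (ha : ∀ n, HasLaw (a n) (Measure.pi fun _ : Fin n => μ) P)
    {f : X → ℝ} (hf : Measurable f) {B : ℝ} (hB : ∀ x, |f x| ≤ B) :
    ∀ᵐ ω ∂P, Tendsto (fun n : ℕ => (n : ℝ)⁻¹ * ∑ i, f (a n ω i)) atTop (𝓝 (∫ y, f y ∂μ)) := by
  obtain ⟨B, hB, hB0⟩ : ∃ B, (∀ x, |f x| ≤ B) ∧ 0 < B :=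
    ⟨max B 1, fun x => (hB x).trans (le_max_left _ _), by positivity⟩
  have key : ∀ ε : ℝ, 0 < ε →
      ∀ᵐ ω ∂P, ∀ᶠ n : ℕ in atTop, |(n : ℝ)⁻¹ * ∑ i, f (a n ω i) - ∫ y, f y ∂μ| < ε := by
    intro ε hε
    set S : ∀ n : ℕ, Set (Fin n → X) := fun n =>
      {x | ε ≤ |(n : ℝ)⁻¹ * ∑ i, f (x i) - ∫ y, f y ∂μ|}
    have hS : ∀ n, MeasurableSet (S n) := fun n => by
      refine measurableSet_le measurable_const ?_
      have : Measurable fun x : Fin n → X => (n : ℝ)⁻¹ * ∑ i, f (x i) - ∫ y, f y ∂μ := by fun_prop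
      exact this.abs
    have hPS : ∀ n, P (a n ⁻¹' S n) = (Measure.pi fun _ : Fin n => μ) (S n) := fun n => by
      rw [← (ha n).map_eq, Measure.map_apply_of_aemeasurable (ha n).aemeasurable (hS n)]
    have hq : rexp (-(ε ^ 2 / (2 * B ^ 2))) < 1 := by
      rw [Real.exp_lt_one_iff]
      have : 0 < ε ^ 2 / (2 * B ^ 2) := by positivity
      linarith
    have hsum : Summable fun n : ℕ => (Measure.pi fun _ : Fin n => μ).real (S n) := by
      have hg : Summable fun n : ℕ => 2 * rexp (-(ε ^ 2 / (2 * B ^ 2))) ^ n :=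
        (summable_geometric_of_lt_one (exp_pos _).le hq).mul_left 2
      rw [← summable_nat_add_iff 1] at hg ⊢
      refine Summable.of_nonneg_of_le (fun _ => measureReal_nonneg) (fun n => ?_) hg
      have := measure_abs_average_sub_integral_le μ hf hB hB0 hε (n := n + 1) (by omega)
      rwa [mul_comm (-(ε ^ 2 / (2 * B ^ 2))), Real.exp_nat_mul] at this
    have hfin : ∑' n, P (a n ⁻¹' S n) ≠ ∞ := by
      simp_rw [hPS]
      have : ∀ n, (Measure.pi fun _ : Fin n => μ) (S n) =
          ENNReal.ofReal ((Measure.pi fun _ : Fin n => μ).real (S n)) := fun n => by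
        rw [ofReal_measureReal]
      simp_rw [this]
      exact hsum.tsum_ofReal_ne_top
    filter_upwards [ae_eventually_notMem hfin] with ω hω
    filter_upwards [hω] with n hn
    exact not_le.1 hn
  have hall : ∀ᵐ ω ∂P, ∀ k : ℕ, ∀ᶠ n : ℕ in atTop,
      |(n : ℝ)⁻¹ * ∑ i, f (a n ω i) - ∫ y, f y ∂μ| < 1 / (k + 1 : ℝ) :=
    ae_all_iff.2 fun k => key _ Nat.one_div_pos_of_nat
  filter_upwards [hall] with ω hω
  rw [Metric.tendsto_atTop']
  intro ε hε
  obtain ⟨k, hk⟩ := exists_nat_one_div_lt hε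
  obtain ⟨N, hN⟩ := eventually_atTop.1 (hω k)
  exact ⟨N, fun n hn => by rw [Real.dist_eq]; exact (hN n hn.le).trans hk⟩

/-- The empirical distribution of `n + 1` points. -/
noncomputable def empiricalMeasure {n : ℕ} (x : Fin (n + 1) → X) : ProbabilityMeasure X :=
  ⟨(finUniform (Fin (n + 1))).map x,
    Measure.isProbabilityMeasure_map (measurable_of_countable x).aemeasurable⟩

theorem integral_empiricalMeasure {n : ℕ} (x : Fin (n + 1) → X) {f : X → ℝ} (hf : Measurable f) :
    ∫ y, f y ∂(empiricalMeasure x : Measure X) = ((n + 1 : ℕ) : ℝ)⁻¹ * ∑ i, f (x i) := by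
  change ∫ y, f y ∂((finUniform (Fin (n + 1))).map x) = _
  rw [integral_map (measurable_of_countable x).aemeasurable hf.aestronglyMeasurable,
    integral_finUniform]
  simp

variable [TopologicalSpace X] [CompactSpace X] [BorelSpace X] [SecondCountableTopology X]
  [T2Space X]

theorem ae_tendsto_empiricalMeasure (μ : ProbabilityMeasure X) {Ω : Type*}
    [MeasurableSpace Ω] {P : Measure Ω} [IsProbabilityMeasure P] {a : ∀ n : ℕ, Ω → Fin n → X}
    (ha : ∀ n, HasLaw (a n) (Measure.pi fun _ : Fin n => (μ : Measure X)) P) :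
    ∀ᵐ ω ∂P, Tendsto (fun n : ℕ => empiricalMeasure (a (n + 1) ω)) atTop (𝓝 μ) := by
  have hall : ∀ᵐ ω ∂P, ∀ k : ℕ, Tendsto (fun n : ℕ => (n : ℝ)⁻¹ * ∑ i,
      TopologicalSpace.denseSeq C(X, ℝ) k (a n ω i)) atTop
      (𝓝 (∫ y, TopologicalSpace.denseSeq C(X, ℝ) k y ∂(μ : Measure X))) := by
    refine ae_all_iff.2 fun k => ?_
    exact ae_tendsto_average (μ : Measure X) ha (ContinuousMap.measurable _)
      (fun x => (TopologicalSpace.denseSeq C(X, ℝ) k).norm_coe_le_norm x)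
  filter_upwards [hall] with ω hω
  rw [ProbabilityMeasure.tendsto_iff_forall_integral_tendsto]
  intro f
  have hmeas : ∀ g : C(X, ℝ), Measurable g := fun g => g.continuous.measurable
  have hint : ∀ (ν : ProbabilityMeasure X) (g : C(X, ℝ)), Integrable g (ν : Measure X) :=
    fun ν g => Integrable.of_bound (hmeas g).aestronglyMeasurable ‖g‖
      (ae_of_all _ fun x => g.norm_coe_le_norm x)
  have hclose : ∀ (ν : ProbabilityMeasure X) (g h : C(X, ℝ)),
      |∫ x, g x ∂(ν : Measure X) - ∫ x, h x ∂(ν : Measure X)| ≤ dist g h := by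
    intro ν g h
    rw [← integral_sub (hint ν g) (hint ν h)]
    have := norm_integral_le_of_norm_le_const (μ := (ν : Measure X)) (C := dist g h)
      (f := fun x => g x - h x) (ae_of_all _ fun x => by
        rw [Real.norm_eq_abs, ← Real.dist_eq]
        exact ContinuousMap.dist_apply_le_dist x)
    simpa using this
  rw [Metric.tendsto_atTop]
  intro ε hε
  obtain ⟨k, hk⟩ := (TopologicalSpace.denseRange_denseSeq C(X, ℝ)).exists_dist_lt
    f.toContinuousMap (show 0 < ε / 3 by positivity)
  set g := TopologicalSpace.denseSeq C(X, ℝ) k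
  have hk' := (tendsto_add_atTop_iff_nat 1).2 (hω k)
  obtain ⟨N, hN⟩ := Metric.tendsto_atTop.1 hk' (ε / 3) (by positivity)
  refine ⟨N, fun n hn => ?_⟩
  have h1 := hN n hn
  rw [← integral_empiricalMeasure (a (n + 1) ω) (hmeas g), Real.dist_eq] at h1
  have h2 := hclose (empiricalMeasure (a (n + 1) ω)) f.toContinuousMap g
  have h3 := hclose μ f.toContinuousMap g
  rw [Real.dist_eq]
  change |∫ x, f.toContinuousMap x ∂(empiricalMeasure (a (n + 1) ω) : Measure X) -
    ∫ x, f.toContinuousMap x ∂(μ : Measure X)| < ε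
  rw [abs_lt] at h1 ⊢
  rw [abs_le] at h2 h3
  constructor <;> linarith [h1.1, h1.2, h2.1, h2.2, h3.1, h3.2]

end Empirical

/-! ### Triple products and crossing segments -/

/-- The scalar triple product of three vectors. -/
def trip (a b c : E3) : ℝ :=
  a 0 * (b 1 * c 2 - b 2 * c 1) + a 1 * (b 2 * c 0 - b 0 * c 2) + a 2 * (b 0 * c 1 - b 1 * c 0)

/-- The cross product of two vectors. -/
noncomputable def crossE (a b : E3) : E3 :=
  !₂[a 1 * b 2 - a 2 * b 1, a 2 * b 0 - a 0 * b 2, a 0 * b 1 - a 1 * b 0]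

theorem inner_E3 (a b : E3) : inner ℝ a b = a 0 * b 0 + a 1 * b 1 + a 2 * b 2 := by
  simp [PiLp.inner_apply, Fin.sum_univ_three, mul_comm]

theorem inner_crossE (a b c : E3) : inner ℝ a (crossE b c) = trip a b c := by
  simp [inner_E3, crossE, trip]

theorem continuous_trip : Continuous fun p : E3 × E3 × E3 => trip p.1 p.2.1 p.2.2 := by
  unfold trip; fun_prop

@[fun_prop]
theorem Continuous.trip {X : Type*} [TopologicalSpace X] {f g h : X → E3} (hf : Continuous f)
    (hg : Continuous g) (hh : Continuous h) : Continuous fun x => trip (f x) (g x) (h x) :=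
  continuous_trip.comp (hf.prodMk (hg.prodMk hh))

/-- The four reals are all positive or all negative. -/
def AllPosOrNeg (x₁ x₂ x₃ x₄ : ℝ) : Prop :=
  (0 < x₁ ∧ 0 < x₂ ∧ 0 < x₃ ∧ 0 < x₄) ∨ (x₁ < 0 ∧ x₂ < 0 ∧ x₃ < 0 ∧ x₄ < 0)

/-- The four reals are all nonnegative or all nonpositive. -/
def AllNonnegOrNonpos (x₁ x₂ x₃ x₄ : ℝ) : Prop :=
  (0 ≤ x₁ ∧ 0 ≤ x₂ ∧ 0 ≤ x₃ ∧ 0 ≤ x₄) ∨ (x₁ ≤ 0 ∧ x₂ ≤ 0 ∧ x₃ ≤ 0 ∧ x₄ ≤ 0)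

/-- The side of the first end of `e` with respect to the oriented great circle through `f`. -/
def sideFst (e f : E3 × E3) : ℝ := trip e.1 f.1 f.2

/-- The side of the second end of `e` with respect to the oriented great circle through `f`. -/
def sideSnd (e f : E3 × E3) : ℝ := trip e.2 f.1 f.2

/-- Two segments cross in general position. -/
def StrictCross (e f : E3 × E3) : Prop :=
  AllPosOrNeg (sideSnd e f) (-sideFst e f) (-sideSnd f e) (sideFst f e)

/-- The closed counterpart of `StrictCross`. -/
def WeakCross (e f : E3 × E3) : Prop :=
  AllNonnegOrNonpos (sideSnd e f) (-sideFst e f) (-sideSnd f e) (sideFst f e)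

/-- The pair of vectors underlying a pair of points of the sphere. -/
def toE3 (e : S2 × S2) : E3 × E3 := (e.1, e.2)

theorem continuous_toE3 : Continuous toE3 := by unfold toE3; fun_prop

theorem StrictCross.symm {e f : E3 × E3} (h : StrictCross e f) : StrictCross f e := by
  unfold StrictCross AllPosOrNeg at *
  rcases h with ⟨h1, h2, h3, h4⟩ | ⟨h1, h2, h3, h4⟩
  · right; refine ⟨?_, ?_, ?_, ?_⟩ <;> linarith
  · left; refine ⟨?_, ?_, ?_, ?_⟩ <;> linarith

theorem strictCross_comm {e f : E3 × E3} : StrictCross e f ↔ StrictCross f e :=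
  ⟨StrictCross.symm, StrictCross.symm⟩

theorem not_strictCross_self (e : E3 × E3) : ¬ StrictCross e e := by
  have : sideSnd e e = 0 := by unfold sideSnd trip; ring
  simp [StrictCross, AllPosOrNeg, this]

theorem WeakCross.strictCross {e f : E3 × E3} (h : WeakCross e f) (h1 : sideSnd e f ≠ 0)
    (h2 : sideFst e f ≠ 0) (h3 : sideSnd f e ≠ 0) (h4 : sideFst f e ≠ 0) : StrictCross e f := by
  rcases h with ⟨a1, a2, a3, a4⟩ | ⟨a1, a2, a3, a4⟩
  · exact Or.inl ⟨lt_of_le_of_ne a1 h1.symm, lt_of_le_of_ne a2 (neg_ne_zero.2 h2).symm,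
      lt_of_le_of_ne a3 (neg_ne_zero.2 h3).symm, lt_of_le_of_ne a4 h4.symm⟩
  · exact Or.inr ⟨lt_of_le_of_ne a1 h1, lt_of_le_of_ne a2 (neg_ne_zero.2 h2),
      lt_of_le_of_ne a3 (neg_ne_zero.2 h3), lt_of_le_of_ne a4 h4⟩

theorem isOpen_strictCross : IsOpen {p : (E3 × E3) × (E3 × E3) | StrictCross p.1 p.2} := by
  simp only [StrictCross, AllPosOrNeg, sideFst, sideSnd, Set.ofPred_or, Set.ofPred_and]
  refine IsOpen.union ?_ ?_ <;>
  refine ((isOpen_lt ?_ ?_).inter ((isOpen_lt ?_ ?_).inter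
    ((isOpen_lt ?_ ?_).inter (isOpen_lt ?_ ?_)))) <;> fun_prop

theorem isClosed_weakCross : IsClosed {p : (E3 × E3) × (E3 × E3) | WeakCross p.1 p.2} := by
  simp only [WeakCross, AllNonnegOrNonpos, sideFst, sideSnd, Set.ofPred_or, Set.ofPred_and]
  refine IsClosed.union ?_ ?_ <;>
  refine ((isClosed_le ?_ ?_).inter ((isClosed_le ?_ ?_).inter
    ((isClosed_le ?_ ?_).inter (isClosed_le ?_ ?_)))) <;> fun_prop

theorem trip_smul_relation (a b c d : E3) :
    trip b c d • a + (-trip a c d) • b = (-trip d a b) • c + trip c a b • d := by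
  ext i
  fin_cases i <;> simp [trip] <;> ring

theorem SegmentsCross.weakCross {a b c d : S2} (h : SegmentsCross a b c d) :
    WeakCross (toE3 (a, b)) (toE3 (c, d)) := by
  obtain ⟨p, ⟨s, t, hs, ht, hp⟩, s', t', hs', ht', hp'⟩ := h
  have hrel : s • (a : E3) + t • (b : E3) = s' • (c : E3) + t' • (d : E3) := hp.symm.trans hp'
  have h0 := congrArg (fun v : E3 => v 0) hrel
  have h1 := congrArg (fun v : E3 => v 1) hrel
  have h2 := congrArg (fun v : E3 => v 2) hrel
  simp only [PiLp.add_apply, PiLp.smul_apply, smul_eq_mul] at h0 h1 h2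
  have e1 : s * trip a c d = - (t * trip b c d) := by
    unfold trip; linear_combination ((c : E3) 1 * (d : E3) 2 - (c : E3) 2 * (d : E3) 1) * h0 +
      ((c : E3) 2 * (d : E3) 0 - (c : E3) 0 * (d : E3) 2) * h1 +
      ((c : E3) 0 * (d : E3) 1 - (c : E3) 1 * (d : E3) 0) * h2
  have e2 : s' * trip c a b = - (t' * trip d a b) := by
    unfold trip; linear_combination -((a : E3) 1 * (b : E3) 2 - (a : E3) 2 * (b : E3) 1) * h0 -
      ((a : E3) 2 * (b : E3) 0 - (a : E3) 0 * (b : E3) 2) * h1 -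
      ((a : E3) 0 * (b : E3) 1 - (a : E3) 1 * (b : E3) 0) * h2
  have e3 : s * trip d a b = - (s' * trip b c d) := by
    unfold trip; linear_combination -((d : E3) 1 * (b : E3) 2 - (d : E3) 2 * (b : E3) 1) * h0 -
      ((d : E3) 2 * (b : E3) 0 - (d : E3) 0 * (b : E3) 2) * h1 -
      ((d : E3) 0 * (b : E3) 1 - (d : E3) 1 * (b : E3) 0) * h2
  simp only [WeakCross, AllNonnegOrNonpos, sideFst, sideSnd, toE3]
  have f1 : trip a c d = -(t / s * trip b c d) := by field_simp; linarith
  have f3 : trip d a b = -(s' / s * trip b c d) := by field_simp; linarith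
  have f2 : trip c a b = t' / s * trip b c d := by
    have : s' * trip c a b = s' * (t' / s * trip b c d) := by rw [e2, f3]; ring
    exact mul_left_cancel₀ hs'.ne' this
  rw [f1, f2, f3, neg_neg, neg_neg]
  rcases le_total 0 (trip b c d) with h | h
  · left; refine ⟨h, ?_, ?_, ?_⟩ <;> positivity
  · right
    have k1 : 0 ≤ t / s := by positivity
    have k2 : 0 ≤ s' / s := by positivity
    have k3 : 0 ≤ t' / s := by positivity
    exact ⟨h, mul_nonpos_of_nonneg_of_nonpos k1 h, mul_nonpos_of_nonneg_of_nonpos k2 h,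
      mul_nonpos_of_nonneg_of_nonpos k3 h⟩

theorem StrictCross.segmentsCross {a b c d : S2}
    (h : StrictCross (toE3 (a, b)) (toE3 (c, d))) : SegmentsCross a b c d := by
  obtain ⟨s, t, s', t', hs, ht, hs', ht', hrel⟩ : ∃ s t s' t' : ℝ, 0 < s ∧ 0 < t ∧ 0 < s' ∧
      0 < t' ∧ s • (a : E3) + t • (b : E3) = s' • (c : E3) + t' • (d : E3) := by
    have hr := trip_smul_relation (a : E3) b c d
    rcases h with ⟨h1, h2, h3, h4⟩ | ⟨h1, h2, h3, h4⟩
    · exact ⟨_, _, _, _, h1, h2, h3, h4, hr⟩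
    · refine ⟨_, _, _, _, neg_pos.2 h1, neg_pos.2 h2, neg_pos.2 h3, neg_pos.2 h4, ?_⟩
      have := congrArg Neg.neg hr
      simp only [neg_add, ← neg_smul] at this
      exact this
  have hne : s • (a : E3) + t • (b : E3) ≠ 0 := by
    intro h0
    have hc0 : trip c a b = 0 := by
      have h0' := congrArg (fun v : E3 => v 0) h0
      have h1' := congrArg (fun v : E3 => v 1) h0
      have h2' := congrArg (fun v : E3 => v 2) h0
      simp only [PiLp.add_apply, PiLp.smul_apply, smul_eq_mul, PiLp.zero_apply] at h0' h1' h2'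
      have : s * trip c a b = s * 0 := by
        unfold trip
        linear_combination ((b : E3) 1 * (c : E3) 2 - (b : E3) 2 * (c : E3) 1) * h0' +
          ((b : E3) 2 * (c : E3) 0 - (b : E3) 0 * (c : E3) 2) * h1' +
          ((b : E3) 0 * (c : E3) 1 - (b : E3) 1 * (c : E3) 0) * h2'
      exact mul_left_cancel₀ hs.ne' this
    rcases h with ⟨_, _, _, h4⟩ | ⟨_, _, _, h4⟩ <;> simp [sideFst, toE3, hc0] at h4
  set N := ‖s • (a : E3) + t • (b : E3)‖
  have hN : 0 < N := norm_pos_iff.2 hne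
  refine ⟨⟨N⁻¹ • (s • (a : E3) + t • (b : E3)), ?_⟩, ⟨N⁻¹ * s, N⁻¹ * t, by positivity,
    by positivity, ?_⟩, ⟨N⁻¹ * s', N⁻¹ * t', by positivity, by positivity, ?_⟩⟩
  · rw [mem_sphere_zero_iff_norm, norm_smul, norm_inv, norm_norm, inv_mul_cancel₀ hN.ne']
  · simp only [smul_add, smul_smul]
  · simp only [hrel, smul_add, smul_smul]

/-! ### Nondegenerate pairs of random points -/

/-- The measure vanishes on all great circles. -/
def NullOnGreatCircles (μ : Measure S2) : Prop :=
  ∀ N : E3, N ≠ 0 → ∀ᵐ x : S2 ∂μ, inner ℝ (x : E3) N ≠ 0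

theorem exists_ne_zero_orthogonal (a : E3) : ∃ N : E3, N ≠ 0 ∧ inner ℝ a N = 0 := by
  by_cases h : a 0 = 0 ∧ a 1 = 0
  · refine ⟨!₂[1, 0, 0], fun h0 => ?_, by simp [inner_E3, h.1]⟩
    simpa using congrArg (fun v : E3 => v 0) h0
  · refine ⟨!₂[-a 1, a 0, 0], fun h0 => h ⟨?_, ?_⟩, by simp [inner_E3]; ring⟩
    · simpa using congrArg (fun v : E3 => v 1) h0
    · simpa using congrArg (fun v : E3 => v 0) h0

theorem crossE_eq_zero_inner {a b N : E3} (ha : a ≠ 0) (h : crossE a b = 0)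
    (hN : inner ℝ a N = 0) : inner ℝ b N = 0 := by
  have h0 := congrArg (fun v : E3 => v 0) h
  have h1 := congrArg (fun v : E3 => v 1) h
  have h2 := congrArg (fun v : E3 => v 2) h
  simp [crossE] at h0 h1 h2
  rw [inner_E3] at hN ⊢
  have : inner ℝ a a * (b 0 * N 0 + b 1 * N 1 + b 2 * N 2) = inner ℝ a a * 0 := by
    rw [inner_E3]
    linear_combination (a 0 * b 0 + a 1 * b 1 + a 2 * b 2) * hN
      + (a 1 * N 2 - a 2 * N 1) * h0 + (a 2 * N 0 - a 0 * N 2) * h1 + (a 0 * N 1 - a 1 * N 0) * h2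
  exact mul_left_cancel₀ (inner_self_ne_zero.2 ha) this

theorem measurable_toE3 : Measurable toE3 := continuous_toE3.measurable

theorem measurable_sideFst : Measurable fun p : (E3 × E3) × (E3 × E3) => sideFst p.1 p.2 := by
  unfold sideFst; exact Continuous.measurable (by fun_prop)

theorem measurable_sideSnd : Measurable fun p : (E3 × E3) × (E3 × E3) => sideSnd p.1 p.2 := by
  unfold sideSnd; exact Continuous.measurable (by fun_prop)

section Nondegenerate

theorem ae_crossE_ne_zero {μ₁ μ₂ : Measure S2} [SFinite μ₂] (h₂ : NullOnGreatCircles μ₂) :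
    ∀ᵐ e ∂(μ₁.prod μ₂), crossE e.1 e.2 ≠ 0 := by
  have hm : MeasurableSet {e : S2 × S2 | crossE e.1 e.2 ≠ 0} := by
    refine (isOpen_ne_fun ?_ continuous_const).measurableSet
    unfold crossE
    fun_prop
  refine (Measure.ae_prod_iff_ae_ae hm).2 (ae_of_all _ fun a => ?_)
  obtain ⟨N, hN, haN⟩ := exists_ne_zero_orthogonal (a : E3)
  filter_upwards [h₂ N hN] with b hb h0
  exact hb (crossE_eq_zero_inner (ne_zero_of_mem_unit_sphere a) h0 haN)

variable {μ₁ μ₂ : Measure S2} [IsProbabilityMeasure μ₁] [IsProbabilityMeasure μ₂]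

theorem ae_side_ne_zero (h₁ : NullOnGreatCircles μ₁) (h₂ : NullOnGreatCircles μ₂) :
    ∀ᵐ p ∂((μ₁.prod μ₂).prod (μ₁.prod μ₂)),
      sideFst (toE3 p.1) (toE3 p.2) ≠ 0 ∧ sideSnd (toE3 p.1) (toE3 p.2) ≠ 0 := by
  have hm : MeasurableSet {p : (S2 × S2) × (S2 × S2) |
      sideFst (toE3 p.1) (toE3 p.2) ≠ 0 ∧ sideSnd (toE3 p.1) (toE3 p.2) ≠ 0} := by
    have := measurable_toE3
    have k1 := measurable_sideFst.comp (f := fun p : (S2 × S2) × (S2 × S2) =>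
      (toE3 p.1, toE3 p.2)) (by fun_prop)
    have k2 := measurable_sideSnd.comp (f := fun p : (S2 × S2) × (S2 × S2) =>
      (toE3 p.1, toE3 p.2)) (by fun_prop)
    exact (measurableSet_eq_fun k1 measurable_const).compl.inter
      (measurableSet_eq_fun k2 measurable_const).compl
  have hs : ∀ᵐ p ∂((μ₁.prod μ₂).prod (μ₁.prod μ₂)),
      sideFst (toE3 p.2) (toE3 p.1) ≠ 0 ∧ sideSnd (toE3 p.2) (toE3 p.1) ≠ 0 := by
    have hm' := measurable_swap hm
    refine (Measure.ae_prod_iff_ae_ae hm').2 ?_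
    filter_upwards [ae_crossE_ne_zero (μ₁ := μ₁) h₂] with f hf
    have k1 : ∀ᵐ e ∂(μ₁.prod μ₂), inner ℝ (e.1 : E3) (crossE f.1 f.2) ≠ 0 :=
      (Measure.quasiMeasurePreserving_fst (μ := μ₁) (ν := μ₂)).ae (h₁ _ hf)
    have k2 : ∀ᵐ e ∂(μ₁.prod μ₂), inner ℝ (e.2 : E3) (crossE f.1 f.2) ≠ 0 :=
      (Measure.quasiMeasurePreserving_snd (μ := μ₁) (ν := μ₂)).ae (h₂ _ hf)
    filter_upwards [k1, k2] with e he1 he2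
    rw [inner_crossE] at he1 he2
    exact ⟨he1, he2⟩
  have := (Measure.measurePreserving_swap (μ := μ₁.prod μ₂) (ν := μ₁.prod μ₂)).quasiMeasurePreserving.ae hs
  exact this

theorem ae_pi_side_ne_zero (h₁ : NullOnGreatCircles μ₁) (h₂ : NullOnGreatCircles μ₂)
    {V : Type*} [Fintype V] :
    ∀ᵐ x ∂(Measure.pi fun _ : V => μ₁.prod μ₂), ∀ u v, u ≠ v →
      sideFst (toE3 (x u)) (toE3 (x v)) ≠ 0 ∧ sideSnd (toE3 (x u)) (toE3 (x v)) ≠ 0 := by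
  refine ae_all_iff.2 fun u => ae_all_iff.2 fun v => ?_
  by_cases huv : u = v
  · exact ae_of_all _ fun x h => absurd huv h
  have hind : IndepFun (fun x : V → S2 × S2 => x u) (fun x => x v)
      (Measure.pi fun _ : V => μ₁.prod μ₂) :=
    (iIndepFun_pi (μ := fun _ : V => μ₁.prod μ₂) (X := fun _ y => y)
      fun _ => aemeasurable_id).indepFun huv
  have hmap := (indepFun_iff_map_prod_eq_prod_map_map (measurable_pi_apply u).aemeasurable
    (measurable_pi_apply v).aemeasurable).1 hind
  rw [(measurePreserving_eval (fun _ : V => μ₁.prod μ₂) u).map_eq,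
    (measurePreserving_eval (fun _ : V => μ₁.prod μ₂) v).map_eq] at hmap
  have h := ae_side_ne_zero h₁ h₂
  rw [← hmap] at h
  filter_upwards [ae_of_ae_map (by fun_prop) h] with x hx _
  exact hx

end Nondegenerate

/-! ### The limit of the crossing graphs -/

section CrossingSets

variable {V : Type*}

/-- The labellings of the vertices of `H` by segments such that adjacent segments cross in general
position. -/
def crossingSet (H : SimpleGraph V) : Set (V → S2 × S2) :=
  {x | ∀ u v, H.Adj u v → StrictCross (toE3 (x u)) (toE3 (x v))}

/-- The closed counterpart of `crossingSet`. -/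
def weakCrossingSet (H : SimpleGraph V) : Set (V → S2 × S2) :=
  {x | ∀ u v, H.Adj u v → WeakCross (toE3 (x u)) (toE3 (x v))}

theorem isOpen_crossingSet [Finite V] (H : SimpleGraph V) : IsOpen (crossingSet H) := by
  simp only [crossingSet, Set.ofPred_forall]
  refine isOpen_iInter_of_finite fun u => isOpen_iInter_of_finite fun v =>
    isOpen_iInter_of_finite fun _ => ?_
  have := continuous_toE3
  exact isOpen_strictCross.preimage
    (f := fun x : V → S2 × S2 => (toE3 (x u), toE3 (x v))) (by fun_prop)

theorem isClosed_weakCrossingSet (H : SimpleGraph V) : IsClosed (weakCrossingSet H) := by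
  simp only [weakCrossingSet, Set.ofPred_forall]
  refine isClosed_iInter fun u => isClosed_iInter fun v => isClosed_iInter fun _ => ?_
  have := continuous_toE3
  exact isClosed_weakCross.preimage
    (f := fun x : V → S2 × S2 => (toE3 (x u), toE3 (x v))) (by fun_prop)

theorem measure_weakCrossingSet_le [Fintype V] {μ₁ μ₂ : Measure S2} [IsProbabilityMeasure μ₁]
    [IsProbabilityMeasure μ₂] (h₁ : NullOnGreatCircles μ₁) (h₂ : NullOnGreatCircles μ₂)
    (H : SimpleGraph V) : (Measure.pi fun _ : V => μ₁.prod μ₂) (weakCrossingSet H) ≤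
      (Measure.pi fun _ : V => μ₁.prod μ₂) (crossingSet H) := by
  refine measure_mono_ae ?_
  filter_upwards [ae_pi_side_ne_zero h₁ h₂ (V := V)] with x hx hw u v huv
  exact (hw u v huv).strictCross (hx u v huv.ne).2 (hx u v huv.ne).1 (hx v u huv.ne').2
    (hx v u huv.ne').1

theorem card_le_card_hom [Finite V] (H : SimpleGraph V) {n : ℕ} (a b : Fin n → S2) :
    Nat.card {φ : V → Fin n × Fin n | (fun v => (a (φ v).1, b (φ v).2)) ∈ crossingSet H} ≤
      Nat.card (H →g crossingGraph a b) := by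
  have : Finite (H →g crossingGraph a b) := DFunLike.finite _
  refine Nat.card_le_card_of_injective
    (fun φ => (⟨φ.1, fun {u v} huv => ⟨fun h => ?_, ?_⟩⟩ : H →g crossingGraph a b)) ?_
  · have h1 := φ.2 u v huv
    simp only [h] at h1
    exact not_strictCross_self _ h1
  · exact (φ.2 u v huv).segmentsCross
  · intro φ ψ h
    exact Subtype.ext (congrArg (fun f : H →g crossingGraph a b => (f : V → Fin n × Fin n)) h)

theorem card_hom_le_card [Finite V] (H : SimpleGraph V) {n : ℕ} (a b : Fin n → S2) :
    Nat.card (H →g crossingGraph a b) ≤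
    Nat.card {φ : V → Fin n × Fin n |
      (fun v => (a (φ v).1, b (φ v).2)) ∈ weakCrossingSet H} := by
  refine Nat.card_le_card_of_injective (fun f => ⟨f, fun u v huv => ?_⟩) ?_
  · exact (f.map_adj huv).2.weakCross
  · intro f g h
    exact DFunLike.coe_injective (congrArg Subtype.val h)

end CrossingSets

section Limit

open Classical in
/-- The graphon on `[0,1]` obtained from the crossing relation by a map from `[0,1]` to the set of
segments. -/
noncomputable def crossingGraphon (φ : I → S2 × S2) (hφ : Measurable φ) : Graphon where
  toFun x y := if StrictCross (toE3 (φ x)) (toE3 (φ y)) then 1 else 0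
  measurable_toFun := by
    refine Measurable.ite ?_ measurable_const measurable_const
    have := measurable_toE3
    exact (show Measurable fun p : I × I => (toE3 (φ p.1), toE3 (φ p.2)) by fun_prop)
      isOpen_strictCross.measurableSet
  symm x y := by simp only [strictCross_comm]
  nonneg x y := by split_ifs <;> norm_num
  le_one x y := by split_ifs <;> norm_num

theorem homDensity_crossingGraphon {V : Type*} [Fintype V] (H : SimpleGraph V) {φ : I → S2 × S2}
    (hφ : Measurable φ) {ν : Measure (S2 × S2)} [IsProbabilityMeasure ν] (hν : volume.map φ = ν) :
    Graphon.homDensity H (crossingGraphon φ hφ) =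
      (Measure.pi fun _ : V => ν).real (crossingSet H) := by
  classical
  have hmap : (volume : Measure (V → I)).map (fun x v => φ (x v)) = Measure.pi fun _ : V => ν := by
    have : IsProbabilityMeasure ((volume : Measure I).map φ) :=
      Measure.isProbabilityMeasure_map hφ.aemeasurable
    rw [volume_pi, Measure.pi_map_pi fun _ => hφ.aemeasurable, hν]
  have hm : Measurable fun (x : V → I) v => φ (x v) := by fun_prop
  have hO := (isOpen_crossingSet H).measurableSet
  rw [← hmap, map_measureReal_apply hm hO, ← integral_indicator_one (hm hO)]
  refine integral_congr_ae (ae_of_all _ fun x => ?_)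
  have hw : ∀ u v, (crossingGraphon φ hφ).edgeWeight x s(u, v) =
      if StrictCross (toE3 (φ (x u))) (toE3 (φ (x v))) then 1 else 0 := fun u v => rfl
  by_cases hx : (fun v => φ (x v)) ∈ crossingSet H
  · rw [Set.indicator_of_mem (by exact hx)]
    refine (Finset.prod_eq_one fun e he => ?_).trans rfl
    induction e with | _ u v =>
    rw [hw, if_pos (hx u v (by simpa using he))]
  · rw [Set.indicator_of_notMem (by exact hx)]
    simp only [crossingSet, Set.mem_ofPred_eq, not_forall] at hx
    obtain ⟨u, v, huv, hn⟩ := hx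
    refine Finset.prod_eq_zero (i := s(u, v)) (by simpa using huv) ?_
    rw [hw, if_neg hn]

theorem pi_empiricalMeasure {V : Type*} [Fintype V] [DecidableEq V] {n : ℕ} (a b : Fin (n + 1) → S2) :
    (Measure.pi fun _ : V => (((empiricalMeasure a).prod (empiricalMeasure b) :
      ProbabilityMeasure (S2 × S2)) : Measure (S2 × S2))) =
    (finUniform (V → Fin (n + 1) × Fin (n + 1))).map (fun φ v => (a (φ v).1, b (φ v).2)) := by
  have h : (((empiricalMeasure a).prod (empiricalMeasure b) : ProbabilityMeasure (S2 × S2)) :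
      Measure (S2 × S2)) = (finUniform (Fin (n + 1) × Fin (n + 1))).map (Prod.map a b) := by
    rw [← finUniform_prod]
    exact Measure.map_prod_map _ _ (measurable_of_countable a) (measurable_of_countable b)
  have : IsProbabilityMeasure
      ((finUniform (Fin (n + 1) × Fin (n + 1))).map (Prod.map a b)) :=
    Measure.isProbabilityMeasure_map (measurable_of_countable _).aemeasurable
  rw [h, ← finUniform_pi]
  exact (Measure.pi_map_pi fun _ => (measurable_of_countable _).aemeasurable).symm

theorem tendsto_homDensity {μ₁ μ₂ : ProbabilityMeasure S2}
    (h₁ : NullOnGreatCircles (μ₁ : Measure S2)) (h₂ : NullOnGreatCircles (μ₂ : Measure S2))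
    {a b : ∀ n : ℕ, Fin n → S2}
    (ha : Tendsto (fun n : ℕ => empiricalMeasure (a (n + 1))) atTop (𝓝 μ₁))
    (hb : Tendsto (fun n : ℕ => empiricalMeasure (b (n + 1))) atTop (𝓝 μ₂))
    {V : Type*} [Fintype V] (H : SimpleGraph V) :
    Tendsto (fun n => SimpleGraph.homDensity H (crossingGraph (a n) (b n))) atTop
      (𝓝 ((Measure.pi fun _ : V => (μ₁ : Measure S2).prod (μ₂ : Measure S2)).real (crossingSet H))) := by
  classical
  rw [← tendsto_add_atTop_iff_nat 1]
  set ν : ℕ → ProbabilityMeasure (V → S2 × S2) := fun n => ProbabilityMeasure.pi fun _ : V =>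
    (empiricalMeasure (a (n + 1))).prod (empiricalMeasure (b (n + 1)))
  have hν : Tendsto ν atTop (𝓝 (ProbabilityMeasure.pi fun _ : V => μ₁.prod μ₂)) := by
    have h1 : Tendsto (fun n => (empiricalMeasure (a (n + 1))).prod (empiricalMeasure (b (n + 1))))
        atTop (𝓝 (μ₁.prod μ₂)) :=
      (ProbabilityMeasure.continuous_prod.tendsto (μ₁, μ₂)).comp (ha.prodMk_nhds hb)
    exact (ProbabilityMeasure.continuous_pi.tendsto _).comp (tendsto_pi_nhds.2 fun _ => h1)
  set P := Measure.pi fun _ : V => (μ₁ : Measure S2).prod (μ₂ : Measure S2)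
  have hcard : ∀ (n : ℕ) (S : Set (V → S2 × S2)), MeasurableSet S →
      (ν n : Measure (V → S2 × S2)).real S =
      (Nat.card {φ : V → Fin (n + 1) × Fin (n + 1) |
        (fun v => (a (n + 1) (φ v).1, b (n + 1) (φ v).2)) ∈ S} : ℝ) /
        (Nat.card (Fin (n + 1) × Fin (n + 1)) : ℝ) ^ Nat.card V := by
    intro n S hS
    have : (ν n : Measure (V → S2 × S2)) = _ := pi_empiricalMeasure (V := V) (a (n + 1)) (b (n + 1))
    rw [this, map_measureReal_apply (measurable_of_countable _) hS, finUniform_real_apply,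
      Nat.card_fun, Nat.cast_pow]
    rfl
  set h : ℕ → ℝ := fun n => SimpleGraph.homDensity H (crossingGraph (a (n + 1)) (b (n + 1)))
  have hlow : ∀ n, (ν n : Measure (V → S2 × S2)) (crossingSet H) ≤ ENNReal.ofReal (h n) := by
    intro n
    rw [← ofReal_measureReal, hcard n _ (isOpen_crossingSet H).measurableSet]
    refine ENNReal.ofReal_le_ofReal (div_le_div_of_nonneg_right ?_ (by positivity))
    exact_mod_cast card_le_card_hom H (a (n + 1)) (b (n + 1))
  have hup : ∀ n, ENNReal.ofReal (h n) ≤ (ν n : Measure (V → S2 × S2)) (weakCrossingSet H) := by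
    intro n
    rw [← ofReal_measureReal (μ := (ν n : Measure (V → S2 × S2))),
      hcard n _ (isClosed_weakCrossingSet H).measurableSet]
    refine ENNReal.ofReal_le_ofReal (div_le_div_of_nonneg_right ?_ (by positivity))
    exact_mod_cast card_hom_le_card H (a (n + 1)) (b (n + 1))
  have hlim : Tendsto (fun n => ENNReal.ofReal (h n)) atTop (𝓝 (P (crossingSet H))) := by
    refine tendsto_of_le_liminf_of_limsup_le ?_ ?_
    · exact (ProbabilityMeasure.le_liminf_measure_open_of_tendsto hν (isOpen_crossingSet H)).trans
        (liminf_le_liminf (Eventually.of_forall hlow))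
    · refine (limsup_le_limsup (Eventually.of_forall hup)).trans ?_
      exact (ProbabilityMeasure.limsup_measure_closed_le_of_tendsto hν
        (isClosed_weakCrossingSet H)).trans (measure_weakCrossingSet_le h₁ h₂ H)
  have := (ENNReal.tendsto_toReal (measure_ne_top P _)).comp hlim
  refine this.congr fun n => ENNReal.toReal_ofReal ?_
  simp only [h, SimpleGraph.homDensity]
  positivity

/-- The probability that three random segments cross pairwise. -/
noncomputable def triangleProb (μ₁ μ₂ : Measure S2) : ℝ :=
  (Measure.pi fun _ : Fin 3 => μ₁.prod μ₂).real (crossingSet (⊤ : SimpleGraph (Fin 3)))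

variable {μ₁ μ₂ : Measure S2} [IsProbabilityMeasure μ₁] [IsProbabilityMeasure μ₂]

theorem ae_tendsto_homDensity (h₁ : NullOnGreatCircles μ₁) (h₂ : NullOnGreatCircles μ₂)
    {Ω : Type*} [MeasurableSpace Ω] {P : Measure Ω} [IsProbabilityMeasure P]
    {a b : ∀ n : ℕ, Ω → Fin n → S2}
    (hab : ∀ n, HasLaw (fun ω => (a n ω, b n ω))
      ((Measure.pi fun _ : Fin n => μ₁).prod (Measure.pi fun _ : Fin n => μ₂)) P) :
    ∀ᵐ ω ∂P, ∀ (k : ℕ) (H : SimpleGraph (Fin k)),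
      Tendsto (fun n => SimpleGraph.homDensity H (crossingGraph (a n ω) (b n ω))) atTop
        (𝓝 ((Measure.pi fun _ : Fin k => μ₁.prod μ₂).real (crossingSet H))) := by
  have ha : ∀ n, HasLaw (a n) (Measure.pi fun _ : Fin n => μ₁) P := fun n =>
    measurePreserving_fst.comp_hasLaw (hab n)
  have hb : ∀ n, HasLaw (b n) (Measure.pi fun _ : Fin n => μ₂) P := fun n =>
    measurePreserving_snd.comp_hasLaw (hab n)
  filter_upwards [ae_tendsto_empiricalMeasure ⟨μ₁, inferInstance⟩ ha,
    ae_tendsto_empiricalMeasure ⟨μ₂, inferInstance⟩ hb] with ω hωa hωb k H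
  exact tendsto_homDensity (μ₁ := ⟨μ₁, inferInstance⟩) (μ₂ := ⟨μ₂, inferInstance⟩) h₁ h₂ hωa hωb H

theorem exists_isCrossingGraphon (h₁ : NullOnGreatCircles μ₁) (h₂ : NullOnGreatCircles μ₂) :
    ∃ W, IsCrossingGraphon μ₁ μ₂ W := by
  have : Nonempty (S2 × S2) := (μ₁.prod μ₂).nonempty_of_neZero
  obtain ⟨φ, hφ, hmap⟩ := (μ₁.prod μ₂).exists_measurable_map_eq
  refine ⟨crossingGraphon φ hφ, fun Ω _ P _ a b hab => ?_⟩
  filter_upwards [ae_tendsto_homDensity h₁ h₂ hab] with ω hω k H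
  rw [homDensity_crossingGraphon H hφ hmap]
  exact hω k H

theorem IsCrossingGraphon.triangleDensity_eq (h₁ : NullOnGreatCircles μ₁)
    (h₂ : NullOnGreatCircles μ₂) {W : Graphon} (hW : IsCrossingGraphon μ₁ μ₂ W) :
    triangleDensity W = triangleProb μ₁ μ₂ := by
  let ν : ∀ n : ℕ, Measure ((Fin n → S2) × (Fin n → S2)) := fun n =>
    (Measure.pi fun _ : Fin n => μ₁).prod (Measure.pi fun _ : Fin n => μ₂)
  let P := Measure.infinitePi ν
  have hlaw : ∀ n, HasLaw (fun ω : ∀ n : ℕ, (Fin n → S2) × (Fin n → S2) => ((ω n).1, (ω n).2))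
      (ν n) P := fun n =>
    ⟨(measurable_pi_apply n).aemeasurable, Measure.infinitePi_map_eval ν n⟩
  have hc := hW _ P (fun n ω => (ω n).1) (fun n ω => (ω n).2) hlaw
  have hd := ae_tendsto_homDensity h₁ h₂ hlaw
  obtain ⟨ω, hω1, hω2⟩ := (hc.and hd).exists
  exact tendsto_nhds_unique (hω1 3 ⊤) (hω2 3 ⊤)

end Limit

/-! ### Uniform angles -/

/-- The uniform distribution on `[0, 2π)`. -/
noncomputable def angleMeasure : Measure ℝ := volume[|Set.Ico (0 : ℝ) (2 * π)]

instance : IsProbabilityMeasure angleMeasure := by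
  refine cond_isProbabilityMeasure_of_finite ?_ (by rw [Real.volume_Ico]; exact ENNReal.ofReal_ne_top)
  simp [Real.volume_Ico, pi_pos]

theorem integral_angleMeasure (f : ℝ → ℝ) :
    ∫ θ, f θ ∂angleMeasure = (2 * π)⁻¹ * ∫ θ in 0..2 * π, f θ := by
  have h : (0 : ℝ) ≤ 2 * π := by positivity
  rw [angleMeasure, ProbabilityTheory.cond, integral_smul_measure, intervalIntegral.integral_of_le h,
    integral_Ico_eq_integral_Ioo, integral_Ioc_eq_integral_Ioo, Real.volume_Ico, sub_zero,
    ENNReal.toReal_inv, ENNReal.toReal_ofReal h, smul_eq_mul]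

theorem integral_angleMeasure_add {f : ℝ → ℝ} (hf : Function.Periodic f (2 * π)) (t : ℝ) :
    ∫ θ, f (θ + t) ∂angleMeasure = ∫ θ, f θ ∂angleMeasure := by
  rw [integral_angleMeasure, integral_angleMeasure,
    intervalIntegral.integral_comp_add_right (fun θ => f θ), zero_add, add_comm (2 * π) t,
    hf.intervalIntegral_add_eq t 0, zero_add]

theorem integral_angleMeasure_neg {f : ℝ → ℝ} (hf : Function.Periodic f (2 * π)) :
    ∫ θ, f (-θ) ∂angleMeasure = ∫ θ, f θ ∂angleMeasure := by
  rw [integral_angleMeasure, integral_angleMeasure, intervalIntegral.integral_comp_neg]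
  have := hf.intervalIntegral_add_eq (-(2 * π)) 0
  rw [neg_add_cancel, zero_add] at this
  rw [neg_zero, this]

section Map

variable {X : Type*} [MeasurableSpace X] {F : ℝ → X}

theorem map_angleMeasure_congr {G : ℝ → X} (hF : Measurable F) (hG : Measurable G)
    (h : ∀ f : X → ℝ, ∫ θ, f (F θ) ∂angleMeasure = ∫ θ, f (G θ) ∂angleMeasure) :
    angleMeasure.map F = angleMeasure.map G := by
  have := Measure.isProbabilityMeasure_map (μ := angleMeasure) hF.aemeasurable
  have := Measure.isProbabilityMeasure_map (μ := angleMeasure) hG.aemeasurable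
  refine Measure.ext fun s hs => (measureReal_eq_measureReal_iff).1 ?_
  rw [map_measureReal_apply hF hs, map_measureReal_apply hG hs,
    ← integral_indicator_one (hF hs), ← integral_indicator_one (hG hs)]
  exact h (s.indicator 1)

theorem map_angleMeasure_add (hF : Measurable F) (hp : Function.Periodic F (2 * π)) (t : ℝ) :
    angleMeasure.map (fun θ => F (θ + t)) = angleMeasure.map F :=
  map_angleMeasure_congr (by fun_prop) hF fun f =>
    integral_angleMeasure_add (f := fun θ => f (F θ)) (fun θ => congrArg f (hp θ)) t

theorem map_angleMeasure_neg (hF : Measurable F) (hp : Function.Periodic F (2 * π)) :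
    angleMeasure.map (fun θ => F (-θ)) = angleMeasure.map F :=
  map_angleMeasure_congr (by fun_prop) hF fun f =>
    integral_angleMeasure_neg (f := fun θ => f (F θ)) (fun θ => congrArg f (hp θ))

end Map

theorem exists_polar (p q : ℝ) : ∃ ρ φ : ℝ, 0 ≤ ρ ∧ ρ ^ 2 = p ^ 2 + q ^ 2 ∧
    p = ρ * cos φ ∧ q = ρ * sin φ := by
  refine ⟨‖(⟨p, q⟩ : ℂ)‖, Complex.arg ⟨p, q⟩, norm_nonneg _, ?_, ?_, ?_⟩
  · rw [Complex.sq_norm, Complex.normSq_mk]; ring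
  · exact (Complex.norm_mul_cos_arg ⟨p, q⟩).symm
  · exact (Complex.norm_mul_sin_arg ⟨p, q⟩).symm

theorem countable_cos_eq (c : ℝ) : {θ : ℝ | cos θ = c}.Countable := by
  by_cases hc : ∃ θ₀, cos θ₀ = c
  · obtain ⟨θ₀, rfl⟩ := hc
    refine ((countable_range fun k : ℤ => 2 * k * π + θ₀).union
      (countable_range fun k : ℤ => 2 * k * π - θ₀)).mono fun θ hθ => ?_
    obtain ⟨k, hk | hk⟩ := Real.cos_eq_cos_iff.1 (Eq.symm hθ)
    · exact Or.inl ⟨k, hk.symm⟩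
    · exact Or.inr ⟨k, hk.symm⟩
  · refine Set.countable_empty.mono fun θ hθ => hc ⟨θ, hθ⟩

theorem ae_angleMeasure_of_countable {s : Set ℝ} (hs : s.Countable) :
    ∀ᵐ θ ∂angleMeasure, θ ∉ s :=
  (cond_absolutelyContinuous (μ := volume) (s := Set.Ico (0 : ℝ) (2 * π))).ae_le
    (measure_eq_zero_iff_ae_notMem.1 (hs.measure_zero volume))

theorem ae_cos_sub_ne (c φ : ℝ) : ∀ᵐ θ ∂angleMeasure, cos (θ - φ) ≠ c :=
  ae_angleMeasure_of_countable
    ((countable_cos_eq c).preimage_of_injOn (sub_left_injective (b := φ)).injOn)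

theorem ae_trig_ne_zero {A B C : ℝ} (h : ¬ (A = 0 ∧ B = 0 ∧ C = 0)) :
    ∀ᵐ θ ∂angleMeasure, A + B * cos θ + C * sin θ ≠ 0 := by
  obtain ⟨ρ, φ, hρ, hρ2, hB, hC⟩ := exists_polar B C
  rcases hρ.eq_or_lt with h0 | h0
  · have hB0 : B = 0 := by rw [hB, ← h0, zero_mul]
    have hC0 : C = 0 := by rw [hC, ← h0, zero_mul]
    refine ae_of_all _ fun θ => ?_
    simp only [hB0, hC0, zero_mul, add_zero]
    exact fun hA => h ⟨hA, hB0, hC0⟩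
  · filter_upwards [ae_cos_sub_ne (-A / ρ) φ] with θ hθ h1
    refine hθ ?_
    rw [eq_div_iff h0.ne', cos_sub]
    rw [hB, hC] at h1
    linarith

/-! ### Orthonormal frames and circles -/

/-- An orthonormal frame consisting of a point of the sphere and a basis of the tangent space. -/
structure SphereFrame where
  c : E3
  e₀ : E3
  e₁ : E3
  norm_c : ‖c‖ = 1
  norm_e₀ : ‖e₀‖ = 1
  norm_e₁ : ‖e₁‖ = 1
  inner_c_e₀ : inner ℝ c e₀ = 0
  inner_c_e₁ : inner ℝ c e₁ = 0
  inner_e₀_e₁ : inner ℝ e₀ e₁ = 0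

namespace SphereFrame

variable (F : SphereFrame)

/-- The unit tangent vector with angular coordinate `θ`. -/
noncomputable def dir (θ : ℝ) : E3 := cos θ • F.e₀ + sin θ • F.e₁

/-- The point with angular coordinate `θ` on the circle of radius `r` around `F.c`. -/
noncomputable def vec (r θ : ℝ) : E3 := cos r • F.c + sin r • F.dir θ

theorem inner_dir_dir (θ : ℝ) : inner ℝ (F.dir θ) (F.dir θ) = 1 := by
  simp only [dir, inner_add_left, inner_add_right, inner_smul_left, inner_smul_right,
    real_inner_self_eq_norm_sq, F.norm_e₀, F.norm_e₁, F.inner_e₀_e₁, real_inner_comm F.e₀ F.e₁]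
  simp
  linarith [cos_sq_add_sin_sq θ]

theorem norm_dir (θ : ℝ) : ‖F.dir θ‖ = 1 := by
  have := F.inner_dir_dir θ
  rw [real_inner_self_eq_norm_sq] at this
  exact (pow_eq_one_iff_of_nonneg (norm_nonneg _) two_ne_zero).1 this

theorem inner_c_dir (θ : ℝ) : inner ℝ F.c (F.dir θ) = 0 := by
  simp [dir, inner_add_right, inner_smul_right, F.inner_c_e₀, F.inner_c_e₁]

theorem norm_vec (r θ : ℝ) : ‖F.vec r θ‖ = 1 := by
  have : ‖F.vec r θ‖ ^ 2 = 1 := by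
    rw [← real_inner_self_eq_norm_sq]
    simp only [vec, inner_add_left, inner_add_right, inner_smul_left, inner_smul_right,
      inner_dir_dir, real_inner_comm F.c (F.dir θ), inner_c_dir, real_inner_self_eq_norm_sq F.c,
      F.norm_c]
    simp
    linarith [cos_sq_add_sin_sq r]
  exact (pow_eq_one_iff_of_nonneg (norm_nonneg _) two_ne_zero).1 this

/-- `SphereFrame.vec` as a point of the sphere. -/
noncomputable def point (r θ : ℝ) : S2 :=
  ⟨F.vec r θ, by rw [mem_sphere_zero_iff_norm]; exact F.norm_vec r θ⟩

/-- The centre of the frame as a point of the sphere. -/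
def center : S2 := ⟨F.c, by rw [mem_sphere_zero_iff_norm]; exact F.norm_c⟩

/-- The antipodal frame. -/
def antipode : SphereFrame where
  c := -F.c
  e₀ := -F.e₀
  e₁ := -F.e₁
  norm_c := by rw [norm_neg, F.norm_c]
  norm_e₀ := by rw [norm_neg, F.norm_e₀]
  norm_e₁ := by rw [norm_neg, F.norm_e₁]
  inner_c_e₀ := by rw [inner_neg_neg, F.inner_c_e₀]
  inner_c_e₁ := by rw [inner_neg_neg, F.inner_c_e₁]
  inner_e₀_e₁ := by rw [inner_neg_neg, F.inner_e₀_e₁]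

theorem antipode_center : F.antipode.center = -F.center := rfl

theorem antipode_point (r θ : ℝ) : F.antipode.point r θ = -F.point r θ := by
  refine Subtype.ext ?_
  simp [point, vec, dir, antipode]
  abel

theorem continuous_vec (r : ℝ) : Continuous (F.vec r) := by unfold vec dir; fun_prop

theorem continuous_point (r : ℝ) : Continuous (F.point r) :=
  (F.continuous_vec r).subtype_mk _

theorem periodic_dir : Function.Periodic F.dir (2 * π) := fun θ => by simp [dir]

theorem periodic_point (r : ℝ) : Function.Periodic (F.point r) (2 * π) := fun θ =>
  Subtype.ext (by simp [point, vec, F.periodic_dir θ])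

theorem expand (x : E3) :
    x = inner ℝ F.c x • F.c + inner ℝ F.e₀ x • F.e₀ + inner ℝ F.e₁ x • F.e₁ := by
  have ho : Orthonormal ℝ ![F.c, F.e₀, F.e₁] := by
    rw [orthonormal_iff_ite]
    intro i j
    fin_cases i <;> fin_cases j <;>
    simp [F.norm_c, F.norm_e₀, F.norm_e₁, F.inner_c_e₀, F.inner_c_e₁,
      F.inner_e₀_e₁, real_inner_comm F.c F.e₀, real_inner_comm F.c F.e₁, real_inner_comm F.e₀ F.e₁]
  let b := (basisOfOrthonormalOfCardEqFinrank ho (by simp)).toOrthonormalBasis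
    (by rw [coe_basisOfOrthonormalOfCardEqFinrank]; exact ho)
  have hb : ⇑b = ![F.c, F.e₀, F.e₁] := by
    simp [b]
  have := b.sum_repr' x
  rw [Fin.sum_univ_three, hb] at this
  exact this.symm

/-- A frame at a given point. -/
noncomputable def ofCenter (c : S2) : SphereFrame where
  c := c
  e₀ := circleFrame c 0
  e₁ := circleFrame c 1
  norm_c := by simp
  norm_e₀ := (circleFrame c).orthonormal.1 0
  norm_e₁ := (circleFrame c).orthonormal.1 1
  inner_c_e₀ := Submodule.mem_orthogonal_singleton_iff_inner_right.1 (circleFrame c 0).2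
  inner_c_e₁ := Submodule.mem_orthogonal_singleton_iff_inner_right.1 (circleFrame c 1).2
  inner_e₀_e₁ := (circleFrame c).orthonormal.2 (show (0 : Fin 2) ≠ 1 by decide)

theorem ofCenter_center (c : S2) : (ofCenter c).center = c := rfl

theorem exists_dir_eq {F G : SphereFrame} (h : F.c = G.c) :
    ∃ t, (∀ θ, F.dir θ = G.dir (θ + t)) ∨ (∀ θ, F.dir θ = G.dir (-θ + t)) := by
  have h0 := G.expand F.e₀
  have h1 := G.expand F.e₁
  rw [← h, F.inner_c_e₀, zero_smul, zero_add] at h0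
  rw [← h, F.inner_c_e₁, zero_smul, zero_add] at h1
  set p := inner ℝ G.e₀ F.e₀
  set q := inner ℝ G.e₁ F.e₀
  set p' := inner ℝ G.e₀ F.e₁
  set q' := inner ℝ G.e₁ F.e₁
  have key : ∀ a b c d : ℝ, inner ℝ (a • G.e₀ + b • G.e₁) (c • G.e₀ + d • G.e₁) = a * c + b * d := by
    intro a b c d
    simp only [inner_add_left, inner_add_right, inner_smul_left, inner_smul_right,
      real_inner_self_eq_norm_sq, G.norm_e₀, G.norm_e₁, G.inner_e₀_e₁,
      real_inner_comm G.e₀ G.e₁]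
    simp
    ring
  have n0 : p * p + q * q = 1 := by
    rw [← key, ← h0, real_inner_self_eq_norm_sq, F.norm_e₀, one_pow]
  have n1 : p' * p' + q' * q' = 1 := by
    rw [← key, ← h1, real_inner_self_eq_norm_sq, F.norm_e₁, one_pow]
  have n01 : p * p' + q * q' = 0 := by
    rw [← key, ← h0, ← h1, F.inner_e₀_e₁]
  obtain ⟨ρ, t, hρ, hρ2, hp, hq⟩ := exists_polar p q
  have hρ1 : ρ = 1 := by
    have : ρ ^ 2 = 1 := by rw [hρ2]; linarith
    exact (pow_eq_one_iff_of_nonneg hρ two_ne_zero).1 this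
  rw [hρ1, one_mul] at hp hq
  set d := p * q' - q * p'
  have hp' : p' = -q * d := by
    simp only [d]; linear_combination (-p') * n0 + p * n01
  have hq' : q' = p * d := by
    simp only [d]; linear_combination (-q') * n0 + q * n01
  have hd : d ^ 2 = 1 := by
    have : p' * p' + q' * q' = d ^ 2 := by
      rw [hp', hq']; linear_combination d ^ 2 * n0
    rw [← this, n1]
  refine ⟨t, ?_⟩
  rcases eq_or_eq_neg_of_sq_eq_sq d 1 (by rw [hd, one_pow]) with hd | hd
  · left
    intro θ
    rw [dir, dir, h0, h1, hp', hq', hd, hp, hq, cos_add, sin_add]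
    module
  · right
    intro θ
    rw [dir, dir, h0, h1, hp', hq', hd, hp, hq, cos_add, sin_add, cos_neg, sin_neg]
    module

theorem circleMeasure_center (r : ℝ) :
    circleMeasure F.center r = angleMeasure.map (F.point r) := by
  change angleMeasure.map ((ofCenter F.center).point r) = _
  obtain ⟨t, ht | ht⟩ := exists_dir_eq (F := ofCenter F.center) (G := F) rfl
  · rw [← map_angleMeasure_add (F.continuous_point r).measurable (F.periodic_point r) t]
    congr 1
    funext θ
    refine Subtype.ext ?_
    simp only [point, vec, ht]
    rfl
  · rw [← map_angleMeasure_add (F.continuous_point r).measurable (F.periodic_point r) t,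
      ← map_angleMeasure_neg (F := fun θ => F.point r (θ + t))]
    · congr 1
      funext θ
      refine Subtype.ext ?_
      simp only [point, vec, ht]
      rfl
    · exact ((F.continuous_point r).comp (continuous_add_const t)).measurable
    · intro θ
      change F.point r (θ + 2 * π + t) = _
      rw [add_right_comm, F.periodic_point r]

theorem ae_inner_vec_ne_zero {r : ℝ} (hr : r ∈ Ioo 0 (π / 2)) {N : E3} (hN : N ≠ 0) :
    ∀ᵐ θ ∂angleMeasure, inner ℝ (F.vec r θ) N ≠ 0 := by
  have hs : sin r ≠ 0 := (sin_pos_of_pos_of_lt_pi hr.1 (by linarith [hr.2, pi_pos])).ne'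
  have hc : cos r ≠ 0 := (cos_pos_of_mem_Ioo ⟨by linarith [hr.1, pi_pos], hr.2⟩).ne'
  have h := ae_trig_ne_zero (A := cos r * inner ℝ F.c N) (B := sin r * inner ℝ F.e₀ N)
    (C := sin r * inner ℝ F.e₁ N) (by
      rintro ⟨h0, h1, h2⟩
      refine hN ?_
      rw [F.expand N, (mul_eq_zero.1 h0).resolve_left hc, (mul_eq_zero.1 h1).resolve_left hs,
        (mul_eq_zero.1 h2).resolve_left hs]
      simp)
  filter_upwards [h] with θ hθ h0
  refine hθ ?_
  rw [← h0]
  simp only [vec, dir, inner_add_left, inner_smul_left]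
  simp
  ring

end SphereFrame

/-! ### Parametrization of the random points -/

/-- The sign `1` or `-1`. -/
def boolSign (ε : Bool) : ℝ := if ε then 1 else -1

/-- The point with angular coordinate `θ` on one of the four circles around the centres of two
frames and their antipodes. -/
noncomputable def pairPoint (F : Bool → SphereFrame) (r : ℝ) (j : Bool × Bool) (θ : ℝ) : S2 :=
  if j.2 then (F j.1).point r θ else (F j.1).antipode.point r θ

theorem coe_pairPoint (F : Bool → SphereFrame) (r : ℝ) (j : Bool × Bool) (θ : ℝ) :
    (pairPoint F r j θ : E3) = boolSign j.2 • (F j.1).vec r θ := by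
  obtain ⟨i, ε⟩ := j
  cases ε
  · simp only [pairPoint, boolSign, SphereFrame.antipode_point]
    simp [SphereFrame.point]
  · simp [pairPoint, boolSign, SphereFrame.point]

theorem continuous_pairPoint (F : Bool → SphereFrame) (r : ℝ) (j : Bool × Bool) :
    Continuous (pairPoint F r j) := by
  obtain ⟨i, ε⟩ := j
  cases ε
  · exact (F i).antipode.continuous_point r
  · exact (F i).continuous_point r

theorem measurable_pairPoint (F : Bool → SphereFrame) (r : ℝ) :
    Measurable fun p : (Bool × Bool) × ℝ => pairPoint F r p.1 p.2 :=
  measurable_from_prod_countable_right fun j => (continuous_pairPoint F r j).measurable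

theorem circlePairsMeasure_eq_map (F : Bool → SphereFrame) (r : ℝ) :
    circlePairsMeasure (F true).center (F false).center r =
      ((finUniform (Bool × Bool)).prod angleMeasure).map fun p => pairPoint F r p.1 p.2 := by
  refine Measure.ext fun s hs => ?_
  have hm := measurable_pairPoint F r
  rw [Measure.map_apply hm hs, Measure.prod_apply (hm hs), finUniform, lintegral_smul_measure,
    lintegral_count, tsum_fintype]
  have h : ∀ K : SphereFrame, circleMeasure K.center r s = angleMeasure (K.point r ⁻¹' s) :=
    fun K => by rw [K.circleMeasure_center, Measure.map_apply (K.continuous_point r).measurable hs]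
  simp only [circlePairsMeasure, ← SphereFrame.antipode_center, Measure.smul_apply,
    Measure.add_apply, h, Fintype.sum_prod_type, Fintype.sum_bool, smul_eq_mul]
  have hc : (Fintype.card (Bool × Bool) : ℝ≥0∞) = 4 := by simp
  rw [hc]
  congr 1
  rw [add_assoc]
  rfl

instance (c₁ c₂ : S2) (r : ℝ) : IsProbabilityMeasure (circlePairsMeasure c₁ c₂ r) := by
  have := circlePairsMeasure_eq_map (fun i => SphereFrame.ofCenter (if i then c₁ else c₂)) r
  simp only [SphereFrame.ofCenter_center, if_true, Bool.false_eq_true, if_false] at this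
  rw [this]
  exact Measure.isProbabilityMeasure_map (measurable_pairPoint _ r).aemeasurable

theorem nullOnGreatCircles_circleMeasure (c : S2) {r : ℝ} (hr : r ∈ Ioo 0 (π / 2)) :
    NullOnGreatCircles (circleMeasure c r) := by
  intro N hN
  have := (SphereFrame.ofCenter c).circleMeasure_center r
  rw [SphereFrame.ofCenter_center] at this
  rw [this]
  have hm := ((SphereFrame.ofCenter c).continuous_point r).measurable
  refine (ae_map_iff hm.aemeasurable ?_).2 ((SphereFrame.ofCenter c).ae_inner_vec_ne_zero hr hN)
  exact (isOpen_ne_fun (by fun_prop) continuous_const).measurableSet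

theorem nullOnGreatCircles_circlePairsMeasure (c₁ c₂ : S2) {r : ℝ} (hr : r ∈ Ioo 0 (π / 2)) :
    NullOnGreatCircles (circlePairsMeasure c₁ c₂ r) := by
  intro N hN
  refine Measure.ae_smul_measure ?_ _
  simp only [ae_add_measure_iff]
  exact ⟨⟨⟨nullOnGreatCircles_circleMeasure _ hr N hN, nullOnGreatCircles_circleMeasure _ hr N hN⟩,
    nullOnGreatCircles_circleMeasure _ hr N hN⟩, nullOnGreatCircles_circleMeasure _ hr N hN⟩

/-- The joint distribution of three independent pairs of uniform angles. -/
noncomputable def angleMeasure₃ : Measure ((Fin 3 → ℝ) × (Fin 3 → ℝ)) :=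
  (Measure.pi fun _ => angleMeasure).prod (Measure.pi fun _ => angleMeasure)

instance : IsProbabilityMeasure angleMeasure₃ := by unfold angleMeasure₃; infer_instance

/-- Three segments with prescribed circles and angles. -/
noncomputable def segments (F G : Bool → SphereFrame) (r : ℝ) (s t : Fin 3 → Bool × Bool)
    (p : (Fin 3 → ℝ) × (Fin 3 → ℝ)) (k : Fin 3) : S2 × S2 :=
  (pairPoint F r (s k) (p.1 k), pairPoint G r (t k) (p.2 k))

theorem measurable_segments (F G : Bool → SphereFrame) (r : ℝ) (s t : Fin 3 → Bool × Bool) :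
    Measurable (segments F G r s t) := by
  have h1 := fun k => (continuous_pairPoint F r (s k)).measurable
  have h2 := fun k => (continuous_pairPoint G r (t k)).measurable
  unfold segments
  fun_prop

theorem integrable_of_abs_le {X : Type*} [MeasurableSpace X] {μ : Measure X} [IsFiniteMeasure μ]
    {f : X → ℝ} (hf : Measurable f) {B : ℝ} (hB : ∀ x, |f x| ≤ B) : Integrable f μ :=
  Integrable.of_bound hf.aestronglyMeasurable B (ae_of_all _ hB)

theorem integral_pi_prod_finUniform {f : (Fin 3 → Bool × Bool) × (Fin 3 → ℝ) → ℝ}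
    (hf : Measurable f) {B : ℝ} (hB : ∀ x, |f x| ≤ B) :
    ∫ y, f (fun k => (y k).1, fun k => (y k).2)
      ∂(Measure.pi fun _ : Fin 3 => (finUniform (Bool × Bool)).prod angleMeasure) =
    (64 : ℝ)⁻¹ * ∑ s, ∫ θ, f (s, θ) ∂(Measure.pi fun _ : Fin 3 => angleMeasure) := by
  have h := (measurePreserving_arrowProdEquivProdArrow (Bool × Bool) ℝ (Fin 3)
    (fun _ => finUniform (Bool × Bool)) (fun _ => angleMeasure)).integral_comp' f
  refine h.trans ?_
  rw [integral_prod _ (integrable_of_abs_le hf hB), finUniform_pi, integral_finUniform]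
  simp

theorem integral_pi_circlePairsMeasure (F G : Bool → SphereFrame) (r : ℝ)
    {f : (Fin 3 → S2 × S2) → ℝ} (hf : Measurable f) {B : ℝ} (hB : ∀ x, |f x| ≤ B) :
    ∫ x, f x ∂(Measure.pi fun _ : Fin 3 =>
      (circlePairsMeasure (F true).center (F false).center r).prod
        (circlePairsMeasure (G true).center (G false).center r)) =
    (64 ^ 2 : ℝ)⁻¹ * ∑ s, ∑ t, ∫ p, f (segments F G r s t p) ∂angleMeasure₃ := by
  set Q := (finUniform (Bool × Bool)).prod angleMeasure
  have hF := measurable_pairPoint F r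
  have hG := measurable_pairPoint G r
  have hFG := hF.prodMap hG
  have hprob := Measure.isProbabilityMeasure_map (μ := Q.prod Q) hFG.aemeasurable
  have hpi : Measurable fun (x : Fin 3 → ((Bool × Bool) × ℝ) × ((Bool × Bool) × ℝ)) k =>
      Prod.map (fun p => pairPoint F r p.1 p.2) (fun p => pairPoint G r p.1 p.2) (x k) :=
    measurable_pi_lambda _ fun k => hFG.comp (measurable_pi_apply k)
  rw [circlePairsMeasure_eq_map F, circlePairsMeasure_eq_map G, Measure.map_prod_map _ _ hF hG,
    ← Measure.pi_map_pi (μ := fun _ : Fin 3 => Q.prod Q) fun _ => hFG.aemeasurable,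
    integral_map hpi.aemeasurable
      hf.aestronglyMeasurable]
  have h := (measurePreserving_arrowProdEquivProdArrow ((Bool × Bool) × ℝ) ((Bool × Bool) × ℝ)
    (Fin 3) (fun _ => Q) (fun _ => Q)).integral_comp' (fun z => f fun k =>
      (pairPoint F r (z.1 k).1 (z.1 k).2, pairPoint G r (z.2 k).1 (z.2 k).2))
  refine h.trans ?_
  have hm2 : ∀ z : Fin 3 → (Bool × Bool) × ℝ, Measurable fun q : (Fin 3 → Bool × Bool) ×
      (Fin 3 → ℝ) => f fun k =>
      (pairPoint F r (z k).1 (z k).2, pairPoint G r (q.1 k) (q.2 k)) := by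
    intro z
    refine hf.comp (measurable_pi_lambda _ fun k => measurable_const.prodMk ?_)
    exact hG.comp (show Measurable fun q : (Fin 3 → Bool × Bool) × (Fin 3 → ℝ) =>
      (q.1 k, q.2 k) by fun_prop)
  have hm3 : ∀ s t : Fin 3 → Bool × Bool, Measurable fun p : (Fin 3 → ℝ) × (Fin 3 → ℝ) =>
      f (segments F G r s t p) := fun s t => hf.comp (measurable_segments F G r s t)
  rw [integral_prod]
  swap
  · refine integrable_of_abs_le (hf.comp (measurable_pi_lambda _ fun k => ?_)) fun x => hB _
    exact hFG.comp (show Measurable fun z : (Fin 3 → (Bool × Bool) × ℝ) ×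
      (Fin 3 → (Bool × Bool) × ℝ) => (z.1 k, z.2 k) by fun_prop)
  have step : ∀ z : Fin 3 → (Bool × Bool) × ℝ,
      ∫ y, f (fun k => (pairPoint F r (z k).1 (z k).2, pairPoint G r (y k).1 (y k).2))
        ∂(Measure.pi fun _ : Fin 3 => Q) =
      (64 : ℝ)⁻¹ * ∑ t : Fin 3 → Bool × Bool, ∫ ψ, f (fun k => (pairPoint F r (z k).1 (z k).2,
        pairPoint G r (t k) (ψ k))) ∂(Measure.pi fun _ : Fin 3 => angleMeasure) :=
    fun z => integral_pi_prod_finUniform (hm2 z) fun _ => hB _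
  simp only [step]
  have hm4 : Measurable fun q : (Fin 3 → Bool × Bool) × (Fin 3 → ℝ) => (64 : ℝ)⁻¹ * ∑ t,
      ∫ ψ, f (segments F G r q.1 t (q.2, ψ)) ∂(Measure.pi fun _ : Fin 3 => angleMeasure) := by
    refine measurable_from_prod_countable_right fun s => ?_
    refine measurable_const.mul (Finset.measurable_sum _ fun t _ => ?_)
    exact (hm3 s t).stronglyMeasurable.integral_prod_right.measurable
  have hb : ∀ (s t : Fin 3 → Bool × Bool) (θ : Fin 3 → ℝ),
      |∫ ψ, f (segments F G r s t (θ, ψ)) ∂(Measure.pi fun _ : Fin 3 => angleMeasure)| ≤ B := by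
    intro s t θ
    have := norm_integral_le_of_norm_le_const (μ := Measure.pi fun _ : Fin 3 => angleMeasure)
      (f := fun ψ => f (segments F G r s t (θ, ψ))) (C := B) (ae_of_all _ fun ψ => hB _)
    simpa using this
  have h2 := integral_pi_prod_finUniform hm4 (B := |(64 : ℝ)⁻¹| * ∑ _t : Fin 3 → Bool × Bool, B)
    fun q => by
      rw [abs_mul]
      refine mul_le_mul_of_nonneg_left ?_ (abs_nonneg _)
      exact (Finset.abs_sum_le_sum_abs _ _).trans (Finset.sum_le_sum fun t _ => hb _ _ _)
  refine h2.trans ?_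
  have e : ((64 : ℝ) ^ 2)⁻¹ = 64⁻¹ * 64⁻¹ := by norm_num
  rw [e, mul_assoc]
  congr 1
  rw [Finset.mul_sum]
  refine Finset.sum_congr rfl fun s _ => ?_
  rw [integral_const_mul, integral_finsetSum]
  · congr 1
    refine Finset.sum_congr rfl fun t _ => ?_
    rw [angleMeasure₃, integral_prod _ (integrable_of_abs_le (hm3 s t) fun _ => hB _)]
  · intro t _
    exact integrable_of_abs_le (hm3 s t).stronglyMeasurable.integral_prod_right.measurable (hb s t)

/-! ### Summation over the signs -/

theorem sum_fin_three_fun {A : Type*} [Fintype A] [DecidableEq A] (f : (Fin 3 → A) → ℝ) :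
    ∑ x, f x = ∑ a, ∑ b, ∑ c, f ![a, b, c] := by
  let e : (Fin 3 → A) ≃ A × A × A :=
    { toFun := fun x => (x 0, x 1, x 2)
      invFun := fun y => ![y.1, y.2.1, y.2.2]
      left_inv := fun x => by ext i; fin_cases i <;> rfl
      right_inv := fun y => rfl }
  rw [← e.symm.sum_comp, Fintype.sum_prod_type]
  refine Finset.sum_congr rfl fun a _ => ?_
  rw [Fintype.sum_prod_type]
  rfl

/-- The indicator, as a polynomial in the signs, of the event that three great circles carry
pairwise crossing segments with ends at the given points or their antipodes. -/
noncomputable def triPoly (a b : Fin 3 → Fin 3 → ℝ) : ℝ :=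
  (1 + a 0 1 * b 0 1 * (a 0 2 * b 0 2)) / 2 * ((1 + a 1 0 * b 1 0 * (a 1 2 * b 1 2)) / 2) *
    ((1 + a 2 0 * b 2 0 * (a 2 1 * b 2 1)) / 2) *
    ((1 - b 0 1 * b 1 0 * (b 0 2 * b 2 0) * (b 1 2 * b 2 1)) / 2)

theorem boolSign_mul_self (ε : Bool) : boolSign ε * boolSign ε = 1 := by
  cases ε <;> norm_num [boolSign]

theorem boolSign_ne_zero (ε : Bool) : boolSign ε ≠ 0 := by
  cases ε <;> norm_num [boolSign]

theorem sign_boolSign_mul (ε : Bool) (x : ℝ) :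
    Real.sign (boolSign ε * x) = boolSign ε * Real.sign x := by
  cases ε
  · simp [boolSign, Real.sign_neg]
  · simp [boolSign]

open Classical in
theorem ite_allPosOrNeg {x₁ x₂ x₃ x₄ : ℝ} (h₁ : x₁ ≠ 0) (h₂ : x₂ ≠ 0) (h₃ : x₃ ≠ 0) (h₄ : x₄ ≠ 0) :
    (if AllPosOrNeg x₁ x₂ x₃ x₄ then 1 else 0 : ℝ) =
      (1 + x₁.sign * x₂.sign) / 2 * ((1 + x₃.sign * x₄.sign) / 2) *
        ((1 + x₁.sign * x₃.sign) / 2) := by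
  unfold AllPosOrNeg
  rcases lt_or_gt_of_ne h₁ with k₁ | k₁ <;> rcases lt_or_gt_of_ne h₂ with k₂ | k₂ <;>
  rcases lt_or_gt_of_ne h₃ with k₃ | k₃ <;> rcases lt_or_gt_of_ne h₄ with k₄ | k₄ <;>
  simp [Real.sign_of_neg, Real.sign_of_pos, k₁, k₂, k₃, k₄, k₁.not_gt, k₂.not_gt,
    k₃.not_gt, k₄.not_gt]

/-- The ends of a segment multiplied by signs. -/
def signedEnds (ε η : Bool) (e : E3 × E3) : E3 × E3 := (boolSign ε • e.1, boolSign η • e.2)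

theorem sideFst_signedEnds (ε η ε' η' : Bool) (e f : E3 × E3) :
    sideFst (signedEnds ε η e) (signedEnds ε' η' f) =
      boolSign ε * (boolSign ε' * (boolSign η' * sideFst e f)) := by
  simp [sideFst, signedEnds, trip]; ring

theorem sideSnd_signedEnds (ε η ε' η' : Bool) (e f : E3 × E3) :
    sideSnd (signedEnds ε η e) (signedEnds ε' η' f) =
      boolSign η * (boolSign ε' * (boolSign η' * sideSnd e f)) := by
  simp [sideSnd, signedEnds, trip]; ring

open Classical in
theorem ite_strictCross_signedEnds (ε η ε' η' : Bool) {e f : E3 × E3} (h₁ : sideFst e f ≠ 0)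
    (h₂ : sideSnd e f ≠ 0) (h₃ : sideFst f e ≠ 0) (h₄ : sideSnd f e ≠ 0) :
    (if StrictCross (signedEnds ε η e) (signedEnds ε' η' f) then 1 else 0 : ℝ) =
      (1 - boolSign ε * boolSign η * ((sideFst e f).sign * (sideSnd e f).sign)) / 2 *
      ((1 - boolSign ε' * boolSign η' * ((sideFst f e).sign * (sideSnd f e).sign)) / 2) *
      ((1 - boolSign ε * boolSign ε' * ((sideSnd e f).sign * (sideSnd f e).sign)) / 2) := by
  have hb := boolSign_ne_zero
  simp only [StrictCross, sideFst_signedEnds, sideSnd_signedEnds]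
  rw [ite_allPosOrNeg (by simp [hb, h₂]) (by simp [hb, h₁]) (by simp [hb, h₄]) (by simp [hb, h₃])]
  simp only [Real.sign_neg, sign_boolSign_mul]
  have q1 := boolSign_mul_self ε
  have q2 := boolSign_mul_self η
  have q3 := boolSign_mul_self ε'
  have q4 := boolSign_mul_self η'
  congr 1
  · congr 1
    · congr 2
      linear_combination (-(boolSign ε * boolSign η * (sideSnd e f).sign * (sideFst e f).sign) *
        (boolSign η' * boolSign η')) * q3 -
        (boolSign ε * boolSign η * (sideSnd e f).sign * (sideFst e f).sign) * q4
    · congr 2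
      linear_combination (-(boolSign ε' * boolSign η' * (sideSnd f e).sign * (sideFst f e).sign) *
        (boolSign η * boolSign η)) * q1 -
        (boolSign ε' * boolSign η' * (sideSnd f e).sign * (sideFst f e).sign) * q2
  · congr 2
    linear_combination (-(boolSign ε * boolSign ε' * (sideSnd e f).sign * (sideSnd f e).sign) *
        (boolSign η * boolSign η)) * q4 -
        (boolSign ε * boolSign ε' * (sideSnd e f).sign * (sideSnd f e).sign) * q2

theorem sum_prod_fin_three (g₀ g₁ g₂ : Bool → ℝ) :
    ∑ η : Fin 3 → Bool, g₀ (η 0) * g₁ (η 1) * g₂ (η 2) =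
      (g₀ true + g₀ false) * (g₁ true + g₁ false) * (g₂ true + g₂ false) := by
  rw [sum_fin_three_fun]
  simp only [Fintype.sum_bool, Matrix.cons_val_zero, Matrix.cons_val_one, Matrix.cons_val]
  ring

theorem sum_sign_polynomial (c d : Fin 3 → Fin 3 → ℝ) :
    ∑ ε : Fin 3 → Bool, ∑ η : Fin 3 → Bool,
      ((1 - boolSign (ε 0) * boolSign (η 0) * c 0 1) / 2 *
        ((1 - boolSign (ε 1) * boolSign (η 1) * c 1 0) / 2) *
        ((1 - boolSign (ε 0) * boolSign (ε 1) * d 0 1) / 2)) *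
      ((1 - boolSign (ε 0) * boolSign (η 0) * c 0 2) / 2 *
        ((1 - boolSign (ε 2) * boolSign (η 2) * c 2 0) / 2) *
        ((1 - boolSign (ε 0) * boolSign (ε 2) * d 0 2) / 2)) *
      ((1 - boolSign (ε 1) * boolSign (η 1) * c 1 2) / 2 *
        ((1 - boolSign (ε 2) * boolSign (η 2) * c 2 1) / 2) *
        ((1 - boolSign (ε 1) * boolSign (ε 2) * d 1 2) / 2)) =
    (1 + c 0 1 * c 0 2) / 2 * ((1 + c 1 0 * c 1 2) / 2) * ((1 + c 2 0 * c 2 1) / 2) *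
      (1 - d 0 1 * d 0 2 * d 1 2) := by
  have inner : ∀ ε : Fin 3 → Bool, ∑ η : Fin 3 → Bool,
      ((1 - boolSign (ε 0) * boolSign (η 0) * c 0 1) / 2 *
        ((1 - boolSign (ε 1) * boolSign (η 1) * c 1 0) / 2) *
        ((1 - boolSign (ε 0) * boolSign (ε 1) * d 0 1) / 2)) *
      ((1 - boolSign (ε 0) * boolSign (η 0) * c 0 2) / 2 *
        ((1 - boolSign (ε 2) * boolSign (η 2) * c 2 0) / 2) *
        ((1 - boolSign (ε 0) * boolSign (ε 2) * d 0 2) / 2)) *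
      ((1 - boolSign (ε 1) * boolSign (η 1) * c 1 2) / 2 *
        ((1 - boolSign (ε 2) * boolSign (η 2) * c 2 1) / 2) *
        ((1 - boolSign (ε 1) * boolSign (ε 2) * d 1 2) / 2)) =
      (1 + c 0 1 * c 0 2) / 2 * ((1 + c 1 0 * c 1 2) / 2) * ((1 + c 2 0 * c 2 1) / 2) *
      ((1 - boolSign (ε 0) * boolSign (ε 1) * d 0 1) / 2 *
        ((1 - boolSign (ε 0) * boolSign (ε 2) * d 0 2) / 2) *
        ((1 - boolSign (ε 1) * boolSign (ε 2) * d 1 2) / 2)) := by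
    intro ε
    have hg : ∀ (k : Bool) (u v : ℝ),
        (1 - boolSign k * boolSign true * u) / 2 * ((1 - boolSign k * boolSign true * v) / 2) +
        (1 - boolSign k * boolSign false * u) / 2 * ((1 - boolSign k * boolSign false * v) / 2) =
        (1 + u * v) / 2 := by
      intro k u v
      cases k <;> simp only [boolSign, if_true, Bool.false_eq_true, if_false] <;> ring
    have h := sum_prod_fin_three
      (fun x => (1 - boolSign (ε 0) * boolSign x * c 0 1) / 2 *
        ((1 - boolSign (ε 0) * boolSign x * c 0 2) / 2))
      (fun x => (1 - boolSign (ε 1) * boolSign x * c 1 0) / 2 *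
        ((1 - boolSign (ε 1) * boolSign x * c 1 2) / 2))
      (fun x => (1 - boolSign (ε 2) * boolSign x * c 2 0) / 2 *
        ((1 - boolSign (ε 2) * boolSign x * c 2 1) / 2))
    rw [hg, hg, hg] at h
    rw [← h, Finset.sum_mul]
    exact Finset.sum_congr rfl fun η _ => by ring
  simp only [inner]
  rw [← Finset.mul_sum]
  congr 1
  rw [sum_fin_three_fun]
  simp only [Fintype.sum_bool, Matrix.cons_val_zero, Matrix.cons_val_one, Matrix.cons_val, boolSign,
    if_true, Bool.false_eq_true, if_false]
  ring

open Classical in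
theorem sum_ite_pairwise_strictCross {E : Fin 3 → E3 × E3}
    (hE : ∀ k l, k ≠ l → sideFst (E k) (E l) ≠ 0 ∧ sideSnd (E k) (E l) ≠ 0) :
    ∑ ε : Fin 3 → Bool, ∑ η : Fin 3 → Bool,
      (if ∀ k l, k ≠ l → StrictCross (signedEnds (ε k) (η k) (E k)) (signedEnds (ε l) (η l) (E l))
        then 1 else 0 : ℝ) =
    2 * triPoly (fun k l => (sideFst (E k) (E l)).sign) (fun k l => (sideSnd (E k) (E l)).sign) := by
  have hsplit : ∀ X : Fin 3 → E3 × E3,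
      (if ∀ k l, k ≠ l → StrictCross (X k) (X l) then 1 else 0 : ℝ) =
      (if StrictCross (X 0) (X 1) then 1 else 0) * (if StrictCross (X 0) (X 2) then 1 else 0) *
      (if StrictCross (X 1) (X 2) then 1 else 0) := by
    intro X
    have : (∀ k l, k ≠ l → StrictCross (X k) (X l)) ↔
        (StrictCross (X 0) (X 1) ∧ StrictCross (X 0) (X 2)) ∧ StrictCross (X 1) (X 2) := by
      constructor
      · intro h
        exact ⟨⟨h 0 1 (by decide), h 0 2 (by decide)⟩, h 1 2 (by decide)⟩
      · rintro ⟨⟨h1, h2⟩, h3⟩ k l hkl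
        fin_cases k <;> fin_cases l <;>
          first | exact absurd rfl hkl | assumption | (apply StrictCross.symm; assumption)
    simp only [this]
    split_ifs <;> simp_all
  have key := sum_sign_polynomial
    (fun k l => (sideFst (E k) (E l)).sign * (sideSnd (E k) (E l)).sign)
    (fun k l => (sideSnd (E k) (E l)).sign * (sideSnd (E l) (E k)).sign)
  have h01 := hE 0 1 (by decide)
  have h10 := hE 1 0 (by decide)
  have h02 := hE 0 2 (by decide)
  have h20 := hE 2 0 (by decide)
  have h12 := hE 1 2 (by decide)
  have h21 := hE 2 1 (by decide)
  have hrw : ∀ ε η : Fin 3 → Bool,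
      (if ∀ k l, k ≠ l → StrictCross (signedEnds (ε k) (η k) (E k)) (signedEnds (ε l) (η l) (E l))
        then 1 else 0 : ℝ) = _ := fun ε η => by
    rw [hsplit fun k => signedEnds (ε k) (η k) (E k),
      ite_strictCross_signedEnds (ε 0) (η 0) (ε 1) (η 1) h01.1 h01.2 h10.1 h10.2,
      ite_strictCross_signedEnds (ε 0) (η 0) (ε 2) (η 2) h02.1 h02.2 h20.1 h20.2,
      ite_strictCross_signedEnds (ε 1) (η 1) (ε 2) (η 2) h12.1 h12.2 h21.1 h21.2]
  simp only [hrw]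
  rw [key]
  unfold triPoly
  ring

/-! ### The triangle probability as a sum over circles -/

/-- Three segments with ends on prescribed circles. -/
noncomputable def ends (F G : Bool → SphereFrame) (r : ℝ) (i j : Fin 3 → Bool)
    (p : (Fin 3 → ℝ) × (Fin 3 → ℝ)) (k : Fin 3) : E3 × E3 :=
  ((F (i k)).vec r (p.1 k), (G (j k)).vec r (p.2 k))

/-- The polynomial of `triPoly` in the signs of triple products of given segments. -/
noncomputable def sidePoly (E : Fin 3 → E3 × E3) : ℝ :=
  triPoly (fun k l => (sideFst (E k) (E l)).sign) (fun k l => (sideSnd (E k) (E l)).sign)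

/-- Three segments are in general position. -/
def EndsGeneric (E : Fin 3 → E3 × E3) : Prop :=
  ∀ k l, k ≠ l → sideFst (E k) (E l) ≠ 0 ∧ sideSnd (E k) (E l) ≠ 0

theorem isOpen_endsGeneric : IsOpen {E : Fin 3 → E3 × E3 | EndsGeneric E} := by
  simp only [EndsGeneric, Set.ofPred_forall, Set.ofPred_and]
  refine isOpen_iInter_of_finite fun k => isOpen_iInter_of_finite fun l =>
    isOpen_iInter_of_finite fun _ => IsOpen.inter ?_ ?_
  · exact isOpen_ne_fun (by unfold sideFst; fun_prop) continuous_const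
  · exact isOpen_ne_fun (by unfold sideSnd; fun_prop) continuous_const

theorem toE3_segments (F G : Bool → SphereFrame) (r : ℝ) (s t : Fin 3 → Bool × Bool)
    (p : (Fin 3 → ℝ) × (Fin 3 → ℝ)) (k : Fin 3) :
    toE3 (segments F G r s t p k) =
      signedEnds (s k).2 (t k).2 (ends F G r (fun k => (s k).1) (fun k => (t k).1) p k) := by
  simp [toE3, segments, signedEnds, ends, coe_pairPoint]

theorem abs_indicator_one_le {X : Type*} (s : Set X) (x : X) :
    |s.indicator (1 : X → ℝ) x| ≤ 1 := by
  by_cases h : x ∈ s <;> simp [h]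

section TriangleProb

variable (F G : Bool → SphereFrame) {r : ℝ} (hr : r ∈ Ioo 0 (π / 2))

include hr in
theorem ae_endsGeneric (i j : Fin 3 → Bool) :
    ∀ᵐ p ∂angleMeasure₃, EndsGeneric (ends F G r i j p) := by
  set bad : Set (Fin 3 → S2 × S2) := {x | ¬ EndsGeneric fun k => toE3 (x k)}
  have hbad : MeasurableSet bad := by
    have h := (isOpen_endsGeneric.preimage
      (show Continuous fun (x : Fin 3 → S2 × S2) k => toE3 (x k) by
        have := continuous_toE3
        fun_prop)).measurableSet.compl
    exact h
  have h := integral_pi_circlePairsMeasure F G r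
    (f := bad.indicator 1) (measurable_one.indicator hbad) (abs_indicator_one_le bad)
  have h0 : ∫ x, bad.indicator 1 x ∂(Measure.pi fun _ : Fin 3 =>
      (circlePairsMeasure (F true).center (F false).center r).prod
        (circlePairsMeasure (G true).center (G false).center r)) = (0 : ℝ) := by
    refine integral_eq_zero_of_ae ?_
    filter_upwards [ae_pi_side_ne_zero (V := Fin 3)
      (nullOnGreatCircles_circlePairsMeasure (F true).center (F false).center hr)
      (nullOnGreatCircles_circlePairsMeasure (G true).center (G false).center hr)] with x hx
    exact Set.indicator_of_notMem (fun hb : ¬ _ => hb hx) _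
  have hnn : ∀ s t p, 0 ≤ bad.indicator (1 : (Fin 3 → S2 × S2) → ℝ) (segments F G r s t p) :=
    fun s t p => Set.indicator_nonneg (fun _ _ => zero_le_one) _
  rw [h0] at h
  have h1 := (mul_eq_zero.1 h.symm).resolve_left (by norm_num)
  rw [Finset.sum_eq_zero_iff_of_nonneg fun s _ => Finset.sum_nonneg fun t _ =>
    integral_nonneg (hnn s t)] at h1
  have h2 := h1 (fun k => (i k, true)) (Finset.mem_univ _)
  rw [Finset.sum_eq_zero_iff_of_nonneg fun t _ => integral_nonneg (hnn _ t)] at h2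
  have h3 := h2 (fun k => (j k, true)) (Finset.mem_univ _)
  rw [integral_eq_zero_iff_of_nonneg (hnn _ _)] at h3
  · filter_upwards [h3] with p hp
    by_contra hcon
    have hmem : segments F G r (fun k => (i k, true)) (fun k => (j k, true)) p ∈ bad := by
      change ¬ EndsGeneric fun k => toE3 (segments F G r _ _ p k)
      simp only [toE3_segments]
      simpa [signedEnds, boolSign] using hcon
    rw [Set.indicator_of_mem hmem] at hp
    exact one_ne_zero hp
  · refine integrable_of_abs_le ((measurable_one.indicator hbad).comp
      (measurable_segments F G r _ _)) fun p => abs_indicator_one_le _ _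

include hr in
theorem triangleProb_eq_sum :
    triangleProb (circlePairsMeasure (F true).center (F false).center r)
      (circlePairsMeasure (G true).center (G false).center r) =
    (2 ^ 11 : ℝ)⁻¹ * ∑ i, ∑ j, ∫ p, sidePoly (ends F G r i j p) ∂angleMeasure₃ := by
  classical
  have hO := (isOpen_crossingSet (⊤ : SimpleGraph (Fin 3))).measurableSet
  have hb := abs_indicator_one_le (crossingSet (⊤ : SimpleGraph (Fin 3)))
  rw [triangleProb, ← integral_indicator_one hO,
    integral_pi_circlePairsMeasure F G r (measurable_one.indicator hO) hb]
  have hsum : ∀ f : (Fin 3 → Bool × Bool) → ℝ,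
      ∑ s, f s = ∑ i : Fin 3 → Bool, ∑ ε : Fin 3 → Bool, f fun k => (i k, ε k) := fun f => by
    rw [← (Equiv.arrowProdEquivProdArrow (Fin 3) (fun _ => Bool) (fun _ => Bool)).symm.sum_comp,
      Fintype.sum_prod_type]
    rfl
  have hint : ∀ s t, Integrable (fun p => (crossingSet (⊤ : SimpleGraph (Fin 3))).indicator
      (1 : (Fin 3 → S2 × S2) → ℝ) (segments F G r s t p)) angleMeasure₃ := fun s t =>
    integrable_of_abs_le ((measurable_one.indicator hO).comp (measurable_segments F G r s t))
      fun p => hb _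
  have hmain : ∀ i j : Fin 3 → Bool, ∑ ε : Fin 3 → Bool, ∑ η : Fin 3 → Bool,
      ∫ p, (crossingSet (⊤ : SimpleGraph (Fin 3))).indicator (1 : (Fin 3 → S2 × S2) → ℝ)
        (segments F G r (fun k => (i k, ε k)) (fun k => (j k, η k)) p) ∂angleMeasure₃ =
      2 * ∫ p, sidePoly (ends F G r i j p) ∂angleMeasure₃ := by
    intro i j
    rw [← integral_const_mul]
    simp_rw [← integral_finsetSum Finset.univ fun η _ => hint _ _]
    rw [← integral_finsetSum]
    swap
    · exact fun ε _ => integrable_finsetSum _ fun η _ => hint _ _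
    refine integral_congr_ae ?_
    filter_upwards [ae_endsGeneric F G hr i j] with p hp
    rw [sidePoly, ← sum_ite_pairwise_strictCross hp]
    refine Finset.sum_congr rfl fun ε _ => Finset.sum_congr rfl fun η _ => ?_
    simp only [Set.indicator_apply, crossingSet, Set.mem_ofPred_eq, SimpleGraph.top_adj,
      toE3_segments, Pi.one_apply]
  have hre : ∑ s, ∑ t, ∫ p, (crossingSet (⊤ : SimpleGraph (Fin 3))).indicator (1 : (Fin 3 → S2 × S2) → ℝ)
      (segments F G r s t p) ∂angleMeasure₃ =
      ∑ i, ∑ j, 2 * ∫ p, sidePoly (ends F G r i j p) ∂angleMeasure₃ := by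
    rw [hsum]
    refine Finset.sum_congr rfl fun i _ => ?_
    simp_rw [hsum (fun t => ∫ p, (crossingSet (⊤ : SimpleGraph (Fin 3))).indicator (1 : (Fin 3 → S2 × S2) → ℝ)
      (segments F G r _ t p) ∂angleMeasure₃)]
    rw [Finset.sum_comm]
    exact Finset.sum_congr rfl fun j _ => hmain i j
  rw [hre]
  simp_rw [← Finset.mul_sum]
  norm_num
  ring

end TriangleProb

/-! ### Marginals of product measures -/

section Marginals

variable {X : Type*} [MeasurableSpace X] {μ : Measure X} [IsProbabilityMeasure μ]
  {ι : Type*} [Fintype ι]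

theorem measurePreserving_pi_pair {k l : ι} (h : k ≠ l) :
    MeasurePreserving (fun x : ι → X => (x k, x l)) (Measure.pi fun _ => μ) (μ.prod μ) := by
  refine ⟨by fun_prop, ?_⟩
  have hind := (iIndepFun_pi (μ := fun _ : ι => μ) (X := fun _ y => y)
    fun _ => aemeasurable_id).indepFun h
  have hmap := (indepFun_iff_map_prod_eq_prod_map_map (measurable_pi_apply k).aemeasurable
    (measurable_pi_apply l).aemeasurable).1 hind
  rwa [(measurePreserving_eval (fun _ : ι => μ) k).map_eq,
    (measurePreserving_eval (fun _ : ι => μ) l).map_eq] at hmap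

theorem measurePreserving_pi_triple {k l m : ι} (hkl : k ≠ l) (hkm : k ≠ m) (hlm : l ≠ m) :
    MeasurePreserving (fun x : ι → X => (x k, (x l, x m))) (Measure.pi fun _ => μ)
      (μ.prod (μ.prod μ)) := by
  refine ⟨by fun_prop, ?_⟩
  have hind := ((iIndepFun_pi (μ := fun _ : ι => μ) (X := fun _ y => y)
    fun _ => aemeasurable_id).indepFun_prodMk (fun i => measurable_pi_apply i) l m k
      hkl.symm hkm.symm).symm
  have hmap := (indepFun_iff_map_prod_eq_prod_map_map (measurable_pi_apply k).aemeasurable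
    (by fun_prop)).1 hind
  rwa [(measurePreserving_eval (fun _ : ι => μ) k).map_eq,
    (measurePreserving_pi_pair hlm).map_eq] at hmap

theorem integral_pi_pair {k l : ι} (h : k ≠ l) {f : X × X → ℝ} (hf : Measurable f) :
    ∫ x, f (x k, x l) ∂(Measure.pi fun _ : ι => μ) = ∫ p, f p ∂(μ.prod μ) := by
  rw [← (measurePreserving_pi_pair (μ := μ) h).map_eq,
    integral_map (by fun_prop) hf.aestronglyMeasurable]

theorem integral_pi_triple {k l m : ι} (hkl : k ≠ l) (hkm : k ≠ m) (hlm : l ≠ m)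
    {f : X × X × X → ℝ} (hf : Measurable f) :
    ∫ x, f (x k, x l, x m) ∂(Measure.pi fun _ : ι => μ) = ∫ p, f p ∂(μ.prod (μ.prod μ)) := by
  rw [← (measurePreserving_pi_triple (μ := μ) hkl hkm hlm).map_eq,
    integral_map (by fun_prop) hf.aestronglyMeasurable]

theorem ae_pi_pair {k l : ι} (h : k ≠ l) {q : X → X → Prop}
    (hq : MeasurableSet {p : X × X | q p.1 p.2}) (hae : ∀ x, ∀ᵐ y ∂μ, q x y) :
    ∀ᵐ x ∂(Measure.pi fun _ : ι => μ), q (x k) (x l) := by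
  have := (Measure.ae_prod_iff_ae_ae hq).2 (ae_of_all μ hae)
  rw [← (measurePreserving_pi_pair (μ := μ) h).map_eq] at this
  exact ae_of_ae_map (by fun_prop) this

end Marginals

/-! ### Moments of the comparison of projections of random points of a circle -/

theorem measurable_real_sign : Measurable Real.sign := by
  unfold Real.sign
  exact Measurable.ite measurableSet_Iio measurable_const
    (Measurable.ite measurableSet_Ioi measurable_const measurable_const)

theorem real_sign_mul (x y : ℝ) : Real.sign (x * y) = Real.sign x * Real.sign y := by
  rcases lt_trichotomy x 0 with hx | hx | hx <;> rcases lt_trichotomy y 0 with hy | hy | hy <;>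
  simp [hx, hy, Real.sign_of_neg, Real.sign_of_pos, mul_neg_of_neg_of_pos,
    mul_neg_of_pos_of_neg, mul_pos_of_neg_of_neg]

theorem abs_real_sign_le (x : ℝ) : |Real.sign x| ≤ 1 := by
  rcases Real.sign_apply_eq x with h | h | h <;> simp [h]

/-- The sign of the difference of the projections of two points of the unit circle to the axis of
direction `φ`. -/
noncomputable def cmpSign (φ θ θ' : ℝ) : ℝ := Real.sign (cos (θ - φ) - cos (θ' - φ))

theorem cmpSign_swap (φ θ θ' : ℝ) : cmpSign φ θ' θ = -cmpSign φ θ θ' := by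
  rw [cmpSign, cmpSign, ← Real.sign_neg, neg_sub]

theorem abs_cmpSign_le (φ θ θ' : ℝ) : |cmpSign φ θ θ'| ≤ 1 := abs_real_sign_le _

@[fun_prop]
theorem Measurable.cmpSign {X : Type*} [MeasurableSpace X] {f g : X → ℝ} (φ : ℝ)
    (hf : Measurable f) (hg : Measurable g) : Measurable fun x => cmpSign φ (f x) (g x) := by
  unfold _root_.cmpSign
  exact measurable_real_sign.comp (by fun_prop)

theorem ae_cmpSign_ne_zero (φ θ : ℝ) : ∀ᵐ θ' ∂angleMeasure, cmpSign φ θ θ' ≠ 0 := by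
  filter_upwards [ae_cos_sub_ne (cos (θ - φ)) φ] with θ' h h0
  exact h (sub_eq_zero.1 (Real.sign_eq_zero_iff.1 h0)).symm

/-- The product distribution of three independent uniform angles. -/
noncomputable abbrev anglePi : Measure (Fin 3 → ℝ) := Measure.pi fun _ => angleMeasure

theorem ae_anglePi_cmpSign {k l : Fin 3} (h : k ≠ l) (φ : ℝ) :
    ∀ᵐ x ∂anglePi, cmpSign φ (x k) (x l) = 1 ∨ cmpSign φ (x k) (x l) = -1 := by
  have hm : MeasurableSet {p : ℝ × ℝ | cmpSign φ p.1 p.2 ≠ 0} :=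
    (measurableSet_eq_fun (by fun_prop) measurable_const).compl
  filter_upwards [ae_pi_pair (μ := angleMeasure) h hm (ae_cmpSign_ne_zero φ)] with x hx
  have := Real.sign_apply_eq_of_ne_zero (cos (x k - φ) - cos (x l - φ))
    (fun h0 => hx (by rw [cmpSign, h0, Real.sign_zero]))
  exact this.symm

theorem integral_cmpSign {k l : Fin 3} (h : k ≠ l) (φ : ℝ) :
    ∫ x, cmpSign φ (x k) (x l) ∂anglePi = 0 := by
  have h1 := integral_pi_pair (μ := angleMeasure) h (f := fun p => cmpSign φ p.1 p.2) (by fun_prop)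
  have h2 := integral_pi_pair (μ := angleMeasure) h.symm (f := fun p => cmpSign φ p.1 p.2)
    (by fun_prop)
  simp only at h1 h2
  have hsw : ∀ x : Fin 3 → ℝ, cmpSign φ (x l) (x k) = -cmpSign φ (x k) (x l) :=
    fun x => cmpSign_swap _ _ _
  simp only [hsw, integral_neg] at h2
  linarith

theorem integral_cmpSign_mul {k l m : Fin 3} (hkl : k ≠ l) (hkm : k ≠ m) (hlm : l ≠ m) (φ : ℝ) :
    ∫ x, cmpSign φ (x k) (x l) * cmpSign φ (x k) (x m) ∂anglePi = 1 / 3 := by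
  have key : ∀ {k l m : Fin 3}, k ≠ l → k ≠ m → l ≠ m →
      ∫ x, cmpSign φ (x k) (x l) * cmpSign φ (x k) (x m) ∂anglePi =
      ∫ p : ℝ × ℝ × ℝ, cmpSign φ p.1 p.2.1 * cmpSign φ p.1 p.2.2
        ∂(angleMeasure.prod (angleMeasure.prod angleMeasure)) := fun hkl hkm hlm =>
    integral_pi_triple (μ := angleMeasure) hkl hkm hlm
      (f := fun p => cmpSign φ p.1 p.2.1 * cmpSign φ p.1 p.2.2) (by fun_prop)
  have hint : ∀ k l m : Fin 3,
      Integrable (fun x => cmpSign φ (x k) (x l) * cmpSign φ (x k) (x m)) anglePi := fun k l m =>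
    integrable_of_abs_le (B := 1) (by fun_prop) fun x => by
      rw [abs_mul]
      exact mul_le_one₀ (abs_cmpSign_le _ _ _) (abs_nonneg _) (abs_cmpSign_le _ _ _)
  have hsum : ∫ x, (cmpSign φ (x k) (x l) * cmpSign φ (x k) (x m) +
      cmpSign φ (x l) (x k) * cmpSign φ (x l) (x m)) +
      cmpSign φ (x m) (x k) * cmpSign φ (x m) (x l) ∂anglePi = 1 := by
    have h1 : ∫ _x : Fin 3 → ℝ, (1 : ℝ) ∂anglePi = 1 := by simp
    rw [← h1]
    refine integral_congr_ae ?_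
    filter_upwards [ae_anglePi_cmpSign hkl φ, ae_anglePi_cmpSign hkm φ,
      ae_anglePi_cmpSign hlm φ] with x a b c
    rw [cmpSign_swap φ (x k) (x l), cmpSign_swap φ (x k) (x m), cmpSign_swap φ (x l) (x m)]
    unfold cmpSign at *
    set u := cos (x k - φ)
    set v := cos (x l - φ)
    set w := cos (x m - φ)
    have pos : ∀ {t : ℝ}, Real.sign t = 1 → 0 < t := fun {t} ht => by
      by_contra hcon
      rcases (not_lt.1 hcon).lt_or_eq with h | h
      · rw [Real.sign_of_neg h] at ht; norm_num at ht
      · rw [h, Real.sign_zero] at ht; norm_num at ht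
    have neg : ∀ {t : ℝ}, Real.sign t = -1 → t < 0 := fun {t} ht => by
      have := pos (t := -t) (by rw [Real.sign_neg, ht, neg_neg])
      linarith
    rcases a with a | a <;> rcases b with b | b <;> rcases c with c | c <;> rw [a, b, c]
    any_goals norm_num
    · linarith [pos a, neg b, pos c]
    · linarith [neg a, pos b, neg c]
  have e1 := integral_add (hint k l m) (hint l k m)
  have e2 := integral_add ((hint k l m).add (hint l k m)) (hint m k l)
  simp only [Pi.add_apply] at e2
  rw [e2, e1, key hkl hkm hlm, key hkl.symm hlm hkm,
    key hkm.symm hlm.symm hkl] at hsum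
  rw [key hkl hkm hlm]
  linarith

theorem integral_sign_cos_sub_cos {g : ℝ} (hg : g ∈ Icc 0 π) :
    ∫ θ, Real.sign (cos g - cos θ) ∂angleMeasure = 1 - 2 * (g / π) := by
  obtain ⟨h0, hπ⟩ := hg
  have hm : Measurable fun θ => Real.sign (cos g - cos θ) := measurable_real_sign.comp (by fun_prop)
  have hii : ∀ a b : ℝ, IntervalIntegrable (fun θ => Real.sign (cos g - cos θ)) volume a b :=
    fun a b => ⟨integrable_of_abs_le hm fun _ => abs_real_sign_le _,
      integrable_of_abs_le hm fun _ => abs_real_sign_le _⟩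
  have hlt : ∀ {a b : ℝ}, 0 ≤ a → a < b → b ≤ π → cos b < cos a := fun ha hab hb =>
    strictAntiOn_cos ⟨ha, hab.le.trans hb⟩ ⟨ha.trans hab.le, hb⟩ hab
  have hc : ∀ θ, cos θ = cos (2 * π - θ) := fun θ => by rw [cos_two_pi_sub]
  have i1 : ∫ θ in 0..g, Real.sign (cos g - cos θ) = ∫ θ in 0..g, (-1 : ℝ) := by
    refine intervalIntegral.integral_congr_Ioo_of_le h0 fun θ hθ => ?_
    exact Real.sign_of_neg (sub_neg.2 (hlt hθ.1.le hθ.2 hπ))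
  have i2 : ∫ θ in g..(2 * π - g), Real.sign (cos g - cos θ) =
      ∫ θ in g..(2 * π - g), (1 : ℝ) := by
    refine intervalIntegral.integral_congr_Ioo_of_le (by linarith) fun θ hθ => ?_
    refine Real.sign_of_pos (sub_pos.2 ?_)
    rcases le_total θ π with h | h
    · exact hlt h0 hθ.1 h
    · rw [hc θ]
      exact hlt h0 (by linarith [hθ.2]) (by linarith)
  have i3 : ∫ θ in (2 * π - g)..(2 * π), Real.sign (cos g - cos θ) =
      ∫ θ in (2 * π - g)..(2 * π), (-1 : ℝ) := by
    refine intervalIntegral.integral_congr_Ioo_of_le (by linarith) fun θ hθ => ?_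
    refine Real.sign_of_neg (sub_neg.2 ?_)
    rw [hc θ]
    exact hlt (by linarith [hθ.2]) (by linarith [hθ.1]) hπ
  rw [integral_angleMeasure, ← intervalIntegral.integral_add_adjacent_intervals (hii 0 g) (hii _ _),
    ← intervalIntegral.integral_add_adjacent_intervals (hii g (2 * π - g)) (hii _ _), i1, i2, i3]
  simp only [intervalIntegral.integral_const, smul_eq_mul]
  field_simp
  ring

theorem integral_cmpSign_mul_cmpSign_const (φ φ' a : ℝ) :
    ∫ b, cmpSign φ a b * cmpSign φ' a b ∂angleMeasure =
      1 - 2 * (arccos (cos (φ - φ')) / π) := by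
  set g := arccos (cos (φ - φ'))
  have hg : cos g = cos (φ - φ') := cos_arccos (neg_one_le_cos _) (cos_le_one _)
  rw [← integral_sign_cos_sub_cos ⟨arccos_nonneg _, arccos_le_pi _⟩,
    ← integral_angleMeasure_add (f := fun θ => Real.sign (cos g - cos θ)) (fun θ => by simp)
      (a - φ - φ')]
  refine integral_congr_ae ?_
  filter_upwards [ae_cmpSign_ne_zero φ a] with b hb
  have h1 : (cos (a - φ) - cos (b - φ)) * (cos (a - φ') - cos (b - φ')) =
      2 * sin ((a - b) / 2) ^ 2 * (cos g - cos (b + (a - φ - φ'))) := by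
    have e1 : (a - φ - (b - φ)) / 2 = (a - b) / 2 := by ring
    have e2 : (a - φ' - (b - φ')) / 2 = (a - b) / 2 := by ring
    rw [cos_sub_cos, cos_sub_cos, e1, e2, hg, cos_sub_cos]
    have e3 : (φ - φ' + (b + (a - φ - φ'))) / 2 = (a - φ' + (b - φ')) / 2 := by ring
    have e4 : (φ - φ' - (b + (a - φ - φ'))) / 2 = -((a - φ + (b - φ)) / 2) := by ring
    rw [e3, e4, sin_neg]
    ring
  have h2 : 0 < 2 * sin ((a - b) / 2) ^ 2 := by
    have : sin ((a - b) / 2) ≠ 0 := fun h0 => hb (by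
      have e1 : (a - φ - (b - φ)) / 2 = (a - b) / 2 := by ring
      rw [cmpSign, cos_sub_cos, e1, h0]
      simp)
    positivity
  rw [cmpSign, cmpSign, ← real_sign_mul, h1, real_sign_mul, Real.sign_of_pos h2, one_mul]

theorem abs_mul_cmpSign_le (φ φ' θ θ' : ℝ) : |cmpSign φ θ θ' * cmpSign φ' θ θ'| ≤ 1 := by
  rw [abs_mul]
  exact mul_le_one₀ (abs_cmpSign_le _ _ _) (abs_nonneg _) (abs_cmpSign_le _ _ _)

theorem integral_cmpSign_mul_cmpSign {k l : Fin 3} (h : k ≠ l) (φ φ' : ℝ) :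
    ∫ x, cmpSign φ (x k) (x l) * cmpSign φ' (x k) (x l) ∂anglePi =
      1 - 2 * (arccos (cos (φ - φ')) / π) := by
  rw [integral_pi_pair (μ := angleMeasure) h (f := fun p => cmpSign φ p.1 p.2 * cmpSign φ' p.1 p.2)
    (by fun_prop), integral_prod _ (integrable_of_abs_le (by fun_prop) fun p =>
      abs_mul_cmpSign_le φ φ' p.1 p.2)]
  simp only [integral_cmpSign_mul_cmpSign_const]
  simp

theorem integral_cmpSign_four {k l m : Fin 3} (hkl : k ≠ l) (hkm : k ≠ m) (hlm : l ≠ m)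
    (φ φ' : ℝ) :
    ∫ x, (cmpSign φ (x k) (x l) * cmpSign φ' (x k) (x l)) *
      (cmpSign φ (x k) (x m) * cmpSign φ' (x k) (x m)) ∂anglePi =
      (1 - 2 * (arccos (cos (φ - φ')) / π)) ^ 2 := by
  have hb : ∀ p : ℝ × ℝ × ℝ, |(cmpSign φ p.1 p.2.1 * cmpSign φ' p.1 p.2.1) *
      (cmpSign φ p.1 p.2.2 * cmpSign φ' p.1 p.2.2)| ≤ 1 := fun p => by
    rw [abs_mul]
    exact mul_le_one₀ (abs_mul_cmpSign_le _ _ _ _) (abs_nonneg _) (abs_mul_cmpSign_le _ _ _ _)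
  rw [integral_pi_triple (μ := angleMeasure) hkl hkm hlm (f := fun p =>
    (cmpSign φ p.1 p.2.1 * cmpSign φ' p.1 p.2.1) * (cmpSign φ p.1 p.2.2 * cmpSign φ' p.1 p.2.2))
    (by fun_prop), integral_prod _ (integrable_of_abs_le (by fun_prop) hb)]
  have : ∀ a : ℝ, ∫ q : ℝ × ℝ, (cmpSign φ a q.1 * cmpSign φ' a q.1) *
      (cmpSign φ a q.2 * cmpSign φ' a q.2) ∂(angleMeasure.prod angleMeasure) =
      (1 - 2 * (arccos (cos (φ - φ')) / π)) ^ 2 := fun a => by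
    rw [integral_prod_mul (fun b => cmpSign φ a b * cmpSign φ' a b)
      (fun b => cmpSign φ a b * cmpSign φ' a b), integral_cmpSign_mul_cmpSign_const, sq]
  simp only [this]
  simp

/-! ### The limiting probabilities -/

theorem triPoly_eq (a b : Fin 3 → Fin 3 → ℝ) {k l m : Fin 3} (hkl : k ≠ l) (hkm : k ≠ m)
    (hlm : l ≠ m) : triPoly a b =
    (1 + a k l * b k l * (a k m * b k m)) / 2 * ((1 + a l k * b l k * (a l m * b l m)) / 2) *
    ((1 + a m k * b m k * (a m l * b m l)) / 2) *
    ((1 - b k l * b l k * (b k m * b m k) * (b l m * b m l)) / 2) := by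
  unfold triPoly
  fin_cases k <;> fin_cases l <;> fin_cases m <;>
    first | exact absurd rfl hkl | exact absurd rfl hkm | exact absurd rfl hlm | skip
  all_goals (simp <;> ring)

theorem boolSign_of_ne {i i' : Bool} (h : i ≠ i') : boolSign i' = -boolSign i := by
  cases i <;> cases i' <;> simp_all [boolSign]

theorem boolSign_eq (i : Bool) : boolSign i = 1 ∨ boolSign i = -1 := by
  cases i <;> simp [boolSign]

theorem integrable_mul_angleMeasure₃ {f g : (Fin 3 → ℝ) → ℝ} (hf : Measurable f)
    (hg : Measurable g) {B B' : ℝ} (hfB : ∀ x, |f x| ≤ B) (hgB : ∀ x, |g x| ≤ B') :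
    Integrable (fun p => f p.1 * g p.2) angleMeasure₃ :=
  (integrable_of_abs_le hf hfB).mul_prod (integrable_of_abs_le hg hgB)

theorem integral_mul_angleMeasure₃ (f g : (Fin 3 → ℝ) → ℝ) :
    ∫ p, f p.1 * g p.2 ∂angleMeasure₃ = (∫ x, f x ∂anglePi) * ∫ y, g y ∂anglePi :=
  integral_prod_mul f g

theorem integral_fst_angleMeasure₃ (f : (Fin 3 → ℝ) → ℝ) :
    ∫ p, f p.1 ∂angleMeasure₃ = ∫ x, f x ∂anglePi := by
  have := integral_mul_angleMeasure₃ f fun _ => 1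
  simpa using this

theorem integral_snd_angleMeasure₃ (f : (Fin 3 → ℝ) → ℝ) :
    ∫ p, f p.2 ∂angleMeasure₃ = ∫ x, f x ∂anglePi := by
  have := integral_mul_angleMeasure₃ (fun _ => 1) f
  simpa using this

theorem ae_angleMeasure₃_fst {k l : Fin 3} (h : k ≠ l) (φ : ℝ) :
    ∀ᵐ p ∂angleMeasure₃, cmpSign φ (p.1 k) (p.1 l) = 1 ∨ cmpSign φ (p.1 k) (p.1 l) = -1 :=
  (Measure.quasiMeasurePreserving_fst (μ := anglePi) (ν := anglePi)).ae (ae_anglePi_cmpSign h φ)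

theorem ae_angleMeasure₃_snd {k l : Fin 3} (h : k ≠ l) (φ : ℝ) :
    ∀ᵐ p ∂angleMeasure₃, cmpSign φ (p.2 k) (p.2 l) = 1 ∨ cmpSign φ (p.2 k) (p.2 l) = -1 :=
  (Measure.quasiMeasurePreserving_snd (μ := anglePi) (ν := anglePi)).ae (ae_anglePi_cmpSign h φ)

/-- The angle between the directions of two phases, divided by `π`. -/
noncomputable def phaseAngle (φ φ' : ℝ) : ℝ := arccos (cos (φ - φ')) / π

theorem phaseAngle_comm (φ φ' : ℝ) : phaseAngle φ φ' = phaseAngle φ' φ := by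
  rw [phaseAngle, phaseAngle, ← cos_neg, neg_sub]

theorem integrable_cmpSign (k l : Fin 3) (φ : ℝ) :
    Integrable (fun x : Fin 3 → ℝ => cmpSign φ (x k) (x l)) anglePi :=
  integrable_of_abs_le (B := 1) (by fun_prop) fun x => abs_cmpSign_le φ (x k) (x l)

theorem integrable_cmpSign_mul (k l m n : Fin 3) (φ φ' : ℝ) :
    Integrable (fun x : Fin 3 → ℝ => cmpSign φ (x k) (x l) * cmpSign φ' (x m) (x n)) anglePi :=
  integrable_of_abs_le (B := 1) (by fun_prop) fun x => by
    rw [abs_mul]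
    exact mul_le_one₀ (abs_cmpSign_le _ _ _) (abs_nonneg _) (abs_cmpSign_le _ _ _)

theorem integral_const_add_add_add {X : Type*} [MeasurableSpace X] {μ : Measure X}
    [IsProbabilityMeasure μ] (c : ℝ) {f g h : X → ℝ} (hf : Integrable f μ) (hg : Integrable g μ)
    (hh : Integrable h μ) :
    ∫ x, (c + f x + g x + h x) ∂μ = c + ∫ x, f x ∂μ + ∫ x, g x ∂μ + ∫ x, h x ∂μ := by
  have h1 : Integrable (fun x => c + f x) μ := (integrable_const c).add hf
  have h2 : Integrable (fun x => c + f x + g x) μ := h1.add hg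
  rw [integral_add h2 hh, integral_add h1 hg, integral_add (integrable_const c) hf]
  simp

theorem integral_cmpSign_not_between {k l m : Fin 3} (hkl : k ≠ l) (hkm : k ≠ m) (hlm : l ≠ m)
    (φ φ' : ℝ) :
    ∫ x, (1 + cmpSign φ (x k) (x l) * cmpSign φ (x k) (x m)) *
      (1 + cmpSign φ' (x k) (x l) * cmpSign φ' (x k) (x m)) ∂anglePi =
      4 * (2 / 3 - phaseAngle φ φ' + phaseAngle φ φ' ^ 2) := by
  have h1 := integral_cmpSign_mul hkl hkm hlm φ
  have h2 := integral_cmpSign_mul hkl hkm hlm φ'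
  have h3 := integral_cmpSign_four hkl hkm hlm φ φ'
  have i1 := integrable_cmpSign_mul k l k m φ φ
  have i2 := integrable_cmpSign_mul k l k m φ' φ'
  have i3 : Integrable (fun x : Fin 3 → ℝ => (cmpSign φ (x k) (x l) * cmpSign φ' (x k) (x l)) *
      (cmpSign φ (x k) (x m) * cmpSign φ' (x k) (x m))) anglePi :=
    integrable_of_abs_le (B := 1) (by fun_prop) fun x => by
      rw [abs_mul]
      exact mul_le_one₀ (abs_mul_cmpSign_le _ _ _ _) (abs_nonneg _) (abs_mul_cmpSign_le _ _ _ _)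
  have e : ∀ x : Fin 3 → ℝ, (1 + cmpSign φ (x k) (x l) * cmpSign φ (x k) (x m)) *
      (1 + cmpSign φ' (x k) (x l) * cmpSign φ' (x k) (x m)) =
      1 + cmpSign φ (x k) (x l) * cmpSign φ (x k) (x m) +
      cmpSign φ' (x k) (x l) * cmpSign φ' (x k) (x m) +
      (cmpSign φ (x k) (x l) * cmpSign φ' (x k) (x l)) *
      (cmpSign φ (x k) (x m) * cmpSign φ' (x k) (x m)) := fun x => by ring
  simp only [e]
  rw [integral_const_add_add_add 1 i1 i2 i3, h1, h2, h3]
  simp only [phaseAngle]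
  ring

theorem integrable_not_between (k l m : Fin 3) (φ φ' : ℝ) :
    Integrable (fun x : Fin 3 → ℝ => 1 / 8 * ((1 + cmpSign φ (x m) (x k) * cmpSign φ (x m) (x l)) *
      (1 + cmpSign φ' (x m) (x k) * cmpSign φ' (x m) (x l)))) anglePi :=
  (integrable_of_abs_le (B := 2 * 2) (by fun_prop) fun x => by
    have h : ∀ φ, |1 + cmpSign φ (x m) (x k) * cmpSign φ (x m) (x l)| ≤ 2 := fun φ => by
      refine (abs_add_le _ _).trans ?_
      rw [abs_one, abs_mul]
      have := mul_le_one₀ (abs_cmpSign_le φ (x m) (x k)) (abs_nonneg _)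
        (abs_cmpSign_le φ (x m) (x l))
      linarith
    rw [abs_mul]
    exact mul_le_mul (h φ) (h φ') (abs_nonneg _) (by norm_num)).const_mul _

theorem integral_cmpSign_quadrant {k l : Fin 3} (h : k ≠ l) (φ φ' : ℝ) {u : ℝ}
    (hu : u = 1 ∨ u = -1) :
    ∫ x, (1 + u * cmpSign φ (x k) (x l)) * (1 + u * cmpSign φ' (x k) (x l)) ∂anglePi =
      2 * (1 - phaseAngle φ φ') := by
  have hi : ∀ φ, Integrable (fun x : Fin 3 → ℝ => u * cmpSign φ (x k) (x l)) anglePi := fun φ =>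
    (integrable_cmpSign k l φ).const_mul u
  have i3 := integrable_cmpSign_mul k l k l φ φ'
  have e : ∀ x : Fin 3 → ℝ,
      (1 + u * cmpSign φ (x k) (x l)) * (1 + u * cmpSign φ' (x k) (x l)) =
      1 + u * cmpSign φ (x k) (x l) + u * cmpSign φ' (x k) (x l) +
      cmpSign φ (x k) (x l) * cmpSign φ' (x k) (x l) := fun x => by
    rcases hu with rfl | rfl <;> ring
  simp only [e]
  rw [integral_const_add_add_add 1 (hi φ) (hi φ') i3, integral_const_mul, integral_const_mul,
    integral_cmpSign h, integral_cmpSign h, integral_cmpSign_mul_cmpSign h]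
  simp only [phaseAngle]
  ring

/-- The limit, as the radius tends to zero, of the polynomial of `triPoly` for three random
segments. -/
noncomputable def limitPoly (Φ Ψ : Bool → Bool → ℝ) (s : ℝ) (i j : Fin 3 → Bool)
    (p : (Fin 3 → ℝ) × (Fin 3 → ℝ)) : ℝ :=
  triPoly
    (fun k l => if i k = i l then cmpSign (Φ (i k) (j l)) (p.1 k) (p.1 l) else s * boolSign (i k))
    (fun k l => if j k = j l then cmpSign (Ψ (j k) (i l)) (p.2 k) (p.2 l) else s * boolSign (j k))

section LimitValues

variable {Φ Ψ : Bool → Bool → ℝ} {s : ℝ} {i j : Fin 3 → Bool} {k l m : Fin 3}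

theorem mul_boolSign_eq (hs : s = 1 ∨ s = -1) (x : Bool) :
    s * boolSign x = 1 ∨ s * boolSign x = -1 := by
  rcases hs with rfl | rfl <;> rcases boolSign_eq x with h | h <;> simp [h]

theorem integral_limitPoly_same (hkl : k ≠ l) (hkm : k ≠ m) (hlm : l ≠ m)
    (hi : i l = i k) (hi' : i m = i k) (hj : j l = j k) (hj' : j m = j k) :
    ∫ p, limitPoly Φ Ψ s i j p ∂angleMeasure₃ = 1 / 3 := by
  set φ := Φ (i k) (j k)
  set ψ := Ψ (j k) (i k)
  have h : ∫ p, limitPoly Φ Ψ s i j p ∂angleMeasure₃ = ∫ p, 1 / 4 +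
      (1 / 4 * (cmpSign φ (p.1 k) (p.1 l) * cmpSign φ (p.1 k) (p.1 m))) *
        (cmpSign ψ (p.2 k) (p.2 l) * cmpSign ψ (p.2 k) (p.2 m)) +
      (1 / 4 * (cmpSign φ (p.1 l) (p.1 k) * cmpSign φ (p.1 l) (p.1 m))) *
        (cmpSign ψ (p.2 l) (p.2 k) * cmpSign ψ (p.2 l) (p.2 m)) +
      (1 / 4 * (cmpSign φ (p.1 m) (p.1 k) * cmpSign φ (p.1 m) (p.1 l))) *
        (cmpSign ψ (p.2 m) (p.2 k) * cmpSign ψ (p.2 m) (p.2 l)) ∂angleMeasure₃ := by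
    refine integral_congr_ae ?_
    filter_upwards [ae_angleMeasure₃_fst hkl φ, ae_angleMeasure₃_fst hkm φ,
      ae_angleMeasure₃_fst hlm φ, ae_angleMeasure₃_snd hkl ψ, ae_angleMeasure₃_snd hkm ψ,
      ae_angleMeasure₃_snd hlm ψ] with p a b c a' b' c'
    rw [limitPoly, triPoly_eq _ _ hkl hkm hlm]
    simp only [hi, hi', hj, hj', if_true]
    rw [cmpSign_swap φ (p.1 k) (p.1 l), cmpSign_swap φ (p.1 k) (p.1 m),
      cmpSign_swap φ (p.1 l) (p.1 m), cmpSign_swap ψ (p.2 k) (p.2 l),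
      cmpSign_swap ψ (p.2 k) (p.2 m), cmpSign_swap ψ (p.2 l) (p.2 m)]
    rcases a with a | a <;> rcases b with b | b <;> rcases c with c | c <;>
    rcases a' with a' | a' <;> rcases b' with b' | b' <;> rcases c' with c' | c' <;>
    rw [a, b, c, a', b', c'] <;> norm_num
  have hI : ∀ k l m : Fin 3, Integrable (fun p : (Fin 3 → ℝ) × (Fin 3 → ℝ) =>
      (1 / 4 * (cmpSign φ (p.1 k) (p.1 l) * cmpSign φ (p.1 k) (p.1 m))) *
        (cmpSign ψ (p.2 k) (p.2 l) * cmpSign ψ (p.2 k) (p.2 m))) angleMeasure₃ := fun k l m =>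
    ((integrable_cmpSign_mul k l k m φ φ).const_mul _).mul_prod (integrable_cmpSign_mul k l k m ψ ψ)
  have hV : ∀ {k l m : Fin 3}, k ≠ l → k ≠ m → l ≠ m → ∫ p : (Fin 3 → ℝ) × (Fin 3 → ℝ),
      (1 / 4 * (cmpSign φ (p.1 k) (p.1 l) * cmpSign φ (p.1 k) (p.1 m))) *
        (cmpSign ψ (p.2 k) (p.2 l) * cmpSign ψ (p.2 k) (p.2 m)) ∂angleMeasure₃ = 1 / 36 := by
    intro k l m hkl hkm hlm
    rw [integral_mul_angleMeasure₃ (fun x => 1 / 4 * (cmpSign φ (x k) (x l) * cmpSign φ (x k) (x m)))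
      (fun x => cmpSign ψ (x k) (x l) * cmpSign ψ (x k) (x m)), integral_const_mul,
      integral_cmpSign_mul hkl hkm hlm, integral_cmpSign_mul hkl hkm hlm]
    norm_num
  rw [h, integral_const_add_add_add (1 / 4) (hI k l m) (hI l k m) (hI m k l), hV hkl hkm hlm,
    hV hkl.symm hlm hkm, hV hkm.symm hlm.symm hkl]
  norm_num

theorem adjacent_fst_identity {A B C B' C' D t : ℝ} (hA : A = 1 ∨ A = -1) (hB : B = 1 ∨ B = -1)
    (hC : C = 1 ∨ C = -1) (hB' : B' = 1 ∨ B' = -1) (hC' : C' = 1 ∨ C' = -1)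
    (hD : D = 1 ∨ D = -1) (ht : t = 1 ∨ t = -1) :
    (1 + A * D * (B' * t)) / 2 * ((1 + -A * -D * (C' * t)) / 2) *
      ((1 + -B * -t * (-C * -t)) / 2) * ((1 - D * -D * (t * -t) * (t * -t)) / 2) =
    1 / 8 * ((1 + B * C) * (1 + B' * C')) + t / 8 * A * (B' + C') * (1 + B * C) * D := by
  rcases hA with rfl | rfl <;> rcases hB with rfl | rfl <;> rcases hC with rfl | rfl <;>
  rcases hB' with rfl | rfl <;> rcases hC' with rfl | rfl <;> rcases hD with rfl | rfl <;>
  rcases ht with rfl | rfl <;> norm_num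

theorem integral_limitPoly_adjacent_fst (hs : s = 1 ∨ s = -1) (hkl : k ≠ l) (hkm : k ≠ m)
    (hlm : l ≠ m) (hi : i l = i k) (hi' : i m = i k) (hj : j l = j k) (hj' : j k ≠ j m) :
    ∫ p, limitPoly Φ Ψ s i j p ∂angleMeasure₃ = 1 / 2 * (2 / 3 -
      phaseAngle (Φ (i k) (j k)) (Φ (i k) (j m)) +
      phaseAngle (Φ (i k) (j k)) (Φ (i k) (j m)) ^ 2) := by
  let f : (Fin 3 → ℝ) → ℝ := fun x => s * boolSign (j k) / 8 *
    cmpSign (Φ (i k) (j k)) (x k) (x l) *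
    (cmpSign (Φ (i k) (j m)) (x k) (x m) + cmpSign (Φ (i k) (j m)) (x l) (x m)) *
    (1 + cmpSign (Φ (i k) (j k)) (x k) (x m) * cmpSign (Φ (i k) (j k)) (x l) (x m))
  let g : (Fin 3 → ℝ) → ℝ := fun x => 1 / 8 * ((1 + cmpSign (Φ (i k) (j k)) (x m) (x k) *
        cmpSign (Φ (i k) (j k)) (x m) (x l)) *
        (1 + cmpSign (Φ (i k) (j m)) (x m) (x k) *
        cmpSign (Φ (i k) (j m)) (x m) (x l)))
  have h : ∫ p, limitPoly Φ Ψ s i j p ∂angleMeasure₃ = ∫ p,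
      g p.1 +
      f p.1 * cmpSign (Ψ (j k) (i k)) (p.2 k) (p.2 l) ∂angleMeasure₃ := by
    refine integral_congr_ae ?_
    filter_upwards [ae_angleMeasure₃_fst hkl (Φ (i k) (j k)),
      ae_angleMeasure₃_fst hkm (Φ (i k) (j k)),
      ae_angleMeasure₃_fst hlm (Φ (i k) (j k)), ae_angleMeasure₃_fst hkm (Φ (i k) (j m)),
      ae_angleMeasure₃_fst hlm (Φ (i k) (j m)),
      ae_angleMeasure₃_snd hkl (Ψ (j k) (i k))] with p a b c d e a'
    have key := adjacent_fst_identity a b c d e a' (mul_boolSign_eq hs (j k))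
    rw [limitPoly, triPoly_eq _ _ hkl hkm hlm]
    simp only [hi, hi', hj, hj', hj'.symm, if_true, if_false, boolSign_of_ne hj', f, g]
    rw [cmpSign_swap _ (p.1 k) (p.1 l), cmpSign_swap _ (p.1 k) (p.1 m),
      cmpSign_swap _ (p.1 l) (p.1 m), cmpSign_swap _ (p.2 k) (p.2 l),
      cmpSign_swap (Φ (i k) (j m)) (p.1 k) (p.1 m), cmpSign_swap (Φ (i k) (j m)) (p.1 l) (p.1 m)]
    linear_combination key
  have hf : Measurable f := by unfold f; fun_prop
  have hb : ∀ x, |f x| ≤ 1 / 8 * 1 * (1 + 1) * (1 + 1 * 1) := fun x => by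
    have := abs_cmpSign_le
    have ht : |s * boolSign (j k) / 8| ≤ 1 / 8 := by
      rcases mul_boolSign_eq hs (j k) with h | h <;> rw [h] <;> norm_num [abs_div]
    simp only [f, abs_mul]
    gcongr
    · exact this _ _ _
    · exact (abs_add_le _ _).trans (add_le_add (this _ _ _) (this _ _ _))
    · refine (abs_add_le _ _).trans ?_
      rw [abs_mul, abs_one]
      gcongr <;> exact this _ _ _
  have i1 : Integrable (fun p : (Fin 3 → ℝ) × (Fin 3 → ℝ) =>
      f p.1 * cmpSign (Ψ (j k) (i k)) (p.2 k) (p.2 l)) angleMeasure₃ :=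
    integrable_mul_angleMeasure₃ hf (by fun_prop) hb fun y => abs_cmpSign_le _ (y k) (y l)
  have i0 : Integrable (fun p : (Fin 3 → ℝ) × (Fin 3 → ℝ) => g p.1) angleMeasure₃ :=
    (integrable_not_between k l m (Φ (i k) (j k)) (Φ (i k) (j m))).comp_fst anglePi
  rw [h, integral_add i0 i1,
    integral_mul_angleMeasure₃ f fun y => cmpSign (Ψ (j k) (i k)) (y k) (y l),
    integral_cmpSign hkl,
    integral_fst_angleMeasure₃ g, integral_const_mul,
    integral_cmpSign_not_between hkm.symm hlm.symm hkl]
  ring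

theorem adjacent_snd_identity {A D E F G H u : ℝ} (hA : A = 1 ∨ A = -1) (hD : D = 1 ∨ D = -1)
    (hE : E = 1 ∨ E = -1) (hF : F = 1 ∨ F = -1) (hG : G = 1 ∨ G = -1)
    (hH : H = 1 ∨ H = -1) (hu : u = 1 ∨ u = -1) :
    (1 + A * D * (u * E)) / 2 * ((1 + -A * -D * (u * G)) / 2) *
      ((1 + -u * -F * (-u * -H)) / 2) * ((1 - D * -D * (E * -F) * (G * -H)) / 2) =
    1 / 8 * ((1 + F * H) * (1 + E * G)) +
      A * (u / 8 * D * E * (1 + F * H) * (1 + E * G)) := by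
  rcases hA with rfl | rfl <;> rcases hD with rfl | rfl <;> rcases hE with rfl | rfl <;>
  rcases hF with rfl | rfl <;> rcases hG with rfl | rfl <;> rcases hH with rfl | rfl <;>
  rcases hu with rfl | rfl <;> norm_num

theorem integral_limitPoly_adjacent_snd (hs : s = 1 ∨ s = -1) (hkl : k ≠ l) (hkm : k ≠ m)
    (hlm : l ≠ m) (hi : i l = i k) (hi' : i k ≠ i m) (hj : j l = j k) (hj' : j m = j k) :
    ∫ p, limitPoly Φ Ψ s i j p ∂angleMeasure₃ = 1 / 2 * (2 / 3 -
      phaseAngle (Ψ (j k) (i k)) (Ψ (j k) (i m)) +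
      phaseAngle (Ψ (j k) (i k)) (Ψ (j k) (i m)) ^ 2) := by
  let f : (Fin 3 → ℝ) → ℝ := fun x => s * boolSign (i k) / 8 *
    cmpSign (Ψ (j k) (i k)) (x k) (x l) * cmpSign (Ψ (j k) (i m)) (x k) (x m) *
    (1 + cmpSign (Ψ (j k) (i k)) (x k) (x m) * cmpSign (Ψ (j k) (i k)) (x l) (x m)) *
    (1 + cmpSign (Ψ (j k) (i m)) (x k) (x m) * cmpSign (Ψ (j k) (i m)) (x l) (x m))
  let g : (Fin 3 → ℝ) → ℝ := fun x => 1 / 8 * ((1 + cmpSign (Ψ (j k) (i k)) (x m) (x k) *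
        cmpSign (Ψ (j k) (i k)) (x m) (x l)) *
        (1 + cmpSign (Ψ (j k) (i m)) (x m) (x k) *
        cmpSign (Ψ (j k) (i m)) (x m) (x l)))
  have h : ∫ p, limitPoly Φ Ψ s i j p ∂angleMeasure₃ = ∫ p,
      g p.2 +
      cmpSign (Φ (i k) (j k)) (p.1 k) (p.1 l) * f p.2 ∂angleMeasure₃ := by
    refine integral_congr_ae ?_
    filter_upwards [ae_angleMeasure₃_fst hkl (Φ (i k) (j k)),
      ae_angleMeasure₃_snd hkl (Ψ (j k) (i k)), ae_angleMeasure₃_snd hkm (Ψ (j k) (i m)),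
      ae_angleMeasure₃_snd hkm (Ψ (j k) (i k)), ae_angleMeasure₃_snd hlm (Ψ (j k) (i m)),
      ae_angleMeasure₃_snd hlm (Ψ (j k) (i k))] with p a b c d e a'
    have key := adjacent_snd_identity a b c d e a' (mul_boolSign_eq hs (i k))
    rw [limitPoly, triPoly_eq _ _ hkl hkm hlm]
    simp only [hj, hj', hi, hi', hi'.symm, if_true, if_false, boolSign_of_ne hi', f, g]
    rw [cmpSign_swap _ (p.1 k) (p.1 l), cmpSign_swap _ (p.2 k) (p.2 m),
      cmpSign_swap _ (p.2 l) (p.2 m), cmpSign_swap _ (p.2 k) (p.2 l),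
      cmpSign_swap (Ψ (j k) (i m)) (p.2 k) (p.2 m), cmpSign_swap (Ψ (j k) (i m)) (p.2 l) (p.2 m)]
    linear_combination key
  have hf : Measurable f := by unfold f; fun_prop
  have hb : ∀ x, |f x| ≤ 1 / 8 * 1 * 1 * (1 + 1 * 1) * (1 + 1 * 1) := fun x => by
    have := abs_cmpSign_le
    have ht : |s * boolSign (i k) / 8| ≤ 1 / 8 := by
      rcases mul_boolSign_eq hs (i k) with h | h <;> rw [h] <;> norm_num [abs_div]
    simp only [f, abs_mul]
    gcongr
    · exact this _ _ _
    · exact this _ _ _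
    all_goals
      refine (abs_add_le _ _).trans ?_
      rw [abs_mul, abs_one]
      gcongr <;> exact this _ _ _
  have i1 : Integrable (fun p : (Fin 3 → ℝ) × (Fin 3 → ℝ) =>
      cmpSign (Φ (i k) (j k)) (p.1 k) (p.1 l) * f p.2) angleMeasure₃ :=
    integrable_mul_angleMeasure₃ (f := fun x => cmpSign (Φ (i k) (j k)) (x k) (x l)) (by fun_prop)
      hf (fun y => abs_cmpSign_le _ (y k) (y l)) hb
  have i0 : Integrable (fun p : (Fin 3 → ℝ) × (Fin 3 → ℝ) => g p.2) angleMeasure₃ :=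
    (integrable_not_between k l m (Ψ (j k) (i k)) (Ψ (j k) (i m))).comp_snd anglePi
  rw [h, integral_add i0 i1,
    integral_mul_angleMeasure₃ (fun y => cmpSign (Φ (i k) (j k)) (y k) (y l)) f,
    integral_cmpSign hkl,
    integral_snd_angleMeasure₃ g, integral_const_mul,
    integral_cmpSign_not_between hkm.symm hlm.symm hkl]
  ring

theorem opposite_identity {A D u t : ℝ} (hA : A = 1 ∨ A = -1) (hD : D = 1 ∨ D = -1)
    (hu : u = 1 ∨ u = -1) (ht : t = 1 ∨ t = -1) :
    (1 + A * D * (u * t)) / 2 * ((1 + -A * -D * (u * t)) / 2) *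
      ((1 + -u * -t * (-u * -t)) / 2) * ((1 - D * -D * (t * -t) * (t * -t)) / 2) =
    1 / 2 + u * t / 2 * A * D := by
  rcases hA with rfl | rfl <;> rcases hD with rfl | rfl <;>
  rcases hu with rfl | rfl <;> rcases ht with rfl | rfl <;> norm_num

theorem integral_limitPoly_opposite (hs : s = 1 ∨ s = -1) (hkl : k ≠ l) (hkm : k ≠ m)
    (hlm : l ≠ m) (hi : i l = i k) (hi' : i k ≠ i m) (hj : j l = j k) (hj' : j k ≠ j m) :
    ∫ p, limitPoly Φ Ψ s i j p ∂angleMeasure₃ = 1 / 2 := by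
  let f : (Fin 3 → ℝ) → ℝ := fun x => (s * boolSign (i k)) * (s * boolSign (j k)) / 2 *
    cmpSign (Φ (i k) (j k)) (x k) (x l)
  have h : ∫ p, limitPoly Φ Ψ s i j p ∂angleMeasure₃ = ∫ p,
      1 / 2 + f p.1 * cmpSign (Ψ (j k) (i k)) (p.2 k) (p.2 l) ∂angleMeasure₃ := by
    refine integral_congr_ae ?_
    filter_upwards [ae_angleMeasure₃_fst hkl (Φ (i k) (j k)),
      ae_angleMeasure₃_snd hkl (Ψ (j k) (i k))] with p a b
    have key := opposite_identity a b (mul_boolSign_eq hs (i k)) (mul_boolSign_eq hs (j k))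
    rw [limitPoly, triPoly_eq _ _ hkl hkm hlm]
    simp only [hi, hi', hi'.symm, hj, hj', hj'.symm, if_true, if_false, boolSign_of_ne hi',
      boolSign_of_ne hj', f]
    rw [cmpSign_swap _ (p.1 k) (p.1 l), cmpSign_swap _ (p.2 k) (p.2 l)]
    linear_combination key
  have i1 : Integrable (fun p : (Fin 3 → ℝ) × (Fin 3 → ℝ) =>
      f p.1 * cmpSign (Ψ (j k) (i k)) (p.2 k) (p.2 l)) angleMeasure₃ :=
    ((integrable_cmpSign k l (Φ (i k) (j k))).const_mul _).mul_prod
      (integrable_cmpSign k l (Ψ (j k) (i k)))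
  rw [h, integral_add (integrable_const _) i1,
    integral_mul_angleMeasure₃ f fun y => cmpSign (Ψ (j k) (i k)) (y k) (y l),
    integral_cmpSign hkl]
  simp

theorem path_identity {A A' R R' u t : ℝ} (hA : A = 1 ∨ A = -1) (hA' : A' = 1 ∨ A' = -1)
    (hR : R = 1 ∨ R = -1) (hR' : R' = 1 ∨ R' = -1) (hu : u = 1 ∨ u = -1) (ht : t = 1 ∨ t = -1) :
    (1 + A * -t * (u * -t)) / 2 * ((1 + -A' * t * (u * R)) / 2) *
      ((1 + -u * t * (-u * -R')) / 2) * ((1 - -t * t * (-t * t) * (R * -R')) / 2) =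
    1 / 16 * ((1 + u * A) * (1 + u * A')) * ((1 + -t * R) * (1 + -t * R')) := by
  rcases hA with rfl | rfl <;> rcases hA' with rfl | rfl <;> rcases hR with rfl | rfl <;>
  rcases hR' with rfl | rfl <;> rcases hu with rfl | rfl <;> rcases ht with rfl | rfl <;> norm_num

theorem integral_limitPoly_path (hs : s = 1 ∨ s = -1) (hkl : k ≠ l) (hkm : k ≠ m)
    (hlm : l ≠ m) (hi : i k = i l) (hi' : i l ≠ i m) (hj : j m = j l) (hj' : j l ≠ j k) :
    ∫ p, limitPoly Φ Ψ s i j p ∂angleMeasure₃ =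
      (1 - phaseAngle (Φ (i l) (j l)) (Φ (i l) (j k))) *
      (1 - phaseAngle (Ψ (j l) (i m)) (Ψ (j l) (i l))) / 4 := by
  have h : ∫ p, limitPoly Φ Ψ s i j p ∂angleMeasure₃ = ∫ p,
      1 / 16 * ((1 + s * boolSign (i l) * cmpSign (Φ (i l) (j l)) (p.1 k) (p.1 l)) *
        (1 + s * boolSign (i l) * cmpSign (Φ (i l) (j k)) (p.1 k) (p.1 l))) *
      ((1 + -(s * boolSign (j l)) * cmpSign (Ψ (j l) (i m)) (p.2 l) (p.2 m)) *
        (1 + -(s * boolSign (j l)) * cmpSign (Ψ (j l) (i l)) (p.2 l) (p.2 m)))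
        ∂angleMeasure₃ := by
    refine integral_congr_ae ?_
    filter_upwards [ae_angleMeasure₃_fst hkl (Φ (i l) (j l)),
      ae_angleMeasure₃_fst hkl (Φ (i l) (j k)), ae_angleMeasure₃_snd hlm (Ψ (j l) (i m)),
      ae_angleMeasure₃_snd hlm (Ψ (j l) (i l))] with p a b c d
    have key := path_identity a b c d (mul_boolSign_eq hs (i l)) (mul_boolSign_eq hs (j l))
    rw [limitPoly, triPoly_eq _ _ hkl hkm hlm]
    simp only [hi, hi', hi'.symm, hj, hj', hj'.symm, if_true, if_false, boolSign_of_ne hi',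
      boolSign_of_ne hj']
    rw [cmpSign_swap _ (p.1 k) (p.1 l), cmpSign_swap _ (p.2 l) (p.2 m)]
    linear_combination key
  have hs' : -(s * boolSign (j l)) = 1 ∨ -(s * boolSign (j l)) = -1 := by
    rcases mul_boolSign_eq hs (j l) with h | h <;> simp [h]
  rw [h, integral_mul_angleMeasure₃ (fun x => 1 / 16 * ((1 + s * boolSign (i l) *
      cmpSign (Φ (i l) (j l)) (x k) (x l)) * (1 + s * boolSign (i l) *
      cmpSign (Φ (i l) (j k)) (x k) (x l)))) (fun y => (1 + -(s * boolSign (j l)) *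
      cmpSign (Ψ (j l) (i m)) (y l) (y m)) * (1 + -(s * boolSign (j l)) *
      cmpSign (Ψ (j l) (i l)) (y l) (y m))), integral_const_mul,
    integral_cmpSign_quadrant hkl _ _ (mul_boolSign_eq hs (i l)),
    integral_cmpSign_quadrant hlm _ _ hs']
  ring

/-- The sequence that takes the value `!b` at `n` and `b` elsewhere. -/
def oddAt (n : Fin 3) (b : Bool) (k : Fin 3) : Bool := if k = n then !b else b

theorem oddAt_self (n : Fin 3) (b : Bool) : oddAt n b n = !b := if_pos rfl

theorem oddAt_of_ne {n k : Fin 3} (h : k ≠ n) (b : Bool) : oddAt n b k = b := if_neg h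

theorem sum_fin_three_bool (f : (Fin 3 → Bool) → ℝ) :
    ∑ j, f j = ∑ b, (f (fun _ => b) + ∑ n, f (oddAt n b)) := by
  rw [sum_fin_three_fun]
  simp only [Fintype.sum_bool, Fin.sum_univ_three]
  rw [show oddAt 0 true = ![false, true, true] by decide,
    show oddAt 1 true = ![true, false, true] by decide,
    show oddAt 2 true = ![true, true, false] by decide,
    show oddAt 0 false = ![true, false, false] by decide,
    show oddAt 1 false = ![false, true, false] by decide,
    show oddAt 2 false = ![false, false, true] by decide,
    show (fun _ : Fin 3 => true) = ![true, true, true] by decide,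
    show (fun _ : Fin 3 => false) = ![false, false, false] by decide]
  ring

theorem sum_fin_three_of_ne (f : Fin 3 → ℝ) {k l m : Fin 3} (hkl : k ≠ l) (hkm : k ≠ m)
    (hlm : l ≠ m) : ∑ n, f n = f k + f l + f m := by
  have : (Finset.univ : Finset (Fin 3)) = {k, l, m} := by
    revert k l m
    decide
  rw [this, Finset.sum_insert (by simp [hkl, hkm]), Finset.sum_pair hlm, add_assoc]

theorem exists_fin_three_ne (m : Fin 3) : ∃ k l : Fin 3, k ≠ l ∧ k ≠ m ∧ l ≠ m := by
  revert m
  decide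

theorem phaseAngle_not (φ : Bool → ℝ) (b : Bool) :
    phaseAngle (φ b) (φ !b) = phaseAngle (φ true) (φ false) := by
  cases b
  · exact phaseAngle_comm _ _
  · rfl

theorem sum_integral_limitPoly_const (hs : s = 1 ∨ s = -1) (c : Bool) :
    ∑ j, ∫ p, limitPoly Φ Ψ s (fun _ => c) j p ∂angleMeasure₃ =
      2 / 3 + 3 * (2 / 3 - phaseAngle (Φ c true) (Φ c false) +
        phaseAngle (Φ c true) (Φ c false) ^ 2) := by
  have h0 : ∀ b, ∫ p, limitPoly Φ Ψ s (fun _ => c) (fun _ => b) p ∂angleMeasure₃ = 1 / 3 :=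
    fun b => integral_limitPoly_same (k := 0) (l := 1) (m := 2) (by decide) (by decide)
      (by decide) rfl rfl rfl rfl
  have h1 : ∀ m b, ∫ p, limitPoly Φ Ψ s (fun _ => c) (oddAt m b) p ∂angleMeasure₃ =
      1 / 2 * (2 / 3 - phaseAngle (Φ c true) (Φ c false) +
        phaseAngle (Φ c true) (Φ c false) ^ 2) := by
    intro m b
    obtain ⟨k, l, hkl, hkm, hlm⟩ := exists_fin_three_ne m
    rw [integral_limitPoly_adjacent_fst hs hkl hkm hlm rfl rfl
      (by rw [oddAt_of_ne hkm, oddAt_of_ne hlm]) (by simp [oddAt_of_ne hkm, oddAt_self])]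
    rw [oddAt_of_ne hkm, oddAt_self, phaseAngle_not (Φ c)]
  rw [sum_fin_three_bool]
  simp only [h0, h1, Fintype.sum_bool, Fin.sum_univ_three]
  ring

theorem sum_integral_limitPoly_oddAt (hs : s = 1 ∨ s = -1) (m : Fin 3) (c : Bool) :
    ∑ j, ∫ p, limitPoly Φ Ψ s (oddAt m c) j p ∂angleMeasure₃ = 1 +
      1 / 2 * ((2 / 3 - phaseAngle (Ψ true true) (Ψ true false) +
        phaseAngle (Ψ true true) (Ψ true false) ^ 2) +
      (2 / 3 - phaseAngle (Ψ false true) (Ψ false false) +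
        phaseAngle (Ψ false true) (Ψ false false) ^ 2)) +
      1 / 2 * (1 - phaseAngle (Φ c true) (Φ c false)) *
        ((1 - phaseAngle (Ψ true true) (Ψ true false)) +
        (1 - phaseAngle (Ψ false true) (Ψ false false))) := by
  obtain ⟨k, l, hkl, hkm, hlm⟩ := exists_fin_three_ne m
  have h0 : ∀ b, ∫ p, limitPoly Φ Ψ s (oddAt m c) (fun _ => b) p ∂angleMeasure₃ =
      1 / 2 * (2 / 3 - phaseAngle (Ψ b true) (Ψ b false) +
        phaseAngle (Ψ b true) (Ψ b false) ^ 2) := fun b => by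
    rw [integral_limitPoly_adjacent_snd hs hkl hkm hlm
      (by rw [oddAt_of_ne hkm, oddAt_of_ne hlm]) (by simp [oddAt_of_ne hkm, oddAt_self]) rfl rfl]
    rw [oddAt_of_ne hkm, oddAt_self, phaseAngle_not (Ψ b)]
  have h1 : ∀ b, ∫ p, limitPoly Φ Ψ s (oddAt m c) (oddAt m b) p ∂angleMeasure₃ = 1 / 2 :=
    fun b => integral_limitPoly_opposite hs hkl hkm hlm
      (by rw [oddAt_of_ne hkm, oddAt_of_ne hlm]) (by simp [oddAt_of_ne hkm, oddAt_self])
      (by rw [oddAt_of_ne hkm, oddAt_of_ne hlm]) (by simp [oddAt_of_ne hkm, oddAt_self])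
  have h2 : ∀ {k l : Fin 3} (b : Bool), k ≠ l → k ≠ m → l ≠ m →
      ∫ p, limitPoly Φ Ψ s (oddAt m c) (oddAt k b) p ∂angleMeasure₃ =
      (1 - phaseAngle (Φ c true) (Φ c false)) * (1 - phaseAngle (Ψ b true) (Ψ b false)) / 4 := by
    intro k l b hkl hkm hlm
    rw [integral_limitPoly_path hs hkl hkm hlm (by rw [oddAt_of_ne hkm, oddAt_of_ne hlm])
      (by simp [oddAt_of_ne hlm, oddAt_self]) (by rw [oddAt_of_ne hkm.symm, oddAt_of_ne hkl.symm])
      (by simp [oddAt_of_ne hkl.symm, oddAt_self]), oddAt_of_ne hlm, oddAt_of_ne hkl.symm,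
      oddAt_self, oddAt_self, phaseAngle_comm (Ψ b !c), phaseAngle_not (Φ c), phaseAngle_not (Ψ b)]
  rw [sum_fin_three_bool]
  simp only [h0, h1, h2 _ hkl hkm hlm, h2 _ hkl.symm hlm hkm, Fintype.sum_bool,
    sum_fin_three_of_ne _ hkl hkm hlm]
  ring

theorem sum_integral_limitPoly (hs : s = 1 ∨ s = -1) :
    ∑ i, ∑ j, ∫ p, limitPoly Φ Ψ s i j p ∂angleMeasure₃ =
      22 / 3 +
      3 * ((2 / 3 - phaseAngle (Φ true true) (Φ true false) +
        phaseAngle (Φ true true) (Φ true false) ^ 2) +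
      (2 / 3 - phaseAngle (Φ false true) (Φ false false) +
        phaseAngle (Φ false true) (Φ false false) ^ 2) +
      (2 / 3 - phaseAngle (Ψ true true) (Ψ true false) +
        phaseAngle (Ψ true true) (Ψ true false) ^ 2) +
      (2 / 3 - phaseAngle (Ψ false true) (Ψ false false) +
        phaseAngle (Ψ false true) (Ψ false false) ^ 2)) +
      3 / 2 * ((1 - phaseAngle (Φ true true) (Φ true false)) +
        (1 - phaseAngle (Φ false true) (Φ false false))) *
      ((1 - phaseAngle (Ψ true true) (Ψ true false)) +
        (1 - phaseAngle (Ψ false true) (Ψ false false))) := by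
  rw [sum_fin_three_bool]
  simp only [sum_integral_limitPoly_const hs, sum_integral_limitPoly_oddAt hs, Fintype.sum_bool,
    Fin.sum_univ_three]
  ring

end LimitValues

/-! ### Rate of convergence to the limiting probabilities -/

theorem norm_crossE_sq (a b : E3) : ‖crossE a b‖ ^ 2 = ‖a‖ ^ 2 * ‖b‖ ^ 2 - inner ℝ a b ^ 2 := by
  rw [← real_inner_self_eq_norm_sq, ← real_inner_self_eq_norm_sq, ← real_inner_self_eq_norm_sq]
  simp only [inner_E3, crossE]
  simp
  ring

theorem norm_crossE_le (a b : E3) : ‖crossE a b‖ ≤ ‖a‖ * ‖b‖ := by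
  refine abs_le_of_sq_le_sq' ?_ (by positivity) |>.2
  rw [norm_crossE_sq, mul_pow]
  nlinarith [sq_nonneg (inner ℝ a b)]

theorem abs_trip_le (a b c : E3) : |trip a b c| ≤ ‖a‖ * (‖b‖ * ‖c‖) := by
  rw [← inner_crossE]
  exact (abs_real_inner_le_norm _ _).trans
    (mul_le_mul_of_nonneg_left (norm_crossE_le b c) (norm_nonneg _))

theorem abs_trip_sub_trip_le {a b c a' b' c' : E3} (hb : ‖b‖ = 1) (hc : ‖c‖ = 1)
    (ha' : ‖a'‖ = 1) (hb' : ‖b'‖ = 1) :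
    |trip a b c - trip a' b' c'| ≤ ‖a - a'‖ + ‖b - b'‖ + ‖c - c'‖ := by
  have h : trip a b c - trip a' b' c' =
      trip (a - a') b c + trip a' (b - b') c + trip a' b' (c - c') := by
    simp [trip]; ring
  rw [h]
  refine (abs_add_three _ _ _).trans ?_
  have h1 := abs_trip_le (a - a') b c
  have h2 := abs_trip_le a' (b - b') c
  have h3 := abs_trip_le a' b' (c - c')
  rw [hb, hc] at h1
  rw [ha', hc] at h2
  rw [ha', hb'] at h3
  linarith

theorem inner_left_crossE (a b : E3) : inner ℝ a (crossE a b) = 0 := by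
  rw [inner_crossE]; unfold trip; ring

theorem inner_right_crossE (a b : E3) : inner ℝ b (crossE a b) = 0 := by
  rw [inner_crossE]; unfold trip; ring

namespace SphereFrame

variable (F : SphereFrame)

theorem norm_vec_sub_c_le {r : ℝ} (hr : r ∈ Ioo 0 (π / 2)) (θ : ℝ) :
    ‖F.vec r θ - F.c‖ ≤ 2 * r := by
  have h : F.vec r θ - F.c = (cos r - 1) • F.c + sin r • F.dir θ := by
    rw [vec, sub_smul, one_smul]; abel
  rw [h]
  refine (norm_add_le _ _).trans ?_
  rw [norm_smul, norm_smul, F.norm_c, F.norm_dir, mul_one, mul_one, Real.norm_eq_abs,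
    Real.norm_eq_abs, abs_of_nonneg (sin_nonneg_of_nonneg_of_le_pi hr.1.le (by linarith [hr.2, pi_pos])),
    abs_of_nonpos (by linarith [cos_le_one r])]
  have h1 := Real.one_sub_sq_div_two_le_cos (x := r)
  have h2 := Real.sin_le hr.1.le
  nlinarith [hr.1, hr.2, pi_le_four]

theorem exists_eq_norm_smul_dir {n : E3} (hn : inner ℝ F.c n = 0) : ∃ φ, n = ‖n‖ • F.dir φ := by
  obtain ⟨ρ, φ, h0, -, hp, hq⟩ := exists_polar (inner ℝ F.e₀ n) (inner ℝ F.e₁ n)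
  have h := F.expand n
  rw [hn, zero_smul, zero_add, hp, hq] at h
  have h' : n = ρ • F.dir φ := by rw [h, dir, smul_add, smul_smul, smul_smul]
  have hρ : ‖n‖ = ρ := by rw [h', norm_smul, F.norm_dir, mul_one, Real.norm_of_nonneg h0]
  exact ⟨φ, by rw [hρ]; exact h'⟩

theorem inner_dir_dir_eq (θ θ' : ℝ) : inner ℝ (F.dir θ) (F.dir θ') = cos (θ - θ') := by
  have h0 := F.inner_e₀_e₁
  have h1 : inner ℝ F.e₁ F.e₀ = 0 := by rw [real_inner_comm]; exact h0
  simp only [dir, inner_add_left, inner_add_right, inner_smul_left, inner_smul_right, h0, h1,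
    real_inner_self_eq_norm_sq, F.norm_e₀, F.norm_e₁]
  simp [cos_sub, mul_comm]

theorem dir_sub_dir (θ θ' : ℝ) :
    F.dir θ - F.dir θ' = (2 * sin ((θ - θ') / 2)) • F.dir ((θ + θ') / 2 + π / 2) := by
  have h1 := cos_sub_cos θ θ'
  have h2 := sin_sub_sin θ θ'
  simp only [dir, cos_add_pi_div_two, sin_add_pi_div_two, smul_add, smul_smul]
  rw [show 2 * sin ((θ - θ') / 2) * -sin ((θ + θ') / 2) = cos θ - cos θ' by rw [h1]; ring,
    show 2 * sin ((θ - θ') / 2) * cos ((θ + θ') / 2) = sin θ - sin θ' by rw [h2], sub_smul, sub_smul]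
  abel

theorem sign_inner_vec_eq {n n₀ : E3} {φ ε r θ θ' : ℝ} (hr : 0 < sin r)
    (h0 : n₀ = ‖n₀‖ • F.dir φ) (hn : ∀ t, |inner ℝ (F.dir t) n - inner ℝ (F.dir t) n₀| ≤ ε)
    (hort : inner ℝ (F.vec r θ') n = 0) (hε : ε < ‖n₀‖ * |sin ((θ + θ') / 2 - φ)|) :
    Real.sign (inner ℝ (F.vec r θ) n) = cmpSign φ θ θ' := by
  set t := (θ + θ') / 2 + π / 2
  have e1 : inner ℝ (F.vec r θ) n =
      sin r * (2 * sin ((θ - θ') / 2) * inner ℝ (F.dir t) n) := by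
    have : inner ℝ (F.vec r θ) n = inner ℝ (F.vec r θ - F.vec r θ') n := by
      rw [inner_sub_left, hort, sub_zero]
    rw [this, show F.vec r θ - F.vec r θ' = sin r • (F.dir θ - F.dir θ') by
      simp only [vec, smul_sub]; abel, F.dir_sub_dir]
    simp only [inner_smul_left, conj_trivial, t]
  have e2 : cos (θ - φ) - cos (θ' - φ) = 2 * sin ((θ - θ') / 2) * -sin ((θ + θ') / 2 - φ) := by
    rw [cos_sub_cos]
    ring_nf
  have e3 : inner ℝ (F.dir t) n₀ = ‖n₀‖ * -sin ((θ + θ') / 2 - φ) := by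
    rw [h0, inner_smul_right, F.inner_dir_dir_eq, ← h0,
      show t - φ = (θ + θ') / 2 - φ + π / 2 by ring, cos_add_pi_div_two]
  have h := hn t
  rw [e3] at h
  have hn0 : 0 < ‖n₀‖ := by
    rcases (norm_nonneg n₀).eq_or_lt with h' | h'
    · rw [← h', zero_mul] at hε
      exact absurd ((abs_nonneg _).trans (hn 0)) (not_le.2 hε)
    · exact h'
  have e4 : Real.sign (inner ℝ (F.dir t) n) = Real.sign (-sin ((θ + θ') / 2 - φ)) := by
    rw [abs_le] at h
    rcases lt_or_ge (sin ((θ + θ') / 2 - φ)) 0 with hs | hs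
    · rw [abs_of_neg hs] at hε
      rw [Real.sign_of_pos (by linarith), Real.sign_of_pos (by linarith)]
    · rw [abs_of_nonneg hs] at hε
      have : 0 < sin ((θ + θ') / 2 - φ) := by
        rcases hs.eq_or_lt with h' | h'
        · rw [← h', mul_zero] at hε
          linarith [(abs_nonneg _).trans (hn 0)]
        · exact h'
      rw [Real.sign_of_neg (by linarith), Real.sign_of_neg (by linarith)]
  rw [cmpSign, e1, e2, real_sign_mul, real_sign_mul, real_sign_mul (2 * _), e4,
    Real.sign_of_pos hr, one_mul]

end SphereFrame

theorem triPoly_congr {a b a' b' : Fin 3 → Fin 3 → ℝ}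
    (ha : ∀ k l, k ≠ l → a k l = a' k l) (hb : ∀ k l, k ≠ l → b k l = b' k l) :
    triPoly a b = triPoly a' b' := by
  unfold triPoly
  rw [ha 0 1 (by decide), ha 0 2 (by decide), ha 1 0 (by decide), ha 1 2 (by decide),
    ha 2 0 (by decide), ha 2 1 (by decide), hb 0 1 (by decide), hb 0 2 (by decide),
    hb 1 0 (by decide), hb 1 2 (by decide), hb 2 0 (by decide), hb 2 1 (by decide)]

theorem triPoly_mem_Icc {a b : Fin 3 → Fin 3 → ℝ} (ha : ∀ k l, |a k l| ≤ 1)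
    (hb : ∀ k l, |b k l| ≤ 1) : triPoly a b ∈ Icc 0 1 := by
  have hmul : ∀ {x y : ℝ}, |x| ≤ 1 → |y| ≤ 1 → |x * y| ≤ 1 := fun hx hy => by
    rw [abs_mul]; exact mul_le_one₀ hx (abs_nonneg _) hy
  have hp : ∀ {x : ℝ}, |x| ≤ 1 → 0 ≤ (1 + x) / 2 ∧ (1 + x) / 2 ≤ 1 := fun hx => by
    rw [abs_le] at hx; constructor <;> linarith
  have hm : ∀ {x : ℝ}, |x| ≤ 1 → 0 ≤ (1 - x) / 2 ∧ (1 - x) / 2 ≤ 1 := fun hx => by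
    rw [abs_le] at hx; constructor <;> linarith
  have h1 := hp (hmul (hmul (ha 0 1) (hb 0 1)) (hmul (ha 0 2) (hb 0 2)))
  have h2 := hp (hmul (hmul (ha 1 0) (hb 1 0)) (hmul (ha 1 2) (hb 1 2)))
  have h3 := hp (hmul (hmul (ha 2 0) (hb 2 0)) (hmul (ha 2 1) (hb 2 1)))
  have h4 := hm (hmul (hmul (hmul (hb 0 1) (hb 1 0)) (hmul (hb 0 2) (hb 2 0)))
    (hmul (hb 1 2) (hb 2 1)))
  unfold triPoly
  exact ⟨mul_nonneg (mul_nonneg (mul_nonneg h1.1 h2.1) h3.1) h4.1,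
    mul_le_one₀ (mul_le_one₀ (mul_le_one₀ h1.2 h2.1 h2.2) h3.1 h3.2) h4.1 h4.2⟩

theorem sidePoly_mem_Icc (E : Fin 3 → E3 × E3) : sidePoly E ∈ Icc 0 1 :=
  triPoly_mem_Icc (fun _ _ => abs_real_sign_le _) fun _ _ => abs_real_sign_le _

theorem limitPoly_mem_Icc {Φ Ψ : Bool → Bool → ℝ} {s : ℝ} (hs : s = 1 ∨ s = -1)
    (i j : Fin 3 → Bool) (p : (Fin 3 → ℝ) × (Fin 3 → ℝ)) : limitPoly Φ Ψ s i j p ∈ Icc 0 1 := by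
  have h : ∀ b, |s * boolSign b| ≤ 1 := fun b => by
    rcases mul_boolSign_eq hs b with h | h <;> simp [h]
  refine triPoly_mem_Icc (fun k l => ?_) fun k l => ?_
  all_goals
    split_ifs
    · exact abs_cmpSign_le _ _ _
    · exact h _

theorem sign_eq_of_mul_pos {u x : ℝ} (hu : u = 1 ∨ u = -1) (h : 0 < u * x) : Real.sign x = u := by
  rcases hu with rfl | rfl
  · exact Real.sign_of_pos (by linarith)
  · exact Real.sign_of_neg (by linarith)

/-- Two angles whose mean is close to `φ` or `φ + π`, as a function on triples. -/
noncomputable def nearMean (ε φ : ℝ) (k l : Fin 3) : (Fin 3 → ℝ) → ℝ :=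
  {x : Fin 3 → ℝ | |sin ((x k + x l) / 2 - φ)| ≤ ε}.indicator 1

theorem indicator_one_congr {X Y : Type*} {s : Set X} {t : Set Y} {x : X} {y : Y}
    (h : x ∈ s ↔ y ∈ t) : s.indicator (1 : X → ℝ) x = t.indicator (1 : Y → ℝ) y := by
  by_cases hx : x ∈ s
  · rw [Set.indicator_of_mem hx, Set.indicator_of_mem (h.1 hx)]
    rfl
  · rw [Set.indicator_of_notMem hx, Set.indicator_of_notMem (mt h.2 hx)]

theorem measurableSet_nearMean (ε φ : ℝ) (k l : Fin 3) :
    MeasurableSet {x : Fin 3 → ℝ | |sin ((x k + x l) / 2 - φ)| ≤ ε} :=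
  measurableSet_le (by fun_prop) measurable_const

theorem angleMeasure_abs_sin_le {ε : ℝ} (hε : 0 ≤ ε) :
    ∫ θ, {θ : ℝ | |sin (θ / 2)| ≤ ε}.indicator (1 : ℝ → ℝ) θ ∂angleMeasure ≤ ε := by
  have hm : MeasurableSet {θ : ℝ | |sin (θ / 2)| ≤ ε} :=
    measurableSet_le (by fun_prop) measurable_const
  have hsub : Set.Ico 0 (2 * π) ∩ {θ : ℝ | |sin (θ / 2)| ≤ ε} ⊆
      Set.Icc 0 (π * ε) ∪ Set.Icc (2 * π - π * ε) (2 * π) := by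
    rintro θ ⟨⟨h0, h1⟩, h2⟩
    have h2 : |sin (θ / 2)| ≤ ε := h2
    have h3 := (le_abs_self _).trans h2
    rcases le_total θ π with h | h
    · left
      refine ⟨h0, ?_⟩
      have := Real.mul_le_sin (x := θ / 2) (by linarith) (by linarith)
      have h4 : 2 / π * (θ / 2) ≤ ε := this.trans h3
      rw [show 2 / π * (θ / 2) = θ / π by ring, div_le_iff₀ pi_pos] at h4
      linarith
    · right
      refine ⟨?_, h1.le⟩
      have := Real.mul_le_sin (x := π - θ / 2) (by linarith) (by linarith)
      rw [sin_pi_sub] at this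
      have h4 : 2 / π * (π - θ / 2) ≤ ε := this.trans h3
      rw [show 2 / π * (π - θ / 2) = (2 * π - θ) / π by field_simp, div_le_iff₀ pi_pos] at h4
      linarith
  have hpi := pi_pos
  rw [integral_indicator_one hm, angleMeasure, measureReal_def,
    ProbabilityTheory.cond_apply measurableSet_Ico]
  refine ENNReal.toReal_le_of_le_ofReal hε ?_
  calc _ ≤ (volume (Set.Ico 0 (2 * π)))⁻¹ *
        volume (Set.Icc 0 (π * ε) ∪ Set.Icc (2 * π - π * ε) (2 * π)) := by gcongr
    _ ≤ (ENNReal.ofReal (2 * π))⁻¹ * (ENNReal.ofReal (2 * π * ε)) := by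
        rw [Real.volume_Ico, sub_zero]
        gcongr
        refine (measure_union_le _ _).trans ?_
        rw [Real.volume_Icc, Real.volume_Icc, ← ENNReal.ofReal_add (by nlinarith) (by nlinarith)]
        refine ENNReal.ofReal_le_ofReal (by linarith)
    _ = ENNReal.ofReal ε := by
        rw [← ENNReal.ofReal_inv_of_pos (by positivity), ← ENNReal.ofReal_mul (by positivity)]
        congr 1
        field_simp

theorem integral_nearMean_le {ε : ℝ} (hε : 0 ≤ ε) (φ : ℝ) {k l : Fin 3} (h : k ≠ l) :
    ∫ x, nearMean ε φ k l x ∂anglePi ≤ ε := by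
  have hper : Function.Periodic ({θ : ℝ | |sin (θ / 2)| ≤ ε}.indicator (1 : ℝ → ℝ)) (2 * π) := by
    intro θ
    refine indicator_one_congr ?_
    rw [Set.mem_ofPred_eq, Set.mem_ofPred_eq, show (θ + 2 * π) / 2 = θ / 2 + π by ring, sin_add_pi, abs_neg]
  have hm : MeasurableSet {p : ℝ × ℝ | |sin ((p.1 + p.2) / 2 - φ)| ≤ ε} :=
    measurableSet_le (by fun_prop) measurable_const
  have e := integral_pi_pair (μ := angleMeasure) h (measurable_one.indicator hm : Measurable
    ({p : ℝ × ℝ | |sin ((p.1 + p.2) / 2 - φ)| ≤ ε}.indicator (1 : ℝ × ℝ → ℝ)))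
  have e' : ∫ x, nearMean ε φ k l x ∂anglePi = _ := e
  rw [e', integral_prod _ (integrable_of_abs_le (measurable_one.indicator hm)
    (abs_indicator_one_le _))]
  have hin : ∀ x, ∫ y, {p : ℝ × ℝ | |sin ((p.1 + p.2) / 2 - φ)| ≤ ε}.indicator
      (1 : ℝ × ℝ → ℝ) (x, y) ∂angleMeasure ≤ ε := by
    intro x
    have := integral_angleMeasure_add hper (x - 2 * φ)
    refine le_trans (le_of_eq ?_) (this.trans_le (angleMeasure_abs_sin_le hε))
    refine integral_congr_ae (ae_of_all _ fun y => ?_)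
    refine indicator_one_congr ?_
    rw [Set.mem_ofPred_eq, Set.mem_ofPred_eq, show (y + (x - 2 * φ)) / 2 = (x + y) / 2 - φ by ring]
  calc _ ≤ ∫ _ : ℝ, ε ∂angleMeasure :=
        integral_mono_of_nonneg (ae_of_all _ fun x => integral_nonneg fun y =>
          Set.indicator_nonneg (fun _ _ => zero_le_one) _) (integrable_const _)
          (ae_of_all _ hin)
    _ = ε := by simp

/-- Phases, orientations and a lower bound for the determinants of four centres. -/
structure LimitData (F G : Bool → SphereFrame) (Φ Ψ : Bool → Bool → ℝ) (s κ : ℝ) : Prop where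
  sign_eq : s = 1 ∨ s = -1
  pos : 0 < κ
  crossE_fst : ∀ i j, crossE (F i).c (G j).c = ‖crossE (F i).c (G j).c‖ • (F i).dir (Φ i j)
  crossE_snd : ∀ i j, crossE (F i).c (G j).c = ‖crossE (F i).c (G j).c‖ • (G j).dir (Ψ j i)
  le_norm : ∀ i j, κ ≤ ‖crossE (F i).c (G j).c‖
  le_fst : ∀ i i' j, i ≠ i' → κ ≤ s * boolSign i * trip (F i).c (F i').c (G j).c
  le_snd : ∀ j j' i, j ≠ j' → κ ≤ s * boolSign j * trip (G j).c (F i).c (G j').c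

namespace LimitData

variable {F G : Bool → SphereFrame} {Φ Ψ : Bool → Bool → ℝ} {s κ r : ℝ}

theorem sidePoly_eq (h : LimitData F G Φ Ψ s κ) (hr : r ∈ Ioo 0 (π / 2)) (hκ : 6 * r < κ)
    {i j : Fin 3 → Bool} {p : (Fin 3 → ℝ) × (Fin 3 → ℝ)}
    (hp : ∀ k l, k ≠ l → 4 * r / κ < |sin ((p.1 k + p.1 l) / 2 - Φ (i k) (j l))|)
    (hp' : ∀ k l, k ≠ l → 4 * r / κ < |sin ((p.2 k + p.2 l) / 2 - Ψ (j k) (i l))|) :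
    sidePoly (ends F G r i j p) = limitPoly Φ Ψ s i j p := by
  have hsin : 0 < sin r := sin_pos_of_pos_of_lt_pi hr.1 (by linarith [hr.2, pi_pos])
  have hA : ∀ b θ, ‖(F b).vec r θ - (F b).c‖ ≤ 2 * r := fun b => (F b).norm_vec_sub_c_le hr
  have hB : ∀ b θ, ‖(G b).vec r θ - (G b).c‖ ≤ 2 * r := fun b => (G b).norm_vec_sub_c_le hr
  have hcross : ∀ l t, ‖t‖ = 1 → |inner ℝ t (crossE ((F (i l)).vec r (p.1 l))
      ((G (j l)).vec r (p.2 l))) - inner ℝ t (crossE (F (i l)).c (G (j l)).c)| ≤ 4 * r := by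
    intro l t ht
    rw [inner_crossE, inner_crossE]
    have := abs_trip_sub_trip_le (a := t) (a' := t) (c' := (G (j l)).c) ((F (i l)).norm_vec r (p.1 l))
      ((G (j l)).norm_vec r (p.2 l)) ht (F (i l)).norm_c
    rw [sub_self, norm_zero] at this
    linarith [hA (i l) (p.1 l), hB (j l) (p.2 l)]
  have hbig : ∀ i j x, 4 * r / κ < |x| → 4 * r < ‖crossE (F i).c (G j).c‖ * |x| := by
    intro i j x hx
    rw [div_lt_iff₀ h.pos] at hx
    nlinarith [h.le_norm i j, abs_nonneg x]
  refine triPoly_congr (fun k l hkl => ?_) fun k l hkl => ?_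
  · split_ifs with hi
    · have hb := hbig (i l) (j l) _ (hp k l hkl)
      have h0 := h.crossE_fst (i l) (j l)
      rw [sideFst, ← inner_crossE]
      simp only [ends]
      rw [hi] at hb ⊢
      exact (F (i l)).sign_inner_vec_eq hsin h0 (fun t => hcross l _ ((F (i l)).norm_dir t))
        (inner_left_crossE _ _) hb
    · refine sign_eq_of_mul_pos (mul_boolSign_eq h.sign_eq _) ?_
      have h1 := h.le_fst (i k) (i l) (j l) hi
      have h2 := abs_trip_sub_trip_le (a := (F (i k)).vec r (p.1 k)) (c' := (G (j l)).c)
        ((F (i l)).norm_vec r (p.1 l)) ((G (j l)).norm_vec r (p.2 l)) (F (i k)).norm_c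
        (F (i l)).norm_c
      have h3 := hA (i k) (p.1 k)
      have h4 := hA (i l) (p.1 l)
      have h5 := hB (j l) (p.2 l)
      have h6 := abs_le.1 (h2.trans (by linarith : _ ≤ 6 * r))
      simp only [sideFst, ends]
      rcases mul_boolSign_eq h.sign_eq (i k) with e | e <;> rw [e] at h1 ⊢ <;> linarith
  · split_ifs with hi
    · have hb := hbig (i l) (j l) _ (hp' k l hkl)
      have h0 := h.crossE_snd (i l) (j l)
      rw [sideSnd, ← inner_crossE]
      simp only [ends]
      rw [hi] at hb ⊢
      exact (G (j l)).sign_inner_vec_eq hsin h0 (fun t => hcross l _ ((G (j l)).norm_dir t))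
        (inner_right_crossE _ _) hb
    · refine sign_eq_of_mul_pos (mul_boolSign_eq h.sign_eq _) ?_
      have h1 := h.le_snd (j k) (j l) (i l) hi
      have h2 := abs_trip_sub_trip_le (a := (G (j k)).vec r (p.2 k)) (c' := (G (j l)).c)
        ((F (i l)).norm_vec r (p.1 l)) ((G (j l)).norm_vec r (p.2 l)) (G (j k)).norm_c
        (F (i l)).norm_c
      have h3 := hB (j k) (p.2 k)
      have h4 := hA (i l) (p.1 l)
      have h5 := hB (j l) (p.2 l)
      have h6 := abs_le.1 (h2.trans (by linarith : _ ≤ 6 * r))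
      simp only [sideSnd, ends]
      rcases mul_boolSign_eq h.sign_eq (j k) with e | e <;> rw [e] at h1 ⊢ <;> linarith

theorem abs_sidePoly_sub_le (h : LimitData F G Φ Ψ s κ) (hr : r ∈ Ioo 0 (π / 2)) (hκ : 6 * r < κ)
    (i j : Fin 3 → Bool) (p : (Fin 3 → ℝ) × (Fin 3 → ℝ)) :
    |sidePoly (ends F G r i j p) - limitPoly Φ Ψ s i j p| ≤
      ∑ q ∈ Finset.univ.offDiag, (nearMean (4 * r / κ) (Φ (i q.1) (j q.2)) q.1 q.2 p.1 +
        nearMean (4 * r / κ) (Ψ (j q.1) (i q.2)) q.1 q.2 p.2) := by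
  have hnn : ∀ ε φ k l x, 0 ≤ nearMean ε φ k l x := fun ε φ k l x =>
    Set.indicator_nonneg (fun _ _ => zero_le_one) _
  have hle : |sidePoly (ends F G r i j p) - limitPoly Φ Ψ s i j p| ≤ 1 := by
    have h1 := sidePoly_mem_Icc (ends F G r i j p)
    have h2 := limitPoly_mem_Icc (Φ := Φ) (Ψ := Ψ) h.sign_eq i j p
    rw [abs_le]
    constructor <;> linarith [h1.1, h1.2, h2.1, h2.2]
  have hterm : ∀ q : Fin 3 × Fin 3, 0 ≤ nearMean (4 * r / κ) (Φ (i q.1) (j q.2)) q.1 q.2 p.1 +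
        nearMean (4 * r / κ) (Ψ (j q.1) (i q.2)) q.1 q.2 p.2 := fun q => add_nonneg (hnn _ _ _ _ _)
    (hnn _ _ _ _ _)
  have hone : ∀ ε φ k l x, |sin ((x k + x l) / 2 - φ)| ≤ ε → nearMean ε φ k l x = 1 :=
    fun ε φ k l x hx => Set.indicator_of_mem (show x ∈ {x | _} from hx) _
  by_cases hp : ∀ k l, k ≠ l → 4 * r / κ < |sin ((p.1 k + p.1 l) / 2 - Φ (i k) (j l))|
  · by_cases hp' : ∀ k l, k ≠ l → 4 * r / κ < |sin ((p.2 k + p.2 l) / 2 - Ψ (j k) (i l))|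
    · rw [h.sidePoly_eq hr hκ hp hp', sub_self, abs_zero]
      exact Finset.sum_nonneg fun q _ => hterm q
    · push Not at hp'
      obtain ⟨k, l, hkl, hq⟩ := hp'
      refine hle.trans (le_trans ?_ (Finset.single_le_sum (fun q _ => hterm q)
        (Finset.mem_offDiag (x := (k, l)).2 ⟨Finset.mem_univ k, Finset.mem_univ l, hkl⟩)))
      dsimp only
      rw [hone _ _ k l p.2 hq]
      linarith [hnn (4 * r / κ) (Φ (i k) (j l)) k l p.1]
  · push Not at hp
    obtain ⟨k, l, hkl, hq⟩ := hp
    refine hle.trans (le_trans ?_ (Finset.single_le_sum (fun q _ => hterm q)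
      (Finset.mem_offDiag (x := (k, l)).2 ⟨Finset.mem_univ k, Finset.mem_univ l, hkl⟩)))
    dsimp only
    rw [hone _ _ k l p.1 hq]
    linarith [hnn (4 * r / κ) (Ψ (j k) (i l)) k l p.2]

theorem _root_.measurable_triPoly {X : Type*} [MeasurableSpace X] {a b : X → Fin 3 → Fin 3 → ℝ}
    (ha : ∀ k l, Measurable fun x => a x k l) (hb : ∀ k l, Measurable fun x => b x k l) :
    Measurable fun x => triPoly (a x) (b x) := by
  unfold triPoly
  fun_prop

theorem _root_.measurable_sidePoly : Measurable sidePoly := by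
  refine measurable_triPoly (fun k l => measurable_real_sign.comp (Continuous.measurable ?_))
    fun k l => measurable_real_sign.comp (Continuous.measurable ?_)
  · unfold sideFst; fun_prop
  · unfold sideSnd; fun_prop

theorem _root_.continuous_ends (F G : Bool → SphereFrame) (r : ℝ) (i j : Fin 3 → Bool) :
    Continuous (ends F G r i j) := by
  have h1 := fun b => (F b).continuous_vec r
  have h2 := fun b => (G b).continuous_vec r
  unfold ends
  fun_prop

theorem _root_.measurable_limitPoly (Φ Ψ : Bool → Bool → ℝ) (s : ℝ) (i j : Fin 3 → Bool) :
    Measurable (limitPoly Φ Ψ s i j) := by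
  refine measurable_triPoly (fun k l => ?_) fun k l => ?_
  all_goals
    split_ifs
    · fun_prop
    · fun_prop

theorem integral_sidePoly_sub_le (h : LimitData F G Φ Ψ s κ) (hr : r ∈ Ioo 0 (π / 2))
    (i j : Fin 3 → Bool) :
    |∫ p, sidePoly (ends F G r i j p) ∂angleMeasure₃ - ∫ p, limitPoly Φ Ψ s i j p ∂angleMeasure₃| ≤
      48 / κ * r := by
  have i1 : Integrable (fun p => sidePoly (ends F G r i j p)) angleMeasure₃ :=
    integrable_of_abs_le (B := 1)
      (measurable_sidePoly.comp (continuous_ends F G r i j).measurable) fun p => by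
        have := sidePoly_mem_Icc (ends F G r i j p)
        rw [abs_of_nonneg this.1]
        exact this.2
  have i2 : Integrable (limitPoly Φ Ψ s i j) angleMeasure₃ :=
    integrable_of_abs_le (B := 1) (measurable_limitPoly Φ Ψ s i j) fun p => by
      have := limitPoly_mem_Icc (Φ := Φ) (Ψ := Ψ) h.sign_eq i j p
      rw [abs_of_nonneg this.1]
      exact this.2
  have hκ := h.pos
  rw [← integral_sub i1 i2]
  refine abs_integral_le_integral_abs.trans ?_
  rcases lt_or_ge (6 * r) κ with h6 | h6
  · have hn : ∀ φ k l, Integrable (nearMean (4 * r / κ) φ k l) anglePi := fun φ k l =>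
      integrable_of_abs_le (measurable_one.indicator (measurableSet_nearMean _ _ _ _))
        (abs_indicator_one_le _)
    have hf : ∀ q : Fin 3 × Fin 3, Integrable (fun p : (Fin 3 → ℝ) × (Fin 3 → ℝ) =>
        nearMean (4 * r / κ) (Φ (i q.1) (j q.2)) q.1 q.2 p.1) angleMeasure₃ := fun q =>
      (hn (Φ (i q.1) (j q.2)) q.1 q.2).comp_fst anglePi
    have hg : ∀ q : Fin 3 × Fin 3, Integrable (fun p : (Fin 3 → ℝ) × (Fin 3 → ℝ) =>
        nearMean (4 * r / κ) (Ψ (j q.1) (i q.2)) q.1 q.2 p.2) angleMeasure₃ := fun q =>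
      (hn (Ψ (j q.1) (i q.2)) q.1 q.2).comp_snd anglePi
    have hi : ∀ q : Fin 3 × Fin 3, Integrable (fun p : (Fin 3 → ℝ) × (Fin 3 → ℝ) =>
        nearMean (4 * r / κ) (Φ (i q.1) (j q.2)) q.1 q.2 p.1 +
        nearMean (4 * r / κ) (Ψ (j q.1) (i q.2)) q.1 q.2 p.2) angleMeasure₃ := fun q =>
      (hf q).add (hg q)
    have hε : 0 ≤ 4 * r / κ := div_nonneg (by linarith [hr.1]) hκ.le
    calc _ ≤ ∫ p : (Fin 3 → ℝ) × (Fin 3 → ℝ), ∑ q ∈ Finset.univ.offDiag,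
          (nearMean (4 * r / κ) (Φ (i q.1) (j q.2)) q.1 q.2 p.1 +
          nearMean (4 * r / κ) (Ψ (j q.1) (i q.2)) q.1 q.2 p.2) ∂angleMeasure₃ :=
          integral_mono_of_nonneg (ae_of_all _ fun p => abs_nonneg _)
            (integrable_finsetSum _ fun q _ => hi q)
            (ae_of_all _ (h.abs_sidePoly_sub_le hr h6 i j))
      _ ≤ ∑ q ∈ (Finset.univ : Finset (Fin 3)).offDiag, (4 * r / κ + 4 * r / κ) := by
          rw [integral_finsetSum _ fun q _ => hi q]
          refine Finset.sum_le_sum fun q hq => ?_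
          rw [integral_add (hf q) (hg q), integral_fst_angleMeasure₃, integral_snd_angleMeasure₃]
          have hne := (Finset.mem_offDiag.1 hq).2.2
          exact add_le_add (integral_nearMean_le hε _ hne) (integral_nearMean_le hε _ hne)
      _ = 48 / κ * r := by
          rw [Finset.sum_const, Finset.offDiag_card]
          simp
          ring
  · calc _ ≤ ∫ _ : (Fin 3 → ℝ) × (Fin 3 → ℝ), (1 : ℝ) ∂angleMeasure₃ := by
          refine integral_mono_of_nonneg (ae_of_all _ fun p => abs_nonneg _) (integrable_const _)
            (ae_of_all _ fun p => ?_)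
          have h1 := sidePoly_mem_Icc (ends F G r i j p)
          have h2 := limitPoly_mem_Icc (Φ := Φ) (Ψ := Ψ) h.sign_eq i j p
          dsimp only
          rw [abs_le]
          constructor <;> linarith [h1.1, h1.2, h2.1, h2.2]
      _ ≤ 48 / κ * r := by
          rw [integral_const, probReal_univ, smul_eq_mul, one_mul, div_mul_eq_mul_div,
            le_div_iff₀ hκ]
          linarith [hr.1]

theorem abs_triangleProb_sub_le (h : LimitData F G Φ Ψ s κ) (hr : r ∈ Ioo 0 (π / 2)) :
    |triangleProb (circlePairsMeasure (F true).center (F false).center r)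
      (circlePairsMeasure (G true).center (G false).center r) -
      (2 ^ 11 : ℝ)⁻¹ * ∑ i, ∑ j, ∫ p, limitPoly Φ Ψ s i j p ∂angleMeasure₃| ≤ 3 / (2 * κ) * r := by
  rw [triangleProb_eq_sum F G hr, ← mul_sub, abs_mul, abs_of_nonneg (by norm_num),
    ← Finset.sum_sub_distrib]
  have : |∑ i : Fin 3 → Bool, (∑ j : Fin 3 → Bool, ∫ p, sidePoly (ends F G r i j p) ∂angleMeasure₃ -
      ∑ j : Fin 3 → Bool, ∫ p, limitPoly Φ Ψ s i j p ∂angleMeasure₃)| ≤ 64 * (48 / κ * r) := by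
    refine (Finset.abs_sum_le_sum_abs _ _).trans ?_
    calc _ ≤ ∑ _i : Fin 3 → Bool, ∑ _j : Fin 3 → Bool, 48 / κ * r := by
          refine Finset.sum_le_sum fun i _ => ?_
          rw [← Finset.sum_sub_distrib]
          exact (Finset.abs_sum_le_sum_abs _ _).trans
            (Finset.sum_le_sum fun j _ => h.integral_sidePoly_sub_le hr i j)
      _ = _ := by
          simp only [Finset.sum_const, Finset.card_univ, Fintype.card_fun, Fintype.card_bool,
            Fintype.card_fin, nsmul_eq_mul]
          norm_num
          ring
  calc _ ≤ (2 ^ 11 : ℝ)⁻¹ * (64 * (48 / κ * r)) := by gcongr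
    _ = _ := by ring

end LimitData

/-! ### Geometry of the centres -/

theorem linearIndependent_iff_trip_ne_zero (a b c : E3) :
    LinearIndependent ℝ ![a, b, c] ↔ trip a b c ≠ 0 := by
  let e := (WithLp.linearEquiv 2 ℝ (Fin 3 → ℝ))
  have h1 : LinearIndependent ℝ ![a, b, c] ↔ LinearIndependent ℝ (e ∘ ![a, b, c]) :=
    (LinearMap.linearIndependent_iff e.toLinearMap (LinearEquiv.ker e)).symm
  have h2 : (e ∘ ![a, b, c]) = (Matrix.of ![a.ofLp, b.ofLp, c.ofLp]).row := by
    funext k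
    fin_cases k <;> rfl
  rw [h1, h2, Matrix.linearIndependent_rows_iff_isUnit, Matrix.isUnit_iff_isUnit_det,
    isUnit_iff_ne_zero, Matrix.det_fin_three]
  simp only [Matrix.of_apply, Matrix.cons_val_zero, Matrix.cons_val_one, Matrix.cons_val, trip]
  rw [not_iff_not]
  constructor <;> intro h <;> linarith

theorem centresInGeneralPosition_iff (v₁ v₂ w₁ w₂ : S2) :
    CentresInGeneralPosition v₁ v₂ w₁ w₂ ↔ trip v₁ v₂ w₁ ≠ 0 ∧ trip v₁ v₂ w₂ ≠ 0 ∧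
      trip v₁ w₁ w₂ ≠ 0 ∧ trip v₂ w₁ w₂ ≠ 0 := by
  simp only [CentresInGeneralPosition, linearIndependent_iff_trip_ne_zero]

theorem inner_crossE_crossE (p x y : E3) :
    inner ℝ (crossE p x) (crossE p y) = inner ℝ p p * inner ℝ x y - inner ℝ p x * inner ℝ p y := by
  simp only [inner_E3, crossE]
  simp
  ring

theorem crossE_swap (a b : E3) : crossE b a = -crossE a b := by
  ext k
  fin_cases k <;> simp [crossE] <;> ring

theorem inner_sub_inner_smul {p : E3} (hp : ‖p‖ = 1) (x y : E3) :
    inner ℝ (x - inner ℝ p x • p) (y - inner ℝ p y • p) = inner ℝ (crossE p x) (crossE p y) := by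
  rw [inner_crossE_crossE]
  simp only [inner_sub_left, inner_sub_right, inner_smul_left, inner_smul_right,
    real_inner_self_eq_norm_sq, hp, real_inner_comm p x, conj_trivial]
  ring

theorem sphericalAngle_eq (x p y : S2) :
    sphericalAngle x p y = InnerProductGeometry.angle (crossE p x) (crossE p y) := by
  have hp : ‖(p : E3)‖ = 1 := by simp
  have hn : ∀ z : E3, ‖z - inner ℝ (p : E3) z • (p : E3)‖ = ‖crossE p z‖ := fun z => by
    rw [norm_eq_sqrt_real_inner, norm_eq_sqrt_real_inner, inner_sub_inner_smul hp]
  rw [sphericalAngle, InnerProductGeometry.angle, InnerProductGeometry.angle, hn, hn,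
    inner_sub_inner_smul hp]

theorem sphericalAngle_eq' (x p y : S2) :
    sphericalAngle x p y = InnerProductGeometry.angle (crossE x p) (crossE y p) := by
  rw [sphericalAngle_eq, crossE_swap (x : E3), crossE_swap (y : E3),
    InnerProductGeometry.angle_neg_neg]

theorem SphereFrame.phaseAngle_eq (F : SphereFrame) {n n' : E3} {φ φ' : ℝ}
    (hn : n = ‖n‖ • F.dir φ) (hn' : n' = ‖n'‖ • F.dir φ') (h : n ≠ 0) (h' : n' ≠ 0) :
    phaseAngle φ φ' = InnerProductGeometry.angle n n' / π := by
  have h1 : 0 < ‖n‖ := norm_pos_iff.2 h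
  have h2 : 0 < ‖n'‖ := norm_pos_iff.2 h'
  rw [hn, hn', InnerProductGeometry.angle_smul_left_of_pos _ _ h1,
    InnerProductGeometry.angle_smul_right_of_pos _ _ h2, InnerProductGeometry.angle,
    F.norm_dir, F.norm_dir, F.inner_dir_dir_eq, mul_one, div_one, phaseAngle]

theorem trip_smul_add_smul {a b c d : ℝ} {v₁ v₂ w₁ w₂ : E3}
    (h : a • v₁ + b • w₂ = c • v₂ + d • w₁) (x y : E3) :
    a * trip x v₁ y + b * trip x w₂ y = c * trip x v₂ y + d * trip x w₁ y := by
  have h' := fun k => congrArg (fun z : E3 => z k) h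
  have h0 := h' 0
  have h1 := h' 1
  have h2 := h' 2
  simp only [PiLp.add_apply, PiLp.smul_apply, smul_eq_mul] at h0 h1 h2
  unfold trip
  linear_combination (x 2 * y 1 - x 1 * y 2) * h0 + (x 0 * y 2 - x 2 * y 0) * h1 +
    (x 1 * y 0 - x 0 * y 1) * h2

theorem segmentsCross_iff (a b c d : S2) : SegmentsCross a b c d ↔
    ∃ s t s' t' : ℝ, 0 < s ∧ 0 < t ∧ 0 < s' ∧ 0 < t' ∧
      s • (a : E3) + t • (b : E3) = s' • (c : E3) + t' • (d : E3) ∧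
      ‖s • (a : E3) + t • (b : E3)‖ = 1 := by
  constructor
  · rintro ⟨p, ⟨s, t, hs, ht, h⟩, s', t', hs', ht', h'⟩
    exact ⟨s, t, s', t', hs, ht, hs', ht', h ▸ h', by rw [← h]; simp⟩
  · rintro ⟨s, t, s', t', hs, ht, hs', ht', h, h1⟩
    exact ⟨⟨s • (a : E3) + t • (b : E3), mem_sphere_zero_iff_norm.2 h1⟩, ⟨s, t, hs, ht, rfl⟩,
      s', t', hs', ht', h⟩

theorem exists_limitData (F G : Bool → SphereFrame)
    (hgp : CentresInGeneralPosition (F true).center (F false).center (G true).center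
      (G false).center)
    (hcr : SegmentsCross (F true).center (G false).center (F false).center (G true).center) :
    ∃ Φ Ψ s κ, LimitData F G Φ Ψ s κ := by
  rw [centresInGeneralPosition_iff] at hgp
  obtain ⟨h1, h2, h3, h4⟩ := hgp
  obtain ⟨a, b, c, d, ha, hb, hc, hd, h, -⟩ := (segmentsCross_iff _ _ _ _).1 hcr
  simp only [SphereFrame.center] at h1 h2 h3 h4 h
  have key := trip_smul_add_smul h
  choose Φ hΦ using fun i j => (F i).exists_eq_norm_smul_dir (inner_left_crossE (F i).c (G j).c)
  choose Ψ hΨ using fun j i => (G j).exists_eq_norm_smul_dir (inner_right_crossE (F i).c (G j).c)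
  have hcyc : ∀ x y z, trip x y z = trip y z x := fun x y z => by unfold trip; ring
  have hself : ∀ x y, trip x x y = 0 := fun x y => by unfold trip; ring
  have hself' : ∀ x y, trip x y y = 0 := fun x y => by unfold trip; ring
  have hanti : ∀ x y z, trip x z y = -trip x y z := fun x y z => by unfold trip; ring
  set v₁ := (F true).c
  set v₂ := (F false).c
  set w₁ := (G true).c
  set w₂ := (G false).c
  set D := trip v₁ v₂ w₁
  have e1 : b * trip v₁ v₂ w₂ = d * D := by
    have := key v₂ v₁
    rw [hself, hcyc v₂ v₁ v₁, hself, hanti, hanti v₂ v₁ w₁] at this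
    have q1 : trip v₂ v₁ w₂ = -trip v₁ v₂ w₂ := by unfold trip; ring
    have q2 : trip v₂ v₁ w₁ = -D := by unfold D trip; ring
    rw [q1, q2] at this
    linarith
  have e2 : b * trip v₁ w₁ w₂ = -(c * D) := by
    have := key v₁ w₁
    rw [hself, hself', hanti v₁ w₁ w₂] at this
    linarith
  have e3 : a * trip v₁ w₁ w₂ = c * trip v₂ w₁ w₂ := by
    have := key w₁ w₂
    rw [hself, hself', hanti w₁ w₂ v₁, hanti w₁ w₂ v₂, ← hcyc v₁, ← hcyc v₂] at this
    linarith
  obtain ⟨s, hs, hsD⟩ : ∃ s : ℝ, (s = 1 ∨ s = -1) ∧ 0 < s * D := by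
    rcases lt_or_gt_of_ne h1 with h | h
    · exact ⟨-1, Or.inr rfl, by linarith⟩
    · exact ⟨1, Or.inl rfl, by linarith⟩
  have p1 : 0 < s * trip v₁ v₂ w₂ := by
    have : 0 < b * (s * trip v₁ v₂ w₂) := by
      rw [show b * (s * trip v₁ v₂ w₂) = d * (s * D) by linear_combination s * e1]
      positivity
    exact pos_of_mul_pos_right this hb.le
  have p2 : 0 < s * -trip v₁ w₁ w₂ := by
    have : 0 < b * (s * -trip v₁ w₁ w₂) := by
      rw [show b * (s * -trip v₁ w₁ w₂) = c * (s * D) by linear_combination -s * e2]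
      positivity
    exact pos_of_mul_pos_right this hb.le
  have p3 : 0 < s * -trip v₂ w₁ w₂ := by
    have : 0 < c * (s * -trip v₂ w₁ w₂) := by
      rw [show c * (s * -trip v₂ w₁ w₂) = a * (s * -trip v₁ w₁ w₂) by linear_combination s * e3]
      positivity
    exact pos_of_mul_pos_right this hc.le
  set κ := min (min (s * D) (s * trip v₁ v₂ w₂)) (min (s * -trip v₁ w₁ w₂) (s * -trip v₂ w₁ w₂))
  have hκ : 0 < κ := lt_min (lt_min hsD p1) (lt_min p2 p3)
  have k1 : κ ≤ s * D := (min_le_left _ _).trans (min_le_left _ _)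
  have k2 : κ ≤ s * trip v₁ v₂ w₂ := (min_le_left _ _).trans (min_le_right _ _)
  have k3 : κ ≤ s * -trip v₁ w₁ w₂ := (min_le_right _ _).trans (min_le_left _ _)
  have k4 : κ ≤ s * -trip v₂ w₁ w₂ := (min_le_right _ _).trans (min_le_right _ _)
  have hfst : ∀ i i' j, i ≠ i' → κ ≤ s * boolSign i * trip (F i).c (F i').c (G j).c := by
    have hsw : ∀ x y z, trip y x z = -trip x y z := fun x y z => by unfold trip; ring
    have := hsw v₁ v₂
    intro i i' j hii
    cases i <;> cases i' <;> cases j <;> simp only [boolSign, ne_eq, not_true_eq_false] at hii ⊢ <;>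
      simp only [if_true, Bool.false_eq_true, if_false] <;> first
      | (change κ ≤ s * -1 * trip v₂ v₁ w₂; rw [hsw]; linarith)
      | (change κ ≤ s * -1 * trip v₂ v₁ w₁; rw [hsw]; change κ ≤ s * -1 * -D; linarith)
      | (change κ ≤ s * 1 * trip v₁ v₂ w₂; linarith)
      | (change κ ≤ s * 1 * D; linarith)
  have hsnd : ∀ j j' i, j ≠ j' → κ ≤ s * boolSign j * trip (G j).c (F i).c (G j').c := by
    have hsw : ∀ x y z, trip y x z = -trip x y z := fun x y z => by unfold trip; ring
    have hsw' : ∀ x y z, trip z x y = trip x y z := fun x y z => by unfold trip; ring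
    intro j j' i hjj
    cases j <;> cases j' <;> cases i <;> simp only [boolSign, ne_eq, not_true_eq_false] at hjj ⊢ <;>
      simp only [if_true, Bool.false_eq_true, if_false] <;> first
      | (change κ ≤ s * -1 * trip w₂ v₂ w₁; rw [hsw']; linarith)
      | (change κ ≤ s * -1 * trip w₂ v₁ w₁; rw [hsw']; linarith)
      | (change κ ≤ s * 1 * trip w₁ v₂ w₂; rw [hsw]; linarith)
      | (change κ ≤ s * 1 * trip w₁ v₁ w₂; rw [hsw]; linarith)
  refine ⟨Φ, Ψ, s, κ, hs, hκ, hΦ, fun i j => hΨ j i, fun i j => ?_, hfst, hsnd⟩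
  have h5 := hfst (!i) i j (by simp)
  have h6 : |trip (F !i).c (F i).c (G j).c| ≤ ‖crossE (F i).c (G j).c‖ := by
    rw [← inner_crossE]
    refine (abs_real_inner_le_norm _ _).trans ?_
    rw [(F !i).norm_c, one_mul]
  have h7 := abs_le.1 h6
  rcases mul_boolSign_eq hs (!i) with e | e <;> rw [e] at h5 <;> linarith

theorem exists_abs_triangleProb_sub_le {v₁ v₂ w₁ w₂ : S2}
    (hgp : CentresInGeneralPosition v₁ v₂ w₁ w₂) (hcr : SegmentsCross v₁ w₂ v₂ w₁) :
    ∃ C : ℝ, ∀ r ∈ Ioo (0 : ℝ) (π / 2),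
      |triangleProb (circlePairsMeasure v₁ v₂ r) (circlePairsMeasure w₁ w₂ r) -
        angleDensity (sphericalAngle v₂ w₂ v₁) (sphericalAngle w₂ v₂ w₁)
          (sphericalAngle w₁ v₁ w₂) (sphericalAngle v₁ w₁ v₂)| ≤ C * r := by
  let F : Bool → SphereFrame := fun b => SphereFrame.ofCenter (if b then v₁ else v₂)
  let G : Bool → SphereFrame := fun b => SphereFrame.ofCenter (if b then w₁ else w₂)
  have hF : (F true).center = v₁ := SphereFrame.ofCenter_center _
  have hF' : (F false).center = v₂ := SphereFrame.ofCenter_center _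
  have hG : (G true).center = w₁ := SphereFrame.ofCenter_center _
  have hG' : (G false).center = w₂ := SphereFrame.ofCenter_center _
  obtain ⟨Φ, Ψ, s, κ, h⟩ := exists_limitData F G (by rwa [hF, hF', hG, hG'])
    (by rwa [hF, hF', hG, hG'])
  refine ⟨3 / (2 * κ), fun r hr => ?_⟩
  have key := h.abs_triangleProb_sub_le hr
  rw [hF, hF', hG, hG', sum_integral_limitPoly h.sign_eq] at key
  have hne : ∀ i j, crossE (F i).c (G j).c ≠ 0 := fun i j =>
    norm_pos_iff.1 (h.pos.trans_le (h.le_norm i j))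
  have q1 := fun i => (F i).phaseAngle_eq (h.crossE_fst i true) (h.crossE_fst i false)
    (hne i true) (hne i false)
  have q2 := fun j => (G j).phaseAngle_eq (h.crossE_snd true j) (h.crossE_snd false j)
    (hne true j) (hne false j)
  rw [q1, q1, q2, q2] at key
  rw [sphericalAngle_eq' v₂ w₂ v₁, sphericalAngle_eq w₂ v₂ w₁, sphericalAngle_eq w₁ v₁ w₂,
    sphericalAngle_eq' v₁ w₁ v₂, InnerProductGeometry.angle_comm (crossE v₂ w₂),
    InnerProductGeometry.angle_comm (crossE v₂ w₂)]
  convert key using 3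
  change angleDensity (InnerProductGeometry.angle (crossE (F true).c (G false).c)
      (crossE (F false).c (G false).c))
    (InnerProductGeometry.angle (crossE (F false).c (G true).c) (crossE (F false).c (G false).c))
    (InnerProductGeometry.angle (crossE (F true).c (G true).c) (crossE (F true).c (G false).c))
    (InnerProductGeometry.angle (crossE (F true).c (G true).c) (crossE (F false).c (G true).c)) = _
  rw [angleDensity]
  field_simp
  ring

/-! ### Bounds for the limiting density -/

theorem angle_add_angle_add_angle_add_angle_le {m₁ m₂ m₃ m₄ : E3} (h : m₁ + m₃ = m₂ + m₄)
    (h₁ : m₁ ≠ 0) (h₃ : m₃ ≠ 0) :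
    InnerProductGeometry.angle m₁ m₂ + InnerProductGeometry.angle m₂ m₃ +
      InnerProductGeometry.angle m₃ m₄ + InnerProductGeometry.angle m₄ m₁ ≤ 2 * π := by
  have a1 := InnerProductGeometry.angle_add_angle_sub_add_angle_sub_eq_pi m₂ h₁
  have a2 := InnerProductGeometry.angle_add_angle_sub_add_angle_sub_eq_pi m₄ h₃
  have e1 : m₃ - m₄ = m₂ - m₁ := by
    rw [sub_eq_sub_iff_add_eq_add, add_comm, h]
  have e2 : m₄ - m₃ = m₁ - m₂ := by rw [← neg_sub, e1, neg_sub]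
  rw [e1, e2] at a2
  have t1 := InnerProductGeometry.angle_le_angle_add_angle m₂ (m₂ - m₁) m₃
  have t2 := InnerProductGeometry.angle_le_angle_add_angle m₄ (m₁ - m₂) m₁
  rw [InnerProductGeometry.angle_comm (m₂ - m₁) m₃] at t1
  rw [InnerProductGeometry.angle_comm (m₁ - m₂) m₁] at t2
  rw [InnerProductGeometry.angle_comm m₂ m₁] at a1
  rw [InnerProductGeometry.angle_comm m₄ m₃] at a2
  linarith

theorem sphericalAngle_mem_Icc (x p y : S2) : sphericalAngle x p y ∈ Icc 0 π :=
  ⟨InnerProductGeometry.angle_nonneg _ _, InnerProductGeometry.angle_le_pi _ _⟩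

theorem sum_sphericalAngle_le {v₁ v₂ w₁ w₂ : S2}
    (hgp : CentresInGeneralPosition v₁ v₂ w₁ w₂) (hcr : SegmentsCross v₁ w₂ v₂ w₁) :
    sphericalAngle v₂ w₂ v₁ + sphericalAngle w₂ v₂ w₁ + sphericalAngle w₁ v₁ w₂ +
      sphericalAngle v₁ w₁ v₂ ≤ 2 * π := by
  obtain ⟨a, b, c, d, ha, hb, hc, hd, h, -⟩ := (segmentsCross_iff _ _ _ _).1 hcr
  rw [centresInGeneralPosition_iff] at hgp
  have hne : ∀ x y z : E3, trip x y z ≠ 0 → crossE y z ≠ 0 := fun x y z h h0 => h (by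
    rw [← inner_crossE, h0, inner_zero_right])
  have hsm : ∀ (x y : ℝ) (p q : E3), crossE (x • p) (y • q) = (x * y) • crossE p q := by
    intro x y p q
    ext k
    fin_cases k <;> simp [crossE] <;> ring
  have hang : ∀ {x y x' y' : ℝ} (p q p' q' : E3), 0 < x → 0 < y → 0 < x' → 0 < y' →
      InnerProductGeometry.angle (crossE (x • p) (y • q)) (crossE (x' • p') (y' • q')) =
      InnerProductGeometry.angle (crossE p q) (crossE p' q') := by
    intro x y x' y' p q p' q' hx hy hx' hy'
    rw [hsm, hsm, InnerProductGeometry.angle_smul_left_of_pos _ _ (mul_pos hx hy),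
      InnerProductGeometry.angle_smul_right_of_pos _ _ (mul_pos hx' hy')]
  have hm : crossE (a • (v₁ : E3)) (d • (w₁ : E3)) + crossE (c • (v₂ : E3)) (b • (w₂ : E3)) =
      crossE (a • (v₁ : E3)) (b • (w₂ : E3)) + crossE (c • (v₂ : E3)) (d • (w₁ : E3)) := by
    have hv : a • (v₁ : E3) - c • (v₂ : E3) = d • (w₁ : E3) - b • (w₂ : E3) := by
      rw [sub_eq_sub_iff_add_eq_add, h, add_comm]
    generalize a • (v₁ : E3) = x at *
    generalize b • (w₂ : E3) = y at *
    generalize c • (v₂ : E3) = z at *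
    generalize d • (w₁ : E3) = u at *
    have hx : x = z + u - y := by rw [eq_sub_iff_add_eq]; exact h
    subst hx
    ext k
    fin_cases k <;> simp [crossE] <;> ring
  have key := angle_add_angle_add_angle_add_angle_le hm
    (by rw [hsm]; exact smul_ne_zero (mul_pos ha hd).ne' (hne v₂ _ _ (fun h0 => hgp.1 (by
      have : trip v₁ v₂ w₁ = -trip v₂ v₁ w₁ := by unfold trip; ring
      rw [this, h0, neg_zero]))))
    (by rw [hsm]; exact smul_ne_zero (mul_pos hc hb).ne' (hne v₁ _ _ hgp.2.1))
  rw [hang _ _ _ _ ha hd ha hb, hang _ _ _ _ ha hb hc hb, hang _ _ _ _ hc hb hc hd,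
    hang _ _ _ _ hc hd ha hd] at key
  rw [sphericalAngle_eq' v₂ w₂ v₁, sphericalAngle_eq w₂ v₂ w₁, sphericalAngle_eq w₁ v₁ w₂,
    sphericalAngle_eq' v₁ w₁ v₂, InnerProductGeometry.angle_comm (crossE v₂ w₂) (crossE v₁ w₂),
    InnerProductGeometry.angle_comm (crossE v₁ w₁) (crossE v₂ w₁)]
  linarith

theorem angleDensity_mem_Icc {α β γ δ : ℝ} (hα : α ∈ Icc 0 π) (hβ : β ∈ Icc 0 π)
    (hγ : γ ∈ Icc 0 π) (hδ : δ ∈ Icc 0 π) (h : α + β + γ + δ ≤ 2 * π) :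
    angleDensity α β γ δ ∈ Icc (83 / (3 * 2 ^ 12) : ℝ) (1 / (3 * 2 ^ 5)) := by
  have hπ := pi_pos
  set X := (2 * π - α - δ) * (2 * π - γ - β) + 2 * (α ^ 2 + β ^ 2 + γ ^ 2 + δ ^ 2) -
    2 * π * (α + β + γ + δ) with hX
  have hD : angleDensity α β γ δ = 3 / 2 ^ 12 * (X / π ^ 2) + 23 / (3 * 2 ^ 10) := by
    rw [angleDensity, ← hX]
    field_simp
  have h1 : -1 ≤ X / π ^ 2 := by
    rw [le_div_iff₀ (by positivity)]
    nlinarith [sq_nonneg (α - δ), sq_nonneg (γ - β), sq_nonneg (α + δ - γ - β),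
      mul_nonneg (sub_nonneg.2 h) hπ.le, sq_nonneg (2 * π - (α + β + γ + δ))]
  have h2 : X / π ^ 2 ≤ 4 := by
    rw [div_le_iff₀ (by positivity)]
    have q1 := mul_nonneg hα.1 (sub_nonneg.2 hα.2)
    have q2 := mul_nonneg hβ.1 (sub_nonneg.2 hβ.2)
    have q3 := mul_nonneg hγ.1 (sub_nonneg.2 hγ.2)
    have q4 := mul_nonneg hδ.1 (sub_nonneg.2 hδ.2)
    have hS : 0 ≤ α + β + γ + δ := by linarith [hα.1, hβ.1, hγ.1, hδ.1]
    have q5 := mul_nonneg hS (sub_nonneg.2 h)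
    nlinarith [sq_nonneg (α + δ - γ - β), mul_nonneg hS hπ.le]
  rw [hD]
  constructor <;> norm_num <;> linarith

/-! ### Change of signs of the centres -/

theorem circlePairsMeasure_neg_left (c₁ c₂ : S2) (r : ℝ) :
    circlePairsMeasure (-c₁) c₂ r = circlePairsMeasure c₁ c₂ r := by
  rw [circlePairsMeasure, circlePairsMeasure, neg_neg, add_comm (circleMeasure (-c₁) r)]

theorem circlePairsMeasure_neg_right (c₁ c₂ : S2) (r : ℝ) :
    circlePairsMeasure c₁ (-c₂) r = circlePairsMeasure c₁ c₂ r := by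
  rw [circlePairsMeasure, circlePairsMeasure, neg_neg, add_right_comm]

theorem segmentsCross_of_eq {v₁ v₂ w₁ w₂ : S2} {a b c d : ℝ} (ha : 0 < a) (hb : 0 < b) (hc : 0 < c)
    (hd : 0 < d) (h : a • (v₁ : E3) + b • (w₂ : E3) = c • (v₂ : E3) + d • (w₁ : E3))
    (hne : trip v₁ v₂ w₂ ≠ 0) : SegmentsCross v₁ w₂ v₂ w₁ := by
  set z := a • (v₁ : E3) + b • (w₂ : E3) with hz
  have h0 : 0 < ‖z‖ := by
    rw [norm_pos_iff]
    intro h0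
    apply hne
    have : a * trip v₁ v₂ w₂ = -trip v₂ z w₂ := by
      simp [trip, hz]
      ring
    rw [h0, show trip v₂ 0 w₂ = 0 by simp [trip], neg_zero] at this
    exact (mul_eq_zero.1 this).resolve_left ha.ne'
  refine (segmentsCross_iff _ _ _ _).2 ⟨a / ‖z‖, b / ‖z‖, c / ‖z‖, d / ‖z‖, by positivity,
    by positivity, by positivity, by positivity, ?_, ?_⟩
  · simp only [div_eq_inv_mul, mul_smul, ← smul_add]
    rw [← hz, h]
  · simp only [div_eq_inv_mul, mul_smul, ← smul_add]
    rw [← hz, norm_smul, norm_inv, norm_norm, inv_mul_cancel₀ h0.ne']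

theorem exists_crossing_signs {v₁ v₂ w₁ w₂ : S2} (hgp : CentresInGeneralPosition v₁ v₂ w₁ w₂) :
    ∃ v₁' v₂' w₁' w₂' : S2, CentresInGeneralPosition v₁' v₂' w₁' w₂' ∧
      SegmentsCross v₁' w₂' v₂' w₁' ∧
      (∀ r, circlePairsMeasure v₁' v₂' r = circlePairsMeasure v₁ v₂ r) ∧
      ∀ r, circlePairsMeasure w₁' w₂' r = circlePairsMeasure w₁ w₂ r := by
  rw [centresInGeneralPosition_iff] at hgp
  obtain ⟨h1, h2, h3, h4⟩ := hgp
  have hsgn : ∀ (c : ℝ) (v : S2), ∃ v' : S2, (v' = v ∨ v' = -v) ∧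
      c • (v : E3) = |c| • (v' : E3) := by
    intro c v
    rcases le_total 0 c with h | h
    · exact ⟨v, Or.inl rfl, by rw [abs_of_nonneg h]⟩
    · exact ⟨-v, Or.inr rfl, by rw [abs_of_nonpos h, coe_neg_sphere, neg_smul_neg]⟩
  obtain ⟨v₁', p1, q1⟩ := hsgn (trip v₂ w₁ w₂) v₁
  obtain ⟨v₂', p2, q2⟩ := hsgn (trip v₁ w₁ w₂) v₂
  obtain ⟨w₁', p3, q3⟩ := hsgn (-trip v₁ v₂ w₂) w₁
  obtain ⟨w₂', p4, q4⟩ := hsgn (-trip v₁ v₂ w₁) w₂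
  have hrel : |trip v₂ w₁ w₂| • (v₁' : E3) + |-trip v₁ v₂ w₁| • (w₂' : E3) =
      |trip v₁ w₁ w₂| • (v₂' : E3) + |-trip v₁ v₂ w₂| • (w₁' : E3) := by
    rw [← q1, ← q2, ← q3, ← q4]
    ext k
    fin_cases k <;> simp [trip] <;> ring
  have n1 : ∀ a b c : E3, trip (-a) b c = -trip a b c := fun a b c => by simp [trip]; ring
  have n2 : ∀ a b c : E3, trip a (-b) c = -trip a b c := fun a b c => by simp [trip]; ring
  have n3 : ∀ a b c : E3, trip a b (-c) = -trip a b c := fun a b c => by simp [trip]; ring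
  have hgp' : trip v₁' v₂' w₁' ≠ 0 ∧ trip v₁' v₂' w₂' ≠ 0 ∧ trip v₁' w₁' w₂' ≠ 0 ∧
      trip v₂' w₁' w₂' ≠ 0 := by
    rcases p1 with rfl | rfl <;> rcases p2 with rfl | rfl <;> rcases p3 with rfl | rfl <;>
    rcases p4 with rfl | rfl <;>
    simp only [coe_neg_sphere, n1, n2, n3, neg_neg, ne_eq, neg_eq_zero] <;>
    exact ⟨h1, h2, h3, h4⟩
  refine ⟨v₁', v₂', w₁', w₂', (centresInGeneralPosition_iff _ _ _ _).2 hgp',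
    segmentsCross_of_eq (abs_pos.2 h4) (abs_pos.2 (neg_ne_zero.2 h1)) (abs_pos.2 h3)
      (abs_pos.2 (neg_ne_zero.2 h2)) hrel hgp'.2.1, fun r => ?_, fun r => ?_⟩
  · rcases p1 with rfl | rfl <;> rcases p2 with rfl | rfl <;>
    simp only [circlePairsMeasure_neg_left, circlePairsMeasure_neg_right]
  · rcases p3 with rfl | rfl <;> rcases p4 with rfl | rfl <;>
    simp only [circlePairsMeasure_neg_left, circlePairsMeasure_neg_right]

theorem exists_triangleProb_bounds {v₁ v₂ w₁ w₂ : S2}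
    (hgp : CentresInGeneralPosition v₁ v₂ w₁ w₂) :
    ∃ C : ℝ, ∀ r ∈ Ioo (0 : ℝ) (π / 2),
      83 / (3 * 2 ^ 12) - C * r ≤
        triangleProb (circlePairsMeasure v₁ v₂ r) (circlePairsMeasure w₁ w₂ r) ∧
      triangleProb (circlePairsMeasure v₁ v₂ r) (circlePairsMeasure w₁ w₂ r) ≤
        1 / (3 * 2 ^ 5) + C * r := by
  obtain ⟨v₁', v₂', w₁', w₂', hgp', hcr, hv, hw⟩ := exists_crossing_signs hgp
  obtain ⟨C, hC⟩ := exists_abs_triangleProb_sub_le hgp' hcr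
  refine ⟨C, fun r hr => ?_⟩
  have h1 := abs_le.1 (hC r hr)
  have h2 := angleDensity_mem_Icc (sphericalAngle_mem_Icc v₂' w₂' v₁')
    (sphericalAngle_mem_Icc w₂' v₂' w₁') (sphericalAngle_mem_Icc w₁' v₁' w₂')
    (sphericalAngle_mem_Icc v₁' w₁' v₂') (sum_sphericalAngle_le hgp' hcr)
  rw [hv, hw] at h1
  constructor <;> linarith [h2.1, h2.2]

theorem IsCircleGraphon.triangleDensity_eq {v₁ v₂ w₁ w₂ : S2} {r : ℝ} (hr : r ∈ Ioo 0 (π / 2))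
    {W : Graphon} (hW : IsCircleGraphon v₁ v₂ w₁ w₂ r W) : triangleDensity W =
      triangleProb (circlePairsMeasure v₁ v₂ r) (circlePairsMeasure w₁ w₂ r) :=
  IsCrossingGraphon.triangleDensity_eq (nullOnGreatCircles_circlePairsMeasure _ _ hr)
    (nullOnGreatCircles_circlePairsMeasure _ _ hr) hW

theorem exists_isCircleGraphon (v₁ v₂ w₁ w₂ : S2) {r : ℝ} (hr : r ∈ Ioo 0 (π / 2)) :
    ∃ W, IsCircleGraphon v₁ v₂ w₁ w₂ r W :=
  exists_isCrossingGraphon (nullOnGreatCircles_circlePairsMeasure _ _ hr)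
    (nullOnGreatCircles_circlePairsMeasure _ _ hr)

/-! ### A family of centres with four equal angles -/

theorem eventually_sign_eq {x : ℝ} (hx : x ≠ 0) : ∀ᶠ y in 𝓝 x, Real.sign y = Real.sign x := by
  rcases lt_or_gt_of_ne hx with h | h
  · filter_upwards [eventually_lt_nhds h] with y hy
    rw [Real.sign_of_neg hy, Real.sign_of_neg h]
  · filter_upwards [eventually_gt_nhds h] with y hy
    rw [Real.sign_of_pos hy, Real.sign_of_pos h]

theorem continuousAt_sidePoly {E : Fin 3 → E3 × E3} (hE : EndsGeneric E) :
    ContinuousAt sidePoly E := by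
  have h1 : ∀ k l, Continuous fun E : Fin 3 → E3 × E3 => sideFst (E k) (E l) := fun k l => by
    unfold sideFst; fun_prop
  have h2 : ∀ k l, Continuous fun E : Fin 3 → E3 × E3 => sideSnd (E k) (E l) := fun k l => by
    unfold sideSnd; fun_prop
  have h : ∀ᶠ E' in 𝓝 E, ∀ k l, k ≠ l →
      (sideFst (E' k) (E' l)).sign = (sideFst (E k) (E l)).sign ∧
      (sideSnd (E' k) (E' l)).sign = (sideSnd (E k) (E l)).sign := by
    refine eventually_all.2 fun k => eventually_all.2 fun l => ?_
    by_cases hkl : k = l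
    · exact Eventually.of_forall fun _ h => absurd hkl h
    · filter_upwards [(h1 k l).continuousAt.eventually (eventually_sign_eq (hE k l hkl).1),
        (h2 k l).continuousAt.eventually (eventually_sign_eq (hE k l hkl).2)] with E' a b _
      exact ⟨a, b⟩
  refine (continuousAt_const (y := sidePoly E)).congr ?_
  filter_upwards [h] with E' hE'
  exact (triPoly_congr (fun k l hkl => (hE' k l hkl).1) fun k l hkl => (hE' k l hkl).2).symm

theorem continuous_triangleProb {F G : ℝ → Bool → SphereFrame} {r : ℝ} (hr : r ∈ Ioo 0 (π / 2))
    (hF : ∀ b θ, Continuous fun t => (F t b).vec r θ)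
    (hG : ∀ b θ, Continuous fun t => (G t b).vec r θ) :
    Continuous fun t => triangleProb
      (circlePairsMeasure (F t true).center (F t false).center r)
      (circlePairsMeasure (G t true).center (G t false).center r) := by
  simp only [fun t => triangleProb_eq_sum (F t) (G t) hr]
  refine continuous_const.mul (continuous_finsetSum _ fun i _ => continuous_finsetSum _ fun j _ =>
    continuous_iff_continuousAt.2 fun t => ?_)
  refine continuousAt_of_dominated (bound := fun _ => 1) (Eventually.of_forall fun t =>
    (measurable_sidePoly.comp (continuous_ends (F t) (G t) r i j).measurable).aestronglyMeasurable)
    (Eventually.of_forall fun t => ae_of_all _ fun p => ?_) (integrable_const _) ?_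
  · have := sidePoly_mem_Icc (ends (F t) (G t) r i j p)
    rw [Real.norm_of_nonneg this.1]
    exact this.2
  · filter_upwards [ae_endsGeneric (F t) (G t) hr i j] with p hp
    refine ContinuousAt.comp (g := sidePoly) (continuousAt_sidePoly hp) (Continuous.continuousAt ?_)
    unfold ends
    exact continuous_pi fun k => (hF _ _).prodMk (hG _ _)

/-- The vertices of a rectangle inscribed in the sphere, with four equal angles between its sides
and diagonals. -/
noncomputable def squareVec (a b : Bool) (t : ℝ) : E3 :=
  !₂[boolSign a * (sin t * (√2)⁻¹), boolSign b * cos t, sin t * (√2)⁻¹]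

theorem inv_sqrt_two_sq : (√2)⁻¹ * (√2)⁻¹ = (1 / 2 : ℝ) := by
  rw [← mul_inv, Real.mul_self_sqrt (by norm_num)]
  norm_num

theorem inner_squareVec (a b a' b' : Bool) (t : ℝ) :
    inner ℝ (squareVec a b t) (squareVec a' b' t) =
      (boolSign a * boolSign a' + 1) / 2 * sin t ^ 2 + boolSign b * boolSign b' * cos t ^ 2 := by
  rw [inner_E3]
  simp only [squareVec, PiLp.toLp_apply, Matrix.cons_val_zero, Matrix.cons_val_one, Matrix.cons_val]
  linear_combination (boolSign a * boolSign a' + 1) * sin t ^ 2 * inv_sqrt_two_sq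

theorem norm_eq_one_of_inner {x : E3} (h : inner ℝ x x = 1) : ‖x‖ = 1 := by
  rw [real_inner_self_eq_norm_sq] at h
  exact (pow_eq_one_iff_of_nonneg (norm_nonneg _) two_ne_zero).1 h

theorem norm_squareVec (a b : Bool) (t : ℝ) : ‖squareVec a b t‖ = 1 := by
  apply norm_eq_one_of_inner
  rw [inner_squareVec, boolSign_mul_self, boolSign_mul_self]
  linarith [sin_sq_add_cos_sq t]

/-- A unit vector orthogonal to `squareVec a b t`. -/
noncomputable def squareTangent (a : Bool) : E3 := !₂[(√2)⁻¹, 0, -(boolSign a * (√2)⁻¹)]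

theorem norm_squareTangent (a : Bool) : ‖squareTangent a‖ = 1 := by
  apply norm_eq_one_of_inner
  rw [inner_E3]
  simp only [squareTangent, PiLp.toLp_apply, Matrix.cons_val_zero, Matrix.cons_val_one,
    Matrix.cons_val]
  linear_combination (1 + boolSign a * boolSign a) * inv_sqrt_two_sq + 1 / 2 * boolSign_mul_self a

theorem inner_squareVec_squareTangent (a b : Bool) (t : ℝ) :
    inner ℝ (squareVec a b t) (squareTangent a) = 0 := by
  rw [inner_E3]
  simp only [squareVec, squareTangent, PiLp.toLp_apply, Matrix.cons_val_zero, Matrix.cons_val_one,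
    Matrix.cons_val]
  ring

/-- The frame at a vertex of the spherical rectangle. -/
noncomputable def squareFrame (a : Bool) (t : ℝ) (b : Bool) : SphereFrame where
  c := squareVec a b t
  e₀ := squareTangent a
  e₁ := crossE (squareVec a b t) (squareTangent a)
  norm_c := norm_squareVec a b t
  norm_e₀ := norm_squareTangent a
  norm_e₁ := by
    refine (pow_eq_one_iff_of_nonneg (norm_nonneg _) two_ne_zero).1 ?_
    rw [norm_crossE_sq, norm_squareVec, norm_squareTangent, inner_squareVec_squareTangent]
    norm_num
  inner_c_e₀ := inner_squareVec_squareTangent a b t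
  inner_c_e₁ := inner_left_crossE _ _
  inner_e₀_e₁ := inner_right_crossE _ _

theorem continuous_squareVec (a b : Bool) : Continuous (squareVec a b) := by
  refine (PiLp.continuous_toLp 2 _).comp (continuous_pi fun k => ?_)
  fin_cases k
  · exact continuous_const.mul (continuous_sin.mul continuous_const)
  · exact continuous_const.mul continuous_cos
  · exact continuous_sin.mul continuous_const

theorem continuous_crossE_const (y : E3) : Continuous fun x => crossE x y := by
  refine (PiLp.continuous_toLp 2 _).comp (continuous_pi fun k => ?_)
  fin_cases k <;> simp only [Fin.zero_eta, Fin.mk_one, Fin.reduceFinMk, Matrix.cons_val_zero,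
    Matrix.cons_val_one, Matrix.cons_val] <;> fun_prop

theorem continuous_squareFrame_vec (a b : Bool) (r θ : ℝ) :
    Continuous fun t => (squareFrame a t b).vec r θ := by
  have h1 := continuous_squareVec a b
  have h2 := (continuous_crossE_const (squareTangent a)).comp h1
  simp only [Function.comp_def] at h2
  simp only [SphereFrame.vec, SphereFrame.dir, squareFrame]
  fun_prop

/-- A vertex of the spherical rectangle. -/
noncomputable def squarePoint (a b : Bool) (t : ℝ) : S2 := (squareFrame a t b).center

theorem coe_squarePoint (a b : Bool) (t : ℝ) : (squarePoint a b t : E3) = squareVec a b t := rfl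

theorem continuous_triangleProb_square {r : ℝ} (hr : r ∈ Ioo 0 (π / 2)) :
    Continuous fun t => triangleProb
      (circlePairsMeasure (squarePoint true true t) (squarePoint true false t) r)
      (circlePairsMeasure (squarePoint false true t) (squarePoint false false t) r) :=
  continuous_triangleProb (F := squareFrame true) (G := squareFrame false) hr
    (fun b θ => continuous_squareFrame_vec true b r θ)
    fun b θ => continuous_squareFrame_vec false b r θ

theorem trip_squareVec (a b a' b' a'' b'' : Bool) (t : ℝ) :
    trip (squareVec a b t) (squareVec a' b' t) (squareVec a'' b'' t) =
      (boolSign a * (boolSign b' - boolSign b'') + boolSign a' * (boolSign b'' - boolSign b) +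
        boolSign a'' * (boolSign b - boolSign b')) / 2 * (sin t ^ 2 * cos t) := by
  simp only [trip, squareVec, PiLp.toLp_apply, Matrix.cons_val_zero, Matrix.cons_val_one,
    Matrix.cons_val]
  linear_combination (boolSign a * (boolSign b' - boolSign b'') +
    boolSign a' * (boolSign b'' - boolSign b) +
    boolSign a'' * (boolSign b - boolSign b')) * sin t ^ 2 * cos t * inv_sqrt_two_sq

theorem square_generalPosition {t : ℝ} (ht : t ∈ Ioo 0 (π / 2)) :
    CentresInGeneralPosition (squarePoint true true t) (squarePoint true false t)
      (squarePoint false true t) (squarePoint false false t) := by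
  have h1 : 0 < sin t := sin_pos_of_pos_of_lt_pi ht.1 (by linarith [ht.2, pi_pos])
  have h2 : 0 < cos t := cos_pos_of_mem_Ioo ⟨by linarith [ht.1, pi_pos], ht.2⟩
  have h3 : sin t ^ 2 * cos t ≠ 0 := by positivity
  rw [centresInGeneralPosition_iff]
  simp only [coe_squarePoint, trip_squareVec]
  refine ⟨mul_ne_zero ?_ h3, mul_ne_zero ?_ h3, mul_ne_zero ?_ h3, mul_ne_zero ?_ h3⟩ <;>
  norm_num [boolSign]

theorem square_segmentsCross {t : ℝ} (ht : t ∈ Ioo 0 (π / 2)) :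
    SegmentsCross (squarePoint true true t) (squarePoint false false t)
      (squarePoint true false t) (squarePoint false true t) := by
  refine segmentsCross_of_eq one_pos one_pos one_pos one_pos ?_
    ((centresInGeneralPosition_iff _ _ _ _).1 (square_generalPosition ht)).2.1
  simp only [coe_squarePoint, one_smul]
  ext k
  fin_cases k <;> simp [squareVec, boolSign]

/-- The cosine of the angles of the spherical rectangle. -/
noncomputable def squareCos (t : ℝ) : ℝ := sin t ^ 2 / (1 + cos t ^ 2)

theorem sphericalAngle_square {x p y : S2} {t : ℝ} (ht : t ∈ Ioo 0 (π / 2))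
    (hx : inner ℝ (p : E3) (x : E3) = cos t ^ 2) (hy : inner ℝ (p : E3) (y : E3) = -cos t ^ 2)
    (hxy : inner ℝ (x : E3) (y : E3) = sin t ^ 2 - cos t ^ 2) :
    sphericalAngle x p y = arccos (squareCos t) := by
  have h1 : 0 < sin t := sin_pos_of_pos_of_lt_pi ht.1 (by linarith [ht.2, pi_pos])
  have hsc := sin_sq_add_cos_sq t
  have hu : ∀ z : S2, inner ℝ (z : E3) (z : E3) = 1 := fun z => by
    rw [real_inner_self_eq_norm_sq]; simp
  have hn : 1 - (cos t ^ 2) ^ 2 = sin t ^ 2 * (1 + cos t ^ 2) := by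
    linear_combination -(1 + cos t ^ 2) * hsc
  have hnn : ∀ z : S2, inner ℝ (p : E3) (z : E3) ^ 2 = (cos t ^ 2) ^ 2 →
      ‖crossE p z‖ = √(sin t ^ 2 * (1 + cos t ^ 2)) := fun z hz => by
    rw [norm_eq_sqrt_real_inner, inner_crossE_crossE, hu, hu, ← hn, ← hz]
    ring_nf
  rw [sphericalAngle_eq, InnerProductGeometry.angle, hnn x (by rw [hx]), hnn y (by rw [hy]; ring),
    Real.mul_self_sqrt (by positivity), inner_crossE_crossE, hu, hx, hy, hxy, squareCos]
  congr 1
  rw [div_eq_div_iff (by positivity) (by positivity)]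
  linear_combination -(1 + cos t ^ 2) * (sin t ^ 2 - cos t ^ 2) * hsc

theorem angleDensity_square {t : ℝ} (ht : t ∈ Ioo 0 (π / 2)) :
    angleDensity
      (sphericalAngle (squarePoint true false t) (squarePoint false false t)
        (squarePoint true true t))
      (sphericalAngle (squarePoint false false t) (squarePoint true false t)
        (squarePoint false true t))
      (sphericalAngle (squarePoint false true t) (squarePoint true true t)
        (squarePoint false false t))
      (sphericalAngle (squarePoint true true t) (squarePoint false true t)
        (squarePoint true false t)) =
    angleDensity (arccos (squareCos t)) (arccos (squareCos t)) (arccos (squareCos t))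
      (arccos (squareCos t)) := by
  rw [sphericalAngle_square ht, sphericalAngle_square ht, sphericalAngle_square ht,
    sphericalAngle_square ht] <;>
  · simp only [coe_squarePoint, inner_squareVec, boolSign]
    norm_num
    try ring

theorem Ioo_subset_angleDensity_image :
    Ioo (83 / 12288 : ℝ) (128 / 12288) ⊆ (fun t => angleDensity (arccos (squareCos t))
      (arccos (squareCos t)) (arccos (squareCos t)) (arccos (squareCos t))) '' Ioo 0 (π / 2) := by
  have hc : Continuous squareCos := by
    unfold squareCos
    exact (by fun_prop : Continuous fun t => sin t ^ 2).div (by fun_prop) fun t => by positivity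
  have hf : Continuous fun t => angleDensity (arccos (squareCos t))
      (arccos (squareCos t)) (arccos (squareCos t)) (arccos (squareCos t)) := by
    unfold angleDensity
    have := continuous_arccos.comp hc
    simp only [Function.comp_def] at this
    fun_prop
  have h := intermediate_value_Ioo (by positivity : (0 : ℝ) ≤ π / 2) hf.continuousOn
  have hπ := pi_ne_zero
  have e0 : angleDensity (π / 2) (π / 2) (π / 2) (π / 2) = 83 / 12288 := by
    unfold angleDensity
    field_simp
    norm_num
  have e1 : angleDensity 0 0 0 0 = 128 / 12288 := by
    unfold angleDensity
    field_simp
    ring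
  simp only [squareCos, sin_zero, cos_zero, sin_pi_div_two, cos_pi_div_two] at h
  norm_num [e0, e1] at h
  norm_num
  exact h

/-! ### The main theorem -/

theorem exists_square_tendsto {x : ℝ} (hx : x ∈ Ioo (83 / 12288 : ℝ) (128 / 12288)) :
    ∃ t ∈ Ioo 0 (π / 2), ∃ C : ℝ, ∀ r ∈ Ioo (0 : ℝ) (π / 2),
      |triangleProb (circlePairsMeasure (squarePoint true true t) (squarePoint true false t) r)
        (circlePairsMeasure (squarePoint false true t) (squarePoint false false t) r) - x| ≤
        C * r := by
  obtain ⟨t, ht, hf⟩ := Ioo_subset_angleDensity_image hx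
  obtain ⟨C, hC⟩ := exists_abs_triangleProb_sub_le (square_generalPosition ht)
    (square_segmentsCross ht)
  refine ⟨t, ht, C, fun r hr => ?_⟩
  have := hC r hr
  rwa [angleDensity_square ht, show angleDensity _ _ _ _ = x from hf] at this

theorem exists_triangleProb_eq {x : ℝ} (hx : x ∈ Ioo (83 / 12288 : ℝ) (128 / 12288)) :
    ∃ r₀ > 0, r₀ ≤ π / 2 ∧ ∀ r ∈ Ioo (0 : ℝ) r₀, ∃ t ∈ Ioo 0 (π / 2),
      triangleProb (circlePairsMeasure (squarePoint true true t) (squarePoint true false t) r)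
        (circlePairsMeasure (squarePoint false true t) (squarePoint false false t) r) = x := by
  obtain ⟨t₁, ht₁, C₁, h₁⟩ := exists_square_tendsto (x := (83 / 12288 + x) / 2)
    ⟨by linarith [hx.1], by linarith [hx.1, hx.2]⟩
  obtain ⟨t₂, ht₂, C₂, h₂⟩ := exists_square_tendsto (x := (128 / 12288 + x) / 2)
    ⟨by linarith [hx.1, hx.2], by linarith [hx.2]⟩
  have hsmall : ∀ {C d : ℝ}, 0 < d → ∃ r₀ > 0, ∀ r ∈ Ioo (0 : ℝ) r₀, C * r < d := by
    intro C d hd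
    refine ⟨d / (|C| + 1), by positivity, fun r hr => ?_⟩
    have h := (lt_div_iff₀ (by positivity)).1 hr.2
    nlinarith [le_abs_self C, hr.1]
  obtain ⟨r₁, hr₁, q₁⟩ := hsmall (C := C₁) (d := (x - 83 / 12288) / 2) (by linarith [hx.1])
  obtain ⟨r₂, hr₂, q₂⟩ := hsmall (C := C₂) (d := (128 / 12288 - x) / 2) (by linarith [hx.2])
  refine ⟨min (min r₁ r₂) (π / 2), by positivity, min_le_right _ _, fun r hr => ?_⟩
  have hr' : r ∈ Ioo 0 (π / 2) := ⟨hr.1, hr.2.trans_le (min_le_right _ _)⟩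
  have a₁ := abs_le.1 (h₁ r hr')
  have a₂ := abs_le.1 (h₂ r hr')
  have b₁ := q₁ r ⟨hr.1, hr.2.trans_le ((min_le_left _ _).trans (min_le_left _ _))⟩
  have b₂ := q₂ r ⟨hr.1, hr.2.trans_le ((min_le_left _ _).trans (min_le_right _ _))⟩
  obtain ⟨t, ht, he⟩ := isPreconnected_Ioo.intermediate_value ht₁ ht₂
    (continuous_triangleProb_square hr').continuousOn
    (show x ∈ Icc _ _ from ⟨by linarith [a₁.2], by linarith [a₂.1]⟩)
  exact ⟨t, ht, he⟩

theorem exists_square_isCircleGraphon {x : ℝ} (hx : x ∈ Ioo (83 / 12288 : ℝ) (128 / 12288)) :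
    ∃ v₁ v₂ w₁ w₂ : S2, CentresInGeneralPosition v₁ v₂ w₁ w₂ ∧ ∃ C : ℝ,
      ∀ r ∈ Ioo (0 : ℝ) (π / 2), ∀ W, IsCircleGraphon v₁ v₂ w₁ w₂ r W →
        |triangleDensity W - x| ≤ C * r := by
  obtain ⟨t, ht, C, hC⟩ := exists_square_tendsto hx
  exact ⟨_, _, _, _, square_generalPosition ht, C, fun r hr W hW => by
    rw [hW.triangleDensity_eq hr]; exact hC r hr⟩

theorem le_of_forall_triangleDensity {v₁ v₂ w₁ w₂ : S2} {a b C C' : ℝ}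
    (h : ∀ r ∈ Ioo (0 : ℝ) (π / 2), ∀ W, IsCircleGraphon v₁ v₂ w₁ w₂ r W →
      a - C * r ≤ triangleDensity W)
    (h' : ∀ r ∈ Ioo (0 : ℝ) (π / 2), ∀ W, IsCircleGraphon v₁ v₂ w₁ w₂ r W →
      triangleDensity W ≤ b + C' * r) : a ≤ b := by
  have hl : Tendsto (fun r : ℝ => b + (C + C') * r) (𝓝[>] 0) (𝓝 (b + (C + C') * 0)) :=
    ((by fun_prop : Continuous fun r : ℝ => b + (C + C') * r).tendsto 0).mono_left
      nhdsWithin_le_nhds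
  rw [mul_zero, add_zero] at hl
  refine ge_of_tendsto hl ?_
  filter_upwards [Ioo_mem_nhdsGT (show (0 : ℝ) < π / 2 by positivity)] with r hr
  obtain ⟨W, hW⟩ := exists_isCircleGraphon v₁ v₂ w₁ w₂ hr
  linarith [h r hr W hW, h' r hr W hW]

theorem theorem6 :
    -- the limits `W(μ₁, μ₂)` exist
    (∀ v₁ v₂ w₁ w₂ : S2, CentresInGeneralPosition v₁ v₂ w₁ w₂ →
      ∀ r ∈ Ioo (0 : ℝ) (π / 2), ∃ W, IsCircleGraphon v₁ v₂ w₁ w₂ r W) ∧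
    -- the two bounds
    (∀ v₁ v₂ w₁ w₂ : S2, CentresInGeneralPosition v₁ v₂ w₁ w₂ →
      ∃ C : ℝ, ∀ r ∈ Ioo (0 : ℝ) (π / 2), ∀ W, IsCircleGraphon v₁ v₂ w₁ w₂ r W →
        83 / (3 * 2 ^ 12) - C * r ≤ triangleDensity W ∧
        triangleDensity W ≤ 1 / (3 * 2 ^ 5) + C * r) ∧
    -- the lower bound is best possible
    (∀ c : ℝ, (∀ v₁ v₂ w₁ w₂ : S2, CentresInGeneralPosition v₁ v₂ w₁ w₂ →
      ∃ C : ℝ, ∀ r ∈ Ioo (0 : ℝ) (π / 2), ∀ W, IsCircleGraphon v₁ v₂ w₁ w₂ r W →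
        c - C * r ≤ triangleDensity W) → c ≤ 83 / (3 * 2 ^ 12)) ∧
    -- the upper bound is best possible
    (∀ c : ℝ, (∀ v₁ v₂ w₁ w₂ : S2, CentresInGeneralPosition v₁ v₂ w₁ w₂ →
      ∃ C : ℝ, ∀ r ∈ Ioo (0 : ℝ) (π / 2), ∀ W, IsCircleGraphon v₁ v₂ w₁ w₂ r W →
        triangleDensity W ≤ c + C * r) → 1 / (3 * 2 ^ 5) ≤ c) ∧
    -- the dependence on the angles
    (∀ v₁ v₂ w₁ w₂ : S2, CentresInGeneralPosition v₁ v₂ w₁ w₂ → SegmentsCross v₁ w₂ v₂ w₁ →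
      ∃ C : ℝ, ∀ r ∈ Ioo (0 : ℝ) (π / 2), ∀ W, IsCircleGraphon v₁ v₂ w₁ w₂ r W →
        |triangleDensity W - angleDensity (sphericalAngle v₂ w₂ v₁) (sphericalAngle w₂ v₂ w₁)
          (sphericalAngle w₁ v₁ w₂) (sphericalAngle v₁ w₁ v₂)| ≤ C * r) ∧
    -- every value in the open interval is a limiting density as `r` tends to `0`
    (∀ x ∈ Ioo (83 / 12288 : ℝ) (128 / 12288),
      ∃ v₁ v₂ w₁ w₂ : S2, CentresInGeneralPosition v₁ v₂ w₁ w₂ ∧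
        ∀ W : ℝ → Graphon, (∀ r ∈ Ioo (0 : ℝ) (π / 2), IsCircleGraphon v₁ v₂ w₁ w₂ r (W r)) →
          Tendsto (fun r => triangleDensity (W r)) (𝓝[>] 0) (𝓝 x)) ∧
    -- every value in the open interval is the density of such a graphon, for all small `r`
    (∀ x ∈ Ioo (83 / 12288 : ℝ) (128 / 12288),
      ∃ r₀ > 0, ∀ r ∈ Ioo (0 : ℝ) r₀,
        ∃ v₁ v₂ w₁ w₂ : S2, CentresInGeneralPosition v₁ v₂ w₁ w₂ ∧
          ∃ W, IsCircleGraphon v₁ v₂ w₁ w₂ r W ∧ triangleDensity W = x) := by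
  refine ⟨fun v₁ v₂ w₁ w₂ _ r hr => exists_isCircleGraphon v₁ v₂ w₁ w₂ hr,
    fun v₁ v₂ w₁ w₂ hgp => ?_, fun c hc => ?_, fun c hc => ?_, fun v₁ v₂ w₁ w₂ hgp hcr => ?_,
    fun x hx => ?_, fun x hx => ?_⟩
  · obtain ⟨C, hC⟩ := exists_triangleProb_bounds hgp
    exact ⟨C, fun r hr W hW => by rw [hW.triangleDensity_eq hr]; exact hC r hr⟩
  · have hx : ∀ x ∈ Ioo (83 / 12288 : ℝ) (128 / 12288), c ≤ x := fun x hx => by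
      obtain ⟨v₁, v₂, w₁, w₂, hgp, C, hC⟩ := exists_square_isCircleGraphon hx
      obtain ⟨C', hC'⟩ := hc v₁ v₂ w₁ w₂ hgp
      exact le_of_forall_triangleDensity (C' := C) hC' fun r hr W hW => by
        linarith [(abs_le.1 (hC r hr W hW)).2]
    by_contra! hlt
    norm_num at hlt
    have h1 := hx (min ((83 / 12288 + c) / 2) (100 / 12288))
      ⟨lt_min (by linarith) (by norm_num), (min_le_right _ _).trans_lt (by norm_num)⟩
    linarith [h1.trans (min_le_left _ _)]
  · have hx : ∀ x ∈ Ioo (83 / 12288 : ℝ) (128 / 12288), x ≤ c := fun x hx => by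
      obtain ⟨v₁, v₂, w₁, w₂, hgp, C, hC⟩ := exists_square_isCircleGraphon hx
      obtain ⟨C', hC'⟩ := hc v₁ v₂ w₁ w₂ hgp
      exact le_of_forall_triangleDensity (C := C) (fun r hr W hW => by
        linarith [(abs_le.1 (hC r hr W hW)).1]) hC'
    by_contra! hlt
    norm_num at hlt
    have h1 := hx (max ((128 / 12288 + c) / 2) (100 / 12288))
      ⟨lt_max_of_lt_right (by norm_num), max_lt (by linarith) (by norm_num)⟩
    linarith [(le_max_left _ _).trans h1]
  · obtain ⟨C, hC⟩ := exists_abs_triangleProb_sub_le hgp hcr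
    exact ⟨C, fun r hr W hW => by rw [hW.triangleDensity_eq hr]; exact hC r hr⟩
  · obtain ⟨v₁, v₂, w₁, w₂, hgp, C, hC⟩ := exists_square_isCircleGraphon hx
    refine ⟨v₁, v₂, w₁, w₂, hgp, fun W hW => ?_⟩
    have hl : Tendsto (fun r : ℝ => C * r) (𝓝[>] 0) (𝓝 (C * 0)) :=
      ((continuous_const_mul C).tendsto 0).mono_left nhdsWithin_le_nhds
    rw [mul_zero] at hl
    refine tendsto_iff_norm_sub_tendsto_zero.2 (squeeze_zero' (Eventually.of_forall fun r =>
      norm_nonneg _) ?_ hl)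
    filter_upwards [Ioo_mem_nhdsGT (show (0 : ℝ) < π / 2 by positivity)] with r hr
    exact hC r hr (W r) (hW r hr)
  · obtain ⟨r₀, h0, h1, h⟩ := exists_triangleProb_eq hx
    refine ⟨r₀, h0, fun r hr => ?_⟩
    obtain ⟨t, ht, he⟩ := h r hr
    have hr' : r ∈ Ioo 0 (π / 2) := ⟨hr.1, hr.2.trans_le h1⟩
    obtain ⟨W, hW⟩ := exists_isCircleGraphon (squarePoint true true t) (squarePoint true false t)
      (squarePoint false true t) (squarePoint false false t) hr'
    exact ⟨_, _, _, _, square_generalPosition ht, W, hW, (hW.triangleDensity_eq hr').trans he⟩
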